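/- Let $n\ge 0$ be an integer, let $\mathbb E^n$ be $n$-dimensional Euclidean space and let $\Lambda\subset\mathbb E^n$ be a lattice (of rank $n$). For a polynomial $h$ on $\mathbb E^n$ put $$\Theta_{h;\Lambda}(z)=\sum_{\lambda\in\Lambda}h(\lambda)\,e^{2\pi i\|\lambda\|^2z}\qquad(z\in\mathbb H).$$ The space of homogeneous harmonic polynomials of degree two on $\mathbb E^n$, with the pairing $\langle p,q\rangle=p(\partial/\partial x_1,\dots,\partial/\partial x_n)\,q(x_1,\dots,x_n)$, is a Euclidean space of dimension $m=\frac{n^2+n-2}{2}$ (for $n=0$: $m=0$). For an orthonormal basis $\mathcal B=(h_1,\dots,h_m)$ of it put $$\det{}_{\mathcal B}\,\mathrm D\Theta_\Lambda(z)=\det\Big(\big(\tfrac1{2\pi i}\tfrac{\partial}{\partial z}\big)^{k}\,\Theta_{h_j;\Lambda}(z)\Big)_{0\le k\le m-1,\;1\le j\le m},\qquad \det{}^2\,\mathrm D\Theta_\Lambda=(\det{}_{\mathcal B}\,\mathrm D\Theta_\Lambda)^2 .$$ (1) The function $\det^2\mathrm D\Theta_\Lambda$ does not depend on $\mathcal B$,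 and it is a lattice invariant: $\det^2\mathrm D\Theta_{\varphi(\Lambda)}=\det^2\mathrm D\Theta_\Lambda$ for every $\varphi\in\mathrm O(n)$. (2) Let $A$ be the Gram matrix of $\Lambda$ with respect to any $\mathbb Z$-basis. The theta map sends a positive definite symmetric matrix $A$ to the function $\Theta_A(z)=\sum_{v\in\mathbb Z^n}e^{2\pi i({}^tvAv)z}$; its differential at $A$ sends a symmetric matrix $B$ to the function $z\mapsto\frac{d}{dt}\Theta_{A+tB}(z)\big|_{t=0}$, and this derivative exists for all $B$ and $z$. One has $\det^2\mathrm D\Theta_\Lambda=0$ if and only if the differential of the theta map is degenerate at $\Lambda$, that is, if and only if it vanishes at some $B\neq0$ in the hyperplane $T_A^0=\{B \text{ symmetric}: \mathrm{tr}(A^{-1}B)=0\}$ of deformations with fixed discriminant; equivalently, if and only if it vanishes at some symmetric $B\neq0$. (3) Suppose that $\Lambda$ is integral, i.e. $\|\lambda\|^2\in\mathbb Z$ for all $\lambda\in\Lambda$, and of level $N$, i.e. $N$ is the least positive integer such that $N(2A)^{-1}$ is an integral matrix with even diagonal. Then $\det^2\mathrm D\Theta_\Lambda$ is a modular form of weight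 $k=\frac{(n+2)^2n(n-1)}{2}$ for $\Gamma_0(N)$. Here the character is trivial if $n\not\equiv3\pmod 4$, and it is $\begin{pmatrix}a&b\\c&d\end{pmatrix}\mapsto\left(\frac{-1}{d}\right)$ if $n\equiv3\pmod4$. That is, $\det^2\mathrm D\Theta_\Lambda$ is holomorphic on $\mathbb H$ and at all cusps, and $\det^2\mathrm D\Theta_\Lambda(\gamma z)=\chi(d)(cz+d)^k\det^2\mathrm D\Theta_\Lambda(z)$ for $\gamma=\begin{pmatrix}a&b\\c&d\end{pmatrix}\in\Gamma_0(N)$, with this character $\chi$. -/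

import Mathlib

open scoped MatrixGroups ModularForm UpperHalfPlane RealInnerProductSpace

namespace ThetaMap

noncomputable section

/-! ### Harmonic quadratic forms and the differentiation pairing -/

/-- The Laplace operator `∑ᵢ ∂²/∂xᵢ²` on real polynomials in `n` variables. -/
def laplacian (n : ℕ) : MvPolynomial (Fin n) ℝ →ₗ[ℝ] MvPolynomial (Fin n) ℝ :=
  ∑ i, (MvPolynomial.pderiv i).toLinearMap ∘ₗ (MvPolynomial.pderiv i).toLinearMap

/-- The space of homogeneous harmonic polynomials of degree two in `n` variables. -/
def harmonicQuadratic (n : ℕ) : Submodule ℝ (MvPolynomial (Fin n) ℝ) :=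
  MvPolynomial.homogeneousSubmodule (Fin n) ℝ 2 ⊓ LinearMap.ker (laplacian n)

/-- The differential operator `∂^s = ∏ᵢ (∂/∂xᵢ)^(sᵢ)` on polynomials. -/
def partialMonomial {n : ℕ} (s : Fin n →₀ ℕ) : Module.End ℝ (MvPolynomial (Fin n) ℝ) :=
  ((List.finRange n).map fun i => ((MvPolynomial.pderiv i).toLinearMap :
    Module.End ℝ (MvPolynomial (Fin n) ℝ)) ^ s i).prod

/-- `p(∂/∂x₁, …, ∂/∂xₙ) q`. -/
def applyDiffOp {n : ℕ} (p q : MvPolynomial (Fin n) ℝ) : MvPolynomial (Fin n) ℝ :=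
  ∑ s ∈ p.support, p.coeff s • partialMonomial s q

/-- The pairing `⟨p, q⟩ = p(∂/∂x₁, …, ∂/∂xₙ) q(x₁, …, xₙ)`. When `p` and `q` are homogeneous of
the same degree (the only case used) the right-hand side is a constant polynomial, and the pairing
is that constant. -/
def diffPairing {n : ℕ} (p q : MvPolynomial (Fin n) ℝ) : ℝ :=
  MvPolynomial.constantCoeff (applyDiffOp p q)

/-- The dimension `m = (n² + n - 2) / 2` of `harmonicQuadratic n`
(for `n = 0` the truncated subtraction gives the correct value `0`). -/
def harmonicDim (n : ℕ) : ℕ := (n ^ 2 + n - 2) / 2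

/-- `h₁, …, hₘ` is an orthonormal basis of the space of homogeneous harmonic polynomials of
degree two. -/
structure IsHarmonicONB (n : ℕ) (h : Fin (harmonicDim n) → MvPolynomial (Fin n) ℝ) : Prop where
  mem : ∀ i, h i ∈ harmonicQuadratic n
  pairing_eq : ∀ i j, diffPairing (h i) (h j) = if i = j then 1 else 0
  span_eq : Submodule.span ℝ (Set.range h) = harmonicQuadratic n

/-! Orthonormal bases exist. -/

theorem coeff_pderiv_pow {n : ℕ} (i : Fin n) (k : ℕ) (t : Fin n →₀ ℕ) (ht : t i = 0)
    (q : MvPolynomial (Fin n) ℝ) :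
    ((((MvPolynomial.pderiv i).toLinearMap : Module.End ℝ (MvPolynomial (Fin n) ℝ)) ^ k) q).coeff t
      = (k.factorial : ℝ) * q.coeff (t + Finsupp.single i k) := by
  induction k generalizing q with
  | zero => simp
  | succ k ih =>
    rw [pow_succ, Module.End.mul_apply, ih]
    change _ * MvPolynomial.coeff _ (MvPolynomial.pderiv i q) = _
    rw [MvPolynomial.coeff_pderiv, add_assoc, ← Finsupp.single_add]
    simp [ht, Nat.factorial_succ]
    ring

theorem coeff_prod_pderiv_pow {n : ℕ} (s : Fin n →₀ ℕ) (l : List (Fin n)) (hl : l.Nodup)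
    (t : Fin n →₀ ℕ) (ht : ∀ i ∈ l, t i = 0) (q : MvPolynomial (Fin n) ℝ) :
    (((l.map fun i => ((MvPolynomial.pderiv i).toLinearMap :
      Module.End ℝ (MvPolynomial (Fin n) ℝ)) ^ s i).prod) q).coeff t
      = ((l.map fun i => ((s i).factorial : ℝ)).prod) *
        q.coeff (t + (l.map fun i => Finsupp.single i (s i)).sum) := by
  induction l generalizing t with
  | nil => simp
  | cons a l ih =>
    rw [List.nodup_cons] at hl
    simp only [List.map_cons, List.prod_cons, List.sum_cons, Module.End.mul_apply]
    rw [coeff_pderiv_pow _ _ _ (ht a (by simp)), ih hl.2]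
    · rw [add_assoc, mul_assoc]
    · intro i hi
      have : a ≠ i := fun h => hl.1 (h ▸ hi)
      simp [ht i (by simp [hi]), this]

theorem constantCoeff_partialMonomial {n : ℕ} (s : Fin n →₀ ℕ) (q : MvPolynomial (Fin n) ℝ) :
    MvPolynomial.constantCoeff (partialMonomial s q) =
      (∏ i, ((s i).factorial : ℝ)) * q.coeff s := by
  rw [partialMonomial, MvPolynomial.constantCoeff_eq,
    coeff_prod_pderiv_pow s _ (List.nodup_finRange n) 0 (by simp), ← List.ofFn_eq_map,
    ← List.ofFn_eq_map, List.prod_ofFn, List.sum_ofFn, Finsupp.univ_sum_single, zero_add]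

theorem diffPairing_eq {n : ℕ} (p q : MvPolynomial (Fin n) ℝ) :
    diffPairing p q =
      ∑ s ∈ p.support, p.coeff s * ((∏ i, ((s i).factorial : ℝ)) * q.coeff s) := by
  simp [diffPairing, applyDiffOp, map_sum, MvPolynomial.smul_eq_C_mul,
    constantCoeff_partialMonomial]

theorem diffPairing_eq_of_subset {n : ℕ} (p q : MvPolynomial (Fin n) ℝ)
    (T : Finset (Fin n →₀ ℕ)) (hT : p.support ⊆ T) :
    diffPairing p q = ∑ s ∈ T, p.coeff s * ((∏ i, ((s i).factorial : ℝ)) * q.coeff s) := by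
  rw [diffPairing_eq]
  refine Finset.sum_subset hT fun s _ hs => ?_
  simp [MvPolynomial.notMem_support_iff.mp hs]

theorem finrank_homogeneous_two (n : ℕ) :
    Module.finrank ℝ (MvPolynomial.homogeneousSubmodule (Fin n) ℝ 2) = n * (n + 1) / 2 := by
  have e1 := (AddMonoidAlgebra.supportedEquivFinsupp (R := ℝ) (S := ℝ)
    {d : Fin n →₀ ℕ | d.degree = 2}).finrank_eq
  have e2 : Sym (Fin n) 2 ≃ {d : Fin n →₀ ℕ | d.degree = 2} :=
    (Sym.equivNatSum (Fin n) 2).trans (Equiv.subtypeEquivRight fun d => by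
      simp only [Finsupp.sum, id]
      rfl)
  have : Fintype {d : Fin n →₀ ℕ | d.degree = 2} := Fintype.ofEquiv _ e2
  rw [MvPolynomial.homogeneousSubmodule_eq_finsupp_supported]
  refine e1.trans ?_
  rw [Module.finrank_finsupp_self, ← Fintype.card_congr e2, Sym.card_sym_eq_choose,
    Nat.choose_two_right]
  simp [mul_comm]

theorem coeff_laplacian {n : ℕ} (p : MvPolynomial (Fin n) ℝ) (d : Fin n →₀ ℕ) :
    (laplacian n p).coeff d =
      ∑ i, p.coeff (d + Finsupp.single i 2) * ((d i + 2) * (d i + 1)) := by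
  simp only [laplacian, LinearMap.sum_apply, MvPolynomial.coeff_sum]
  refine Finset.sum_congr rfl fun i _ => ?_
  change MvPolynomial.coeff d (MvPolynomial.pderiv i (MvPolynomial.pderiv i p)) = _
  rw [MvPolynomial.coeff_pderiv, MvPolynomial.coeff_pderiv, add_assoc, ← Finsupp.single_add]
  simp
  ring

/-- The constant term of the Laplacian of a homogeneous polynomial of degree two. -/
def laplacianFunctional (n : ℕ) : MvPolynomial.homogeneousSubmodule (Fin n) ℝ 2 →ₗ[ℝ] ℝ :=
  (MvPolynomial.lcoeff ℝ (0 : Fin n →₀ ℕ)) ∘ₗ (laplacian n) ∘ₗ Submodule.subtype _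

theorem harmonicQuadratic_eq_map (n : ℕ) :
    harmonicQuadratic n = (LinearMap.ker (laplacianFunctional n)).map (Submodule.subtype _) := by
  ext p
  simp only [harmonicQuadratic, Submodule.mem_inf, LinearMap.mem_ker, Submodule.mem_map,
    Submodule.subtype_apply, Subtype.exists, exists_and_right, exists_eq_right]
  constructor
  · rintro ⟨h1, h2⟩
    refine ⟨h1, ?_⟩
    simp [laplacianFunctional, h2]
  · rintro ⟨h1, h2⟩
    refine ⟨h1, ?_⟩
    ext d
    by_cases hd : d = 0
    · subst hd
      simpa [laplacianFunctional] using h2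
    · rw [coeff_laplacian, MvPolynomial.coeff_zero]
      refine Finset.sum_eq_zero fun i _ => ?_
      have h3 : (d + Finsupp.single i 2).degree ≠ 2 := by
        have : d.degree ≠ 0 := by simpa [Finsupp.degree_eq_zero_iff] using hd
        rw [map_add, Finsupp.degree_single]
        omega
      rw [((MvPolynomial.mem_homogeneousSubmodule _ _).mp h1).coeff_eq_zero h3, zero_mul]

theorem finrank_harmonicQuadratic (n : ℕ) :
    Module.finrank ℝ (harmonicQuadratic n) = harmonicDim n := by
  have h0 := finrank_homogeneous_two n
  have : FiniteDimensional ℝ (MvPolynomial.homogeneousSubmodule (Fin n) ℝ 2) :=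
    Module.Finite.iff_fg.mpr (MvPolynomial.homogeneousSubmodule_fg _ _ 2)
  have h1 := LinearMap.finrank_range_add_finrank_ker (laplacianFunctional n)
  rw [harmonicQuadratic_eq_map,
    ((LinearMap.ker (laplacianFunctional n)).equivMapOfInjective _
      (Submodule.injective_subtype _)).symm.finrank_eq, harmonicDim]
  rw [h0] at h1
  rcases Nat.eq_zero_or_pos n with rfl | hn
  · have h2 : (0 ^ 2 + 0 - 2) / 2 = 0 := rfl
    rw [Nat.zero_mul, Nat.zero_div] at h1
    omega
  · have h2 : Function.Surjective (laplacianFunctional n) := by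
      apply LinearMap.surjective
      intro h3
      have h4 := LinearMap.congr_fun h3
        ⟨MvPolynomial.monomial (Finsupp.single ⟨0, hn⟩ 2) 1,
          (MvPolynomial.mem_homogeneousSubmodule _ _).mpr
            (MvPolynomial.isHomogeneous_monomial _ (by simp))⟩
      simp [laplacianFunctional, coeff_laplacian, MvPolynomial.coeff_monomial,
        Finsupp.single_left_inj] at h4
    rw [LinearMap.range_eq_top.mpr h2, finrank_top, Module.finrank_self] at h1
    have : n ^ 2 + n - 2 = n * (n + 1) - 2 := by ring_nf
    omega

theorem exists_isHarmonicONB (n : ℕ) : ∃ h, IsHarmonicONB n h := by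
  let V := harmonicQuadratic n
  let S : MvPolynomial (Fin n) ℝ → MvPolynomial (Fin n) ℝ → Finset (Fin n →₀ ℕ) :=
    fun p q => p.support ∪ q.support
  let core : InnerProductSpace.Core ℝ V :=
    { inner := fun p q => diffPairing (p : MvPolynomial (Fin n) ℝ) q
      conj_inner_symm := fun p q => by
        classical
        change diffPairing _ _ = diffPairing _ _
        rw [diffPairing_eq_of_subset _ _ ((q : MvPolynomial (Fin n) ℝ).support ∪
            (p : MvPolynomial (Fin n) ℝ).support) Finset.subset_union_left,
          diffPairing_eq_of_subset _ _ ((q : MvPolynomial (Fin n) ℝ).support ∪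
            (p : MvPolynomial (Fin n) ℝ).support) Finset.subset_union_right]
        exact Finset.sum_congr rfl fun s _ => by ring
      re_inner_nonneg := fun p => by
        change 0 ≤ diffPairing _ _
        rw [diffPairing_eq]
        refine Finset.sum_nonneg fun s _ => ?_
        nlinarith [mul_nonneg (Finset.prod_nonneg (s := Finset.univ)
          (f := fun i => ((s i).factorial : ℝ)) fun i _ => Nat.cast_nonneg _)
          (mul_self_nonneg ((p : MvPolynomial (Fin n) ℝ).coeff s))]
      add_left := fun p q r => by
        classical
        change diffPairing _ _ = diffPairing _ _ + diffPairing _ _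
        let T := ((p + q : V) : MvPolynomial (Fin n) ℝ).support ∪
          (p : MvPolynomial (Fin n) ℝ).support ∪ (q : MvPolynomial (Fin n) ℝ).support
        rw [diffPairing_eq_of_subset _ _ T
            (Finset.subset_union_left.trans Finset.subset_union_left),
          diffPairing_eq_of_subset _ _ T
            (Finset.subset_union_right.trans Finset.subset_union_left),
          diffPairing_eq_of_subset _ _ T Finset.subset_union_right, ← Finset.sum_add_distrib]
        exact Finset.sum_congr rfl fun s _ => by simp; ring
      smul_left := fun p q r => by
        classical
        change diffPairing _ _ = r * diffPairing _ _
        let T := ((r • p : V) : MvPolynomial (Fin n) ℝ).support ∪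
          (p : MvPolynomial (Fin n) ℝ).support
        rw [diffPairing_eq_of_subset _ _ T Finset.subset_union_left,
          diffPairing_eq_of_subset _ _ T Finset.subset_union_right, Finset.mul_sum]
        exact Finset.sum_congr rfl fun s _ => by simp; ring
      definite := fun p hp => by
        change diffPairing _ _ = 0 at hp
        rw [diffPairing_eq, Finset.sum_eq_zero_iff_of_nonneg] at hp
        · ext s
          by_contra hs
          have h1 := hp s (MvPolynomial.mem_support_iff.mpr hs)
          have h2 : (∏ i, ((s i).factorial : ℝ)) ≠ 0 :=
            Finset.prod_ne_zero_iff.mpr fun i _ => Nat.cast_ne_zero.mpr (Nat.factorial_ne_zero _)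
          simp_all
        · intro s _
          nlinarith [mul_nonneg (Finset.prod_nonneg (s := Finset.univ)
            (f := fun i => ((s i).factorial : ℝ)) fun i _ => Nat.cast_nonneg _)
            (mul_self_nonneg ((p : MvPolynomial (Fin n) ℝ).coeff s))] }
  let _ : NormedAddCommGroup V := core.toNormedAddCommGroup
  let _ : InnerProductSpace ℝ V := InnerProductSpace.ofCore core.toCore
  have : FiniteDimensional ℝ V := by
    have : FiniteDimensional ℝ (MvPolynomial.homogeneousSubmodule (Fin n) ℝ 2) :=
      Module.Finite.iff_fg.mpr (MvPolynomial.homogeneousSubmodule_fg _ _ 2)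
    exact Submodule.finiteDimensional_of_le (inf_le_left :
      harmonicQuadratic n ≤ MvPolynomial.homogeneousSubmodule (Fin n) ℝ 2)
  let b := (stdOrthonormalBasis ℝ V).reindex (finCongr (finrank_harmonicQuadratic n))
  refine ⟨fun i => (b i : MvPolynomial (Fin n) ℝ), fun i => (b i).2, fun i j => ?_, ?_⟩
  · exact orthonormal_iff_ite.mp b.orthonormal i j
  · have h1 := b.toBasis.span_eq
    rw [OrthonormalBasis.coe_toBasis] at h1
    have h2 := congrArg (Submodule.map (Submodule.subtype _)) h1
    rw [Submodule.map_span, ← Set.range_comp, Submodule.map_top, Submodule.range_subtype] at h2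
    exact h2

/-- A chosen orthonormal basis of the homogeneous harmonic polynomials of degree two. -/
def harmonicONB (n : ℕ) : Fin (harmonicDim n) → MvPolynomial (Fin n) ℝ :=
  (exists_isHarmonicONB n).choose

/-! ### Theta series and the determinant of their derivatives -/

/-- The theta series `Θ_{h;Λ}(z) = ∑_{λ ∈ Λ} h(λ) exp(2πi‖λ‖²z)`. -/
def harmonicTheta {n : ℕ} (Λ : Submodule ℤ (EuclideanSpace ℝ (Fin n)))
    (h : MvPolynomial (Fin n) ℝ) (z : ℍ) : ℂ :=
  ∑' v : Λ, ((MvPolynomial.eval (fun i => (v : EuclideanSpace ℝ (Fin n)) i) h : ℝ) : ℂ) *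
    Complex.exp (2 * Real.pi * Complex.I * ((‖(v : EuclideanSpace ℝ (Fin n))‖ ^ 2 : ℝ) : ℂ) * z)

/-- The determinant `det_𝓑 DΘ_Λ` attached to a family `𝓑 = (h₁, …, hₘ)`: its `(k, j)` entry is
`(1/(2πi) ∂/∂z)^k Θ_{h_j;Λ}`, where `0 ≤ k ≤ m - 1`. -/
def detDTheta {n : ℕ} (Λ : Submodule ℤ (EuclideanSpace ℝ (Fin n)))
    (h : Fin (harmonicDim n) → MvPolynomial (Fin n) ℝ) (z : ℍ) : ℂ :=
  Matrix.det (Matrix.of fun k j : Fin (harmonicDim n) =>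
    (Derivative.normalizedDerivOfComplex)^[(k : ℕ)] (harmonicTheta Λ (h j)) z)

/-- `det² DΘ_Λ`, computed in a chosen orthonormal basis. -/
def detSqDTheta {n : ℕ} (Λ : Submodule ℤ (EuclideanSpace ℝ (Fin n))) (z : ℍ) : ℂ :=
  detDTheta Λ (harmonicONB n) z ^ 2

/-! ### The theta map and its differential -/

/-- The theta map `A ↦ Θ_A`, `Θ_A(z) = ∑_{v ∈ ℤⁿ} exp(2πi(ᵗv A v)z)`. -/
def thetaMap {n : ℕ} (A : Matrix (Fin n) (Fin n) ℝ) (z : ℍ) : ℂ :=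
  ∑' v : Fin n → ℤ, Complex.exp (2 * Real.pi * Complex.I *
    ((dotProduct (fun i => (v i : ℝ)) (A.mulVec fun i => (v i : ℝ)) : ℝ) : ℂ) * z)

/-- The differential of the theta map at `A` in the direction `B`: the function
`z ↦ d/dt Θ_{A + tB}(z)` at `t = 0`. -/
def thetaDifferential {n : ℕ} (A B : Matrix (Fin n) (Fin n) ℝ) (z : ℍ) : ℂ :=
  lineDeriv ℝ (fun A' => thetaMap A' z) A B

/-- The hyperplane `T_A⁰` of the tangent space `T_A = Quad_n(ℝ)`: the symmetric matrices `B` with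
`tr(A⁻¹ B) = 0`, that is, the infinitesimal deformations with fixed discriminant. -/
def tangentZero {n : ℕ} (A : Matrix (Fin n) (Fin n) ℝ) : Set (Matrix (Fin n) (Fin n) ℝ) :=
  {B | B.IsSymm ∧ (A⁻¹ * B).trace = 0}

/-- The quadratic form (Gram matrix) of a lattice with respect to a `ℤ`-basis `b`. -/
def latticeGram {n : ℕ} {Λ : Submodule ℤ (EuclideanSpace ℝ (Fin n))}
    (b : Module.Basis (Fin n) ℤ Λ) : Matrix (Fin n) (Fin n) ℝ :=
  Matrix.gram ℝ fun i => (b i : EuclideanSpace ℝ (Fin n))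

/-! ### Integral lattices and their level -/

/-- `Λ` is integral: its quadratic form `v ↦ ‖v‖²` takes integer values, equivalently
`Θ_Λ ∈ ℤ[[q]]`. -/
def IsIntegralLattice {n : ℕ} (Λ : Submodule ℤ (EuclideanSpace ℝ (Fin n))) : Prop :=
  ∀ v ∈ Λ, ∃ k : ℤ, ‖v‖ ^ 2 = k

/-- `N` is the level of the integral lattice `Λ` with Gram matrix `A`: the least positive integer
`N` such that `N (2A)⁻¹` is integral with even diagonal. Equivalently, in terms of the dual
lattice `Λ'` for the polar form `2⟪v, w⟫` of `‖v‖²`, the least `N > 0` such that `N‖w‖²` is an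
integer for all `w ∈ Λ'`. -/
def IsLevel {n : ℕ} (Λ : Submodule ℤ (EuclideanSpace ℝ (Fin n))) (N : ℕ) : Prop :=
  IsLeast {M : ℕ | 0 < M ∧ ∀ w : EuclideanSpace ℝ (Fin n),
    (∀ v ∈ Λ, ∃ k : ℤ, 2 * ⟪v, w⟫ = k) → ∃ k : ℤ, M * ‖w‖ ^ 2 = k} N

end

end ThetaMap

open ThetaMap

namespace ThetaMap

/-! ### Gaussian sums over lattices -/

/-! Degree-two forms are symmetric matrices `H`; harmonic means traceless, and the differentiation
pairing becomes `2 tr(HK)`. Up to a nonzero constant, `det_𝓑 DΘ_Λ` is the Wronskian of the theta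
series Θ_H attached to an orthonormal basis of traceless matrices (`detDTheta_quadPoly`). A change
of orthonormal basis multiplies it by a determinant whose square is 1, and an isometry merely
conjugates the basis; this gives invariance.

Degeneracy. Write A = ᵗP P with the lattice basis as columns of P. The derivative of the theta map
along B is 2πi z Θ_K(z) with K = ᵗP⁻¹ B P⁻¹, and tr K = tr(A⁻¹B) (`hasLineDerivAt_thetaMap`,
`trace_coordinateForm`). A Wronskian of holomorphic functions vanishes identically exactly when they
are linearly dependent; the symmetry z ↦ −z̄ makes the dependence real. That the trace condition may
be dropped is `trace_eq_zero_of_quadTheta_eq_zero`: inversion of Θ_K has a correction term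
proportional to tr K, which survives at infinity if Θ_K = 0.

Modularity. Poisson summation, differentiated twice in a translation parameter, gives theta
inversion for quadratic weights; tracelessness removes the correction. Splitting the lattice into
residue classes modulo a denominator expresses Θ_H near a rational point by the dual lattice with
Gauss sums as coefficients. For a matrix in Γ₀(N) whose lower right entry is an odd prime p ∤ N this
yields Θ_H(γz) = μ(z)(cz+p)² Θ_H(z), where μ is the same for every H and μ² = (χ₄(p)(cz+p))ⁿ. Only
μ² is needed, so neither half-integral powers nor the discriminant of the lattice enter the result.
The chain rule turns this into a transformation law for squared Wronskians (`wronskian_comp`,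
`wronskian_moebius`), with weight m(n+4) + 2m(m−1) = nm(n+2) and sign χ₄(p)^(nm). A general lower
right entry d is replaced by a prime p ≡ d mod c, found by Dirichlet's theorem. The exponent nm is
odd only for n ≡ 3 mod 4; then 4 ∣ N (`four_dvd_of_odd`), so χ₄(p) = χ₄(d). At the other cusps the
same expansion at a rational point bounds the Wronskian (`exists_bound_wronskian_moebius`). -/

theorem exp_mul_le_exp_sq {δ : ℝ} (hδ : 0 < δ) (K t : ℝ) :
    Real.exp (K * t) ≤ Real.exp (K ^ 2 / (4 * δ)) * Real.exp (δ * t ^ 2) := by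
  rw [← Real.exp_add, Real.exp_le_exp]
  have h : K ^ 2 / (4 * δ) + δ * t ^ 2 - K * t = δ * (t - K / (2 * δ)) ^ 2 := by
    field_simp
    ring
  nlinarith [mul_nonneg hδ.le (sq_nonneg (t - K / (2 * δ)))]

/-- The lattice vector with integral coordinates `v` in the basis `b`. -/
noncomputable def latVec {n : ℕ} (b : Module.Basis (Fin n) ℝ (EuclideanSpace ℝ (Fin n)))
    (v : Fin n → ℤ) : EuclideanSpace ℝ (Fin n) :=
  ∑ i, (v i : ℝ) • b i

section latVec

variable {n : ℕ} (b : Module.Basis (Fin n) ℝ (EuclideanSpace ℝ (Fin n)))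

theorem latVec_add (v w : Fin n → ℤ) : latVec b (v + w) = latVec b v + latVec b w := by
  simp [latVec, add_smul, Finset.sum_add_distrib]

theorem latVec_smul (a : ℤ) (v : Fin n → ℤ) : latVec b (a • v) = (a : ℝ) • latVec b v := by
  simp [latVec, mul_smul, Finset.smul_sum]

theorem latVec_zero : latVec b 0 = 0 := by
  simp [latVec]

theorem latVec_neg (v : Fin n → ℤ) : latVec b (-v) = -latVec b v := by
  simp [latVec]

theorem latVec_eq_equivFun (v : Fin n → ℤ) :
    latVec b v = b.equivFun.symm (fun i => (v i : ℝ)) := by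
  rw [Module.Basis.equivFun_symm_apply]
  rfl

theorem latVec_injective : Function.Injective (latVec b) := by
  intro v w h
  rw [latVec_eq_equivFun, latVec_eq_equivFun] at h
  funext i
  exact_mod_cast congrFun (b.equivFun.symm.injective h) i

/-- A Gaussian decays faster than ‖λ‖⁻ᵈ, and the latter is summable over a lattice once d exceeds
the rank. -/
theorem summable_exp_neg_normSq_latVec {δ : ℝ} (hδ : 0 < δ) :
    Summable fun v : Fin n → ℤ => Real.exp (-δ * ‖latVec b v‖ ^ 2) := by
  let L := Submodule.span ℤ (Set.range b)
  have hL : ∀ v, latVec b v ∈ L := fun v => Submodule.sum_mem _ fun i _ => by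
    rw [Int.cast_smul_eq_zsmul]
    exact Submodule.smul_mem _ _ (Submodule.subset_span ⟨i, rfl⟩)
  let f : (Fin n → ℤ) → L := fun v => ⟨latVec b v, hL v⟩
  have hf : Function.Injective f := fun v w h => latVec_injective b (congrArg Subtype.val h)
  let d := Module.finrank ℤ L + 1
  have h1 := (ZLattice.summable_norm_pow_inv L d (Nat.lt_succ_self _)).comp_injective hf
  have h2 := h1.mul_left (Real.exp ((d : ℝ) ^ 2 / (4 * δ)))
  refine Summable.of_norm_bounded_eventually h2 ?_
  -- The comparison fails at the origin, where the inverse power takes the default value 0, so one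
  -- index is discarded.
  have h3 : ∀ᶠ v : Fin n → ℤ in Filter.cofinite, v ≠ 0 := by
    simpa only [Set.mem_singleton_iff] using (Set.finite_singleton (0 : Fin n → ℤ)).eventually_cofinite_notMem
  filter_upwards [h3] with v hv
  have h4 : 0 < ‖latVec b v‖ := by
    rw [norm_pos_iff]
    intro h
    exact hv (latVec_injective b (by rw [h, latVec_zero]))
  have h5 : ‖latVec b v‖ ^ d ≤ Real.exp (d * ‖latVec b v‖) := by
    rw [Real.exp_nat_mul]
    gcongr
    linarith [Real.add_one_le_exp ‖latVec b v‖]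
  have h6 := exp_mul_le_exp_sq hδ d ‖latVec b v‖
  have h7 : Real.exp (-δ * ‖latVec b v‖ ^ 2) * Real.exp (δ * ‖latVec b v‖ ^ 2) = 1 := by
    rw [← Real.exp_add]
    simp
  rw [Real.norm_eq_abs, abs_of_pos (Real.exp_pos _)]
  change _ ≤ _ * ‖latVec b v‖⁻¹ ^ d
  rw [inv_pow, ← div_eq_mul_inv, le_div_iff₀ (by positivity)]
  calc _ ≤ Real.exp (-δ * ‖latVec b v‖ ^ 2) *
        (Real.exp ((d : ℝ) ^ 2 / (4 * δ)) * Real.exp (δ * ‖latVec b v‖ ^ 2)) := by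
        gcongr
        exact h5.trans h6
    _ = _ := by rw [mul_left_comm, h7, mul_one]

/-- Half of the quadratic decay absorbs the linear exponent, by completing the square. -/
theorem summable_exp_sub_normSq_latVec {δ : ℝ} (hδ : 0 < δ) (K : ℝ) :
    Summable fun v : Fin n → ℤ => Real.exp (K * ‖latVec b v‖ - δ * ‖latVec b v‖ ^ 2) := by
  have h1 := (summable_exp_neg_normSq_latVec b (half_pos hδ)).mul_left
    (Real.exp (K ^ 2 / (4 * (δ / 2))))
  refine Summable.of_nonneg_of_le (fun _ => (Real.exp_pos _).le) (fun v => ?_) h1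
  have h2 := exp_mul_le_exp_sq (half_pos hδ) K ‖latVec b v‖
  calc _ = Real.exp (K * ‖latVec b v‖) * Real.exp (-δ * ‖latVec b v‖ ^ 2) := by
        rw [← Real.exp_add]
        ring_nf
    _ ≤ _ := mul_le_mul_of_nonneg_right h2 (Real.exp_pos _).le
    _ = _ := by
      rw [mul_assoc, ← Real.exp_add]
      congr 2
      ring

end latVec

/-! ### Sums of exponentials -/

/-- The hypothesis majorises the terms uniformly on the disc of radius `R`, so Weierstrass's theorem
allows termwise differentiation. This serves three purposes: derivatives along a translation,
derivatives in z, and the differential of the theta map. -/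
theorem hasDerivAt_tsum_cexp {ι : Type*} {a β : ι → ℂ} {R : ℝ}
    (h : Summable fun k => ‖a k‖ * Real.exp (R * ‖β k‖)) {t : ℂ} (ht : ‖t‖ < R) :
    HasDerivAt (fun t : ℂ => ∑' k, a k * Complex.exp (t * β k))
      (∑' k, a k * β k * Complex.exp (t * β k)) t := by
  have hU : IsOpen (Metric.ball (0 : ℂ) R) := Metric.isOpen_ball
  have htU : t ∈ Metric.ball (0 : ℂ) R := by simpa using ht
  have hd : ∀ k t, HasDerivAt (fun t : ℂ => a k * Complex.exp (t * β k))
      (a k * β k * Complex.exp (t * β k)) t := fun k t => by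
    have := ((hasDerivAt_mul_const (x := t) (β k)).cexp).const_mul (a k)
    exact this.congr_deriv (by ring)
  have hle : ∀ k, ∀ w ∈ Metric.ball (0 : ℂ) R,
      ‖a k * Complex.exp (w * β k)‖ ≤ ‖a k‖ * Real.exp (R * ‖β k‖) := fun k w hw => by
    rw [norm_mul, Complex.norm_exp]
    gcongr
    refine (Complex.re_le_norm _).trans ?_
    rw [norm_mul]
    gcongr
    simpa using (Metric.mem_ball.mp hw).le
  have h1 := Complex.hasSum_deriv_of_summable_norm h
    (fun k => fun w _ => (hd k w).differentiableAt.differentiableWithinAt) hU hle htU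
  have h2 := (Complex.differentiableOn_tsum_of_summable_norm h
    (fun k => fun w _ => (hd k w).differentiableAt.differentiableWithinAt) hU hle).differentiableAt
    (hU.mem_nhds htU)
  have h3 := h2.hasDerivAt
  rw [← h1.tsum_eq] at h3
  simpa only [(hd _ t).deriv] using h3

/-- Shrinking the radius pays for one factor `β`, so termwise differentiation can be repeated. -/
theorem summable_mul_exp_of_lt {ι : Type*} {a β : ι → ℂ} {R R' : ℝ} (hR : R' < R)
    (h : Summable fun k => ‖a k‖ * Real.exp (R * ‖β k‖)) :
    Summable fun k => ‖a k * β k‖ * Real.exp (R' * ‖β k‖) := by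
  have h1 := h.mul_left (1 / (R - R'))
  refine Summable.of_nonneg_of_le (fun _ => by positivity) (fun k => ?_) h1
  have h2 : (R - R') * ‖β k‖ ≤ Real.exp ((R - R') * ‖β k‖) := by
    linarith [Real.add_one_le_exp ((R - R') * ‖β k‖)]
  have h3 : 0 < R - R' := sub_pos.mpr hR
  have h4 : ‖β k‖ ≤ 1 / (R - R') * Real.exp ((R - R') * ‖β k‖) := by
    rw [one_div, ← div_eq_inv_mul, le_div_iff₀ h3]
    linarith
  calc _ = ‖a k‖ * Real.exp (R' * ‖β k‖) * ‖β k‖ := by rw [norm_mul]; ring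
    _ ≤ ‖a k‖ * Real.exp (R' * ‖β k‖) * (1 / (R - R') * Real.exp ((R - R') * ‖β k‖)) := by
      gcongr
    _ = 1 / (R - R') * (‖a k‖ * (Real.exp (R' * ‖β k‖) * Real.exp ((R - R') * ‖β k‖))) := by ring
    _ = _ := by
      rw [← Real.exp_add]
      ring_nf

/-! ### Poisson summation -/

theorem continuous_tsum_of_locally_bounded {n : ℕ} {ι : Type*} {F : ι → (Fin n → ℝ) → ℂ}
    (hF : ∀ k, Continuous (F k))
    (hb : ∀ R : ℝ, ∃ u : ι → ℝ, Summable u ∧ ∀ k x, ‖x‖ ≤ R → ‖F k x‖ ≤ u k) :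
    Continuous fun x => ∑' k, F k x := by
  rw [continuous_iff_continuousAt]
  intro x
  obtain ⟨u, hu, hle⟩ := hb (‖x‖ + 1)
  have h1 : ContinuousOn (fun x => ∑' k, F k x) (Metric.closedBall 0 (‖x‖ + 1)) :=
    continuousOn_tsum (fun k => (hF k).continuousOn) hu
      (fun k y hy => hle k y (by simpa using hy))
  exact h1.continuousAt (Metric.closedBall_mem_nhds_of_mem (by simp))

/-- Needed so that a continuous ℤⁿ-periodic function descends to a continuous function on the torus.
-/
theorem isQuotientMap_torus (n : ℕ) :
    Topology.IsQuotientMap (fun (x : Fin n → ℝ) (i : Fin n) => (x i : UnitAddCircle)) := by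
  have h : IsOpenQuotientMap (fun x : ℝ => (x : UnitAddCircle)) :=
    QuotientAddGroup.isOpenQuotientMap_mk
  have h2 : IsOpenMap (Pi.map fun (_ : Fin n) (x : ℝ) => (x : UnitAddCircle)) :=
    IsOpenMap.piMap (fun _ => h.isOpenMap) (by simp)
  refine IsOpenMap.isQuotientMap h2 ?_ ?_
  · exact continuous_pi fun i => h.continuous.comp (continuous_apply i)
  · exact Function.Surjective.piMap fun _ => h.surjective

theorem mFourier_coe {n : ℕ} (k : Fin n → ℤ) (x : Fin n → ℝ) :
    UnitAddTorus.mFourier k (fun i => (x i : UnitAddCircle)) =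
      Complex.exp (2 * Real.pi * Complex.I * ((∑ i, (k i : ℝ) * x i : ℝ) : ℂ)) := by
  simp only [UnitAddTorus.mFourier, ContinuousMap.coe_mk, fourier_coe_apply]
  rw [← Complex.exp_sum]
  congr 1
  push_cast
  rw [Finset.mul_sum]
  refine Finset.sum_congr rfl fun i _ => ?_
  ring

/-- Unfolding: the integral translates of the half-open unit box tile ℝⁿ. -/
theorem integral_box_tsum {n : ℕ} {F : (Fin n → ℝ) → ℂ} (hint : MeasureTheory.Integrable F)
    (hb : ∀ R : ℝ, ∃ u : (Fin n → ℤ) → ℝ, Summable u ∧ ∀ v : Fin n → ℤ, ∀ x : Fin n → ℝ, ‖x‖ ≤ R →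
      ‖F (x + fun i => (v i : ℝ))‖ ≤ u v) :
    ∫ x in {x : Fin n → ℝ | ∀ i, x i ∈ Set.Ioc (0 : ℝ) (0 + 1)},
      ∑' v : Fin n → ℤ, F (x + fun i => (v i : ℝ)) = ∫ x, F x := by
  let S : (Fin n → ℤ) → Set (Fin n → ℝ) := fun v =>
    {x | ∀ i, x i ∈ Set.Ioc (v i : ℝ) (v i + 1)}
  have hS : ∀ v, MeasurableSet (S v) := fun v => MeasurableSet.univ_pi' fun i => measurableSet_Ioc
  -- The boxes are open on the left, so the box of a point is found by the ceiling minus one;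
  -- disjointness and covering both follow.
  have hmem : ∀ v x, x ∈ S v ↔ v = fun i => ⌈x i⌉ - 1 := by
    intro v x
    simp only [S, Set.mem_ofPred_eq, funext_iff]
    refine forall_congr' fun i => ?_
    have h : v i = ⌈x i⌉ - 1 ↔ ⌈x i⌉ = v i + 1 := ⟨fun h => by omega, fun h => by omega⟩
    rw [h, Int.ceil_eq_iff]
    simp
  have hdisj : Pairwise (Function.onFun Disjoint S) := by
    intro v w hvw
    rw [Function.onFun, Set.disjoint_left]
    intro x hx hx'
    exact hvw (((hmem v x).mp hx).trans ((hmem w x).mp hx').symm)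
  have hunion : ⋃ v, S v = Set.univ :=
    Set.eq_univ_of_forall fun x => Set.mem_iUnion.mpr ⟨_, (hmem _ x).mpr rfl⟩
  have h1 := MeasureTheory.hasSum_integral_iUnion hS hdisj (f := F)
    (μ := MeasureTheory.volume) hint.integrableOn
  rw [hunion, MeasureTheory.setIntegral_univ] at h1
  have h2 : ∀ v : Fin n → ℤ, ∫ x in S 0, F (x + fun i => (v i : ℝ)) = ∫ x in S v, F x := by
    intro v
    have h3 := (MeasureTheory.measurePreserving_add_right MeasureTheory.volume
      (fun i => (v i : ℝ))).setIntegral_preimage_emb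
      (measurableEmbedding_addRight _) F (S v)
    rw [← h3]
    congr 2
    ext x
    simp [S, add_comm (x _) _]
  have h0 : {x : Fin n → ℝ | ∀ i, x i ∈ Set.Ioc (0 : ℝ) (0 + 1)} = S 0 := by
    simp [S]
  rw [h0]
  obtain ⟨u, hu, hle⟩ := hb 1
  have hn : ∀ x ∈ S 0, ‖x‖ ≤ 1 := by
    intro x hx
    rw [pi_norm_le_iff_of_nonneg zero_le_one]
    intro i
    have := hx i
    simp only [Pi.zero_apply, Int.cast_zero, zero_add, Set.mem_Ioc] at this
    rw [Real.norm_eq_abs, abs_le]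
    constructor <;> linarith [this.1, this.2]
  have hvol : MeasureTheory.volume (S 0) < ⊤ := by
    refine (MeasureTheory.measure_mono (fun x hx => ?_)).trans_lt
      (Metric.isBounded_closedBall (x := (0 : Fin n → ℝ)) (r := 1)).measure_lt_top
    simpa using hn x hx
  have h4 := MeasureTheory.hasSum_integral_of_summable_integral_norm
    (μ := MeasureTheory.volume.restrict (S 0))
    (F := fun (v : Fin n → ℤ) x => F (x + fun i => (v i : ℝ)))
    (fun v => (hint.comp_add_right _).integrableOn) ?_
  · rw [← h4.tsum_eq, ← h1.tsum_eq]
    exact tsum_congr h2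
  · refine Summable.of_nonneg_of_le (fun v => MeasureTheory.integral_nonneg fun _ => norm_nonneg _)
      (fun v => ?_) (hu.mul_right (MeasureTheory.volume.real (S 0)))
    have h5 := MeasureTheory.norm_setIntegral_le_of_norm_le_const (μ := MeasureTheory.volume)
      (f := fun x => ‖F (x + fun i => (v i : ℝ))‖) (C := u v) hvol
      (fun x hx => by simpa using hle v x (hn x hx))
    exact (Real.le_norm_self _).trans h5

/-- The periodisation of `F` is continuous and descends to the torus, where unfolding identifies its
Fourier coefficients with `c`. Their summability makes the Fourier series converge to the function
at every point. -/
theorem poisson_summation_pi {n : ℕ} {F : (Fin n → ℝ) → ℂ} (hint : MeasureTheory.Integrable F)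
    (hF : Continuous F)
    (hb : ∀ R : ℝ, ∃ u : (Fin n → ℤ) → ℝ, Summable u ∧ ∀ v : Fin n → ℤ, ∀ x : Fin n → ℝ, ‖x‖ ≤ R →
      ‖F (x + fun i => (v i : ℝ))‖ ≤ u v)
    (c : (Fin n → ℤ) → ℂ) (hc : Summable c)
    (hcF : ∀ k, ∫ x, Complex.exp (-(2 * Real.pi * Complex.I * ((∑ i, (k i : ℝ) * x i : ℝ) : ℂ))) *
      F x = c k) (x : Fin n → ℝ) :
    ∑' v : Fin n → ℤ, F (x + fun i => (v i : ℝ)) =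
      ∑' k, c k * Complex.exp (2 * Real.pi * Complex.I * ((∑ i, (k i : ℝ) * x i : ℝ) : ℂ)) := by
  let π : C(Fin n → ℝ, UnitAddTorus (Fin n)) :=
    ⟨fun x i => (x i : UnitAddCircle), (isQuotientMap_torus n).continuous⟩
  let G : (Fin n → ℝ) → ℂ := fun x => ∑' v : Fin n → ℤ, F (x + fun i => (v i : ℝ))
  have hG : Continuous G := continuous_tsum_of_locally_bounded
    (fun v => hF.comp (continuous_add_const _)) hb
  have hper : ∀ x (w : Fin n → ℤ), G (x + fun i => (w i : ℝ)) = G x := by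
    intro x w
    refine ((Equiv.addLeft w).tsum_eq
      (fun v : Fin n → ℤ => F (x + fun i => (v i : ℝ)))).symm.trans ?_ |>.symm
    refine tsum_congr fun v => congrArg F ?_
    funext i
    simp [add_assoc]
  have hπ : Topology.IsQuotientMap π := isQuotientMap_torus n
  have hfac : Function.FactorsThrough (⟨G, hG⟩ : C(Fin n → ℝ, ℂ)) π := by
    intro x y hxy
    have h : ∀ i, ∃ m : ℤ, y i = x i + m := fun i => by
      have := congrFun hxy i
      have this : ((x i - y i : ℝ) : UnitAddCircle) = 0 := by
        rw [AddCircle.coe_sub, sub_eq_zero]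
        exact this
      obtain ⟨m, hm⟩ := (AddCircle.coe_eq_zero_iff (p := (1 : ℝ)) (x := x i - y i)).mp this
      exact ⟨-m, by push_cast; simp at hm; linarith⟩
    choose w hw using h
    have : y = x + fun i => (w i : ℝ) := funext hw
    change G x = G y
    rw [this, hper]
  let g : C(UnitAddTorus (Fin n), ℂ) := hπ.lift ⟨G, hG⟩ hfac
  have hg : ∀ x, g (π x) = G x := fun x => by
    have := DFunLike.congr_fun (hπ.lift_comp ⟨G, hG⟩ hfac) x
    exact this
  have hcoef : UnitAddTorus.mFourierCoeff g = c := by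
    funext k
    rw [UnitAddTorus.mFourierCoeff_eq_integral _ _ 0, ← hcF k]
    have hexp : ∀ (x : Fin n → ℝ) (v : Fin n → ℤ),
        Complex.exp (-(2 * Real.pi * Complex.I *
          ((∑ i, (k i : ℝ) * (x + fun i => (v i : ℝ)) i : ℝ) : ℂ))) =
        Complex.exp (-(2 * Real.pi * Complex.I * ((∑ i, (k i : ℝ) * x i : ℝ) : ℂ))) := by
      intro x v
      rw [Complex.exp_eq_exp_iff_exists_int]
      refine ⟨-∑ i, k i * v i, ?_⟩
      simp only [Pi.add_apply, mul_add, Finset.sum_add_distrib]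
      push_cast
      ring
    have hnorm : ∀ x : Fin n → ℝ,
        ‖Complex.exp (-(2 * Real.pi * Complex.I * ((∑ i, (k i : ℝ) * x i : ℝ) : ℂ)))‖ = 1 := by
      intro x
      rw [Complex.norm_exp]
      simp
    have hcexp : Continuous fun x : Fin n → ℝ =>
        Complex.exp (-(2 * Real.pi * Complex.I * ((∑ i, (k i : ℝ) * x i : ℝ) : ℂ))) := by
      fun_prop
    have h1 := integral_box_tsum (F := fun x => Complex.exp (-(2 * Real.pi * Complex.I *
        ((∑ i, (k i : ℝ) * x i : ℝ) : ℂ))) * F x) ?_ ?_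
    · rw [← h1]
      refine MeasureTheory.integral_congr_ae (Filter.Eventually.of_forall fun x => ?_)
      simp only [hexp, smul_eq_mul]
      rw [tsum_mul_left, mFourier_coe]
      change _ * g (π x) = _
      rw [hg]
      simp [G]
    · refine (hint.bdd_mul (c := 1) hcexp.aestronglyMeasurable ?_)
      exact Filter.Eventually.of_forall fun x => (hnorm x).le
    · intro R
      obtain ⟨u, hu, hle⟩ := hb R
      refine ⟨u, hu, fun v x hx => ?_⟩
      rw [norm_mul, hnorm, one_mul]
      exact hle v x hx
  have h2 := UnitAddTorus.hasSum_mFourier_series_apply_of_summable (f := g)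
    (by rw [hcoef]; exact hc) (π x)
  rw [hg, hcoef] at h2
  change G x = _
  rw [← h2.tsum_eq]
  refine tsum_congr fun k => ?_
  rw [smul_eq_mul, ← mFourier_coe]
  rfl

/-! ### Dual bases and the theta inversion formula -/

/-- `b'` is dual to `b` with respect to the polar form `2⟪x, y⟫` of `‖x‖²`. -/
def IsPolarDual {n : ℕ} (b b' : Module.Basis (Fin n) ℝ (EuclideanSpace ℝ (Fin n))) : Prop :=
  ∀ i j, 2 * ⟪b' i, b j⟫ = if i = j then (1 : ℝ) else 0

section

variable {n : ℕ} {b b' : Module.Basis (Fin n) ℝ (EuclideanSpace ℝ (Fin n))}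

theorem exists_isPolarDual (b : Module.Basis (Fin n) ℝ (EuclideanSpace ℝ (Fin n))) :
    ∃ b', IsPolarDual b b' := by
  let B : LinearMap.BilinForm ℝ (EuclideanSpace ℝ (Fin n)) := (2 : ℝ) • innerₗ _
  have hB : B.Nondegenerate := by
    have h1 : ∀ x, (∀ y, B x y = 0) → x = 0 := by
      intro x hx
      have := hx x
      simpa [B] using this
    refine ⟨h1, fun y hy => h1 y fun x => ?_⟩
    have := hy x
    simpa [B, real_inner_comm] using this
  refine ⟨B.dualBasis hB b, fun i j => ?_⟩
  have := B.apply_dualBasis_left hB b i j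
  simpa [B, eq_comm] using this

theorem IsPolarDual.symm (h : IsPolarDual b b') : IsPolarDual b' b := by
  intro i j
  rw [real_inner_comm, h j i]
  simp [eq_comm]

theorem IsPolarDual.repr_eq (h : IsPolarDual b b') (x : EuclideanSpace ℝ (Fin n)) (i : Fin n) :
    b.repr x i = 2 * ⟪b' i, x⟫ := by
  conv_rhs => rw [← b.sum_repr x]
  rw [inner_sum, Finset.mul_sum]
  simp only [inner_smul_right, mul_left_comm (2 : ℝ), h i]
  simp

theorem IsPolarDual.inner_latVec (h : IsPolarDual b b') (k : Fin n → ℤ) (y : Fin n → ℝ) :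
    2 * ⟪latVec b' k, b.equivFun.symm y⟫ = ∑ i, (k i : ℝ) * y i := by
  rw [latVec, sum_inner, Finset.mul_sum]
  refine Finset.sum_congr rfl fun i _ => ?_
  rw [inner_smul_left, mul_left_comm, ← h.repr_eq]
  rw [← Module.Basis.equivFun_apply, LinearEquiv.apply_symm_apply]
  rfl

theorem IsPolarDual.inner_latVec_latVec (h : IsPolarDual b b') (k v : Fin n → ℤ) :
    2 * ⟪latVec b' k, latVec b v⟫ = ((∑ i, k i * v i : ℤ) : ℝ) := by
  rw [latVec_eq_equivFun b, h.inner_latVec]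
  push_cast
  rfl

theorem norm_cexp_gaussian (w : ℂ) (r : ℝ) :
    ‖Complex.exp (2 * Real.pi * Complex.I * w * (r ^ 2 : ℝ))‖ =
      Real.exp (-(2 * Real.pi * w.im) * r ^ 2) := by
  rw [Complex.norm_exp]
  congr 1
  have : (2 * Real.pi * Complex.I * w * (r ^ 2 : ℝ) : ℂ) =
      ((2 * Real.pi * r ^ 2 : ℝ) : ℂ) * (Complex.I * w) := by
    push_cast
    ring
  rw [this, Complex.re_ofReal_mul]
  simp
  ring

theorem exp_neg_normSq_add_le {δ : ℝ} (hδ : 0 ≤ δ) {R : ℝ} {x y : EuclideanSpace ℝ (Fin n)}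
    (hx : ‖x‖ ≤ R) :
    Real.exp (-δ * ‖y + x‖ ^ 2) ≤ Real.exp (2 * δ * R * ‖y‖ - δ * ‖y‖ ^ 2) := by
  rw [Real.exp_le_exp]
  have h1 : ‖y + x‖ ^ 2 = ‖y‖ ^ 2 + 2 * ⟪y, x⟫ + ‖x‖ ^ 2 := by
    rw [norm_add_sq_real]
  have h2 : -(‖y‖ * ‖x‖) ≤ ⟪y, x⟫ := (abs_le.mp (abs_real_inner_le_norm y x)).1
  have h3 : ‖y‖ * ‖x‖ ≤ ‖y‖ * R := by gcongr
  have h4 : ‖y‖ ^ 2 - 2 * (‖y‖ * R) ≤ ‖y + x‖ ^ 2 := by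
    rw [h1]
    nlinarith [sq_nonneg ‖x‖]
  nlinarith

theorem summable_mul_gaussian (b : Module.Basis (Fin n) ℝ (EuclideanSpace ℝ (Fin n))) {w : ℂ}
    (hw : 0 < w.im) (x : EuclideanSpace ℝ (Fin n)) {c : (Fin n → ℤ) → ℂ} {C K : ℝ}
    (hc : ∀ v, ‖c v‖ ≤ C * Real.exp (K * ‖latVec b v‖)) (R : ℝ) :
    Summable fun v => ‖c v * Complex.exp (2 * Real.pi * Complex.I * w * (‖latVec b v + x‖ ^ 2 : ℝ))‖
      * Real.exp (R * ‖latVec b v‖) := by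
  have hδ : 0 < 2 * Real.pi * w.im := by positivity
  refine Summable.of_nonneg_of_le (fun _ => by positivity) (fun v => ?_)
    ((summable_exp_sub_normSq_latVec b hδ
      (K + R + 2 * (2 * Real.pi * w.im) * ‖x‖)).mul_left C)
  rw [norm_mul, norm_cexp_gaussian]
  have h1 := exp_neg_normSq_add_le hδ.le (le_refl ‖x‖) (y := latVec b v)
  have h0 : 0 ≤ C * Real.exp (K * ‖latVec b v‖) := (norm_nonneg _).trans (hc v)
  calc _ ≤ (C * Real.exp (K * ‖latVec b v‖)) *
        Real.exp (2 * (2 * Real.pi * w.im) * ‖x‖ * ‖latVec b v‖ -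
          (2 * Real.pi * w.im) * ‖latVec b v‖ ^ 2) * Real.exp (R * ‖latVec b v‖) := by
        gcongr
        exact hc v
    _ = _ := by
      rw [mul_assoc, mul_assoc, mul_assoc, ← Real.exp_add, ← Real.exp_add]
      congr 2
      ring

/-- The image of Lebesgue measure under a linear isomorphism is a Haar measure, hence a multiple of
volume. The value of the constant never matters: it cancels from the theta multiplier, and elsewhere
only its positivity or finiteness is used. -/
theorem exists_integral_equivFun_symm (b : Module.Basis (Fin n) ℝ (EuclideanSpace ℝ (Fin n))) :
    ∃ κ : ℝ, 0 < κ ∧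
      (∀ f : EuclideanSpace ℝ (Fin n) → ℂ, MeasureTheory.Integrable f →
        MeasureTheory.Integrable fun y : Fin n → ℝ => f (b.equivFun.symm y)) ∧
      ∀ f : EuclideanSpace ℝ (Fin n) → ℂ,
        ∫ y : Fin n → ℝ, f (b.equivFun.symm y) = κ • ∫ x, f x := by
  let T : (Fin n → ℝ) ≃L[ℝ] EuclideanSpace ℝ (Fin n) := b.equivFun.symm.toContinuousLinearEquiv
  let e := T.toHomeomorph.toMeasurableEquiv
  let μ := (MeasureTheory.volume : MeasureTheory.Measure (Fin n → ℝ)).map T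
  have : μ.IsAddHaarMeasure := T.isAddHaarMeasure_map _
  obtain ⟨c, hc0, hc1, hc⟩ : ∃ c : ENNReal, c ≠ 0 ∧ c ≠ ⊤ ∧ μ = c • MeasureTheory.volume := by
    refine ⟨μ.addHaarScalarFactor MeasureTheory.volume, ?_, by simp,
      MeasureTheory.Measure.isAddLeftInvariant_eq_smul _ _⟩
    simpa using (MeasureTheory.Measure.addHaarScalarFactor_pos_of_isAddHaarMeasure _ _).ne'
  refine ⟨c.toReal, ENNReal.toReal_pos hc0 hc1, fun f hf => ?_, fun f => ?_⟩
  · have h1 : MeasureTheory.Integrable f μ := by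
      rw [hc]
      exact hf.smul_measure hc1
    exact (MeasureTheory.integrable_map_equiv e f).mp h1
  · have h1 := MeasureTheory.integral_map_equiv (μ := MeasureTheory.volume) e f
    have h2 : ∫ x, f x ∂μ = c.toReal • ∫ x, f x := by
      rw [hc, MeasureTheory.integral_smul_measure]
    rw [← h2]
    exact h1.symm

/-- The covolume constant in the Poisson summation formula for the lattice with basis `b`. -/
noncomputable def poissonConst (b : Module.Basis (Fin n) ℝ (EuclideanSpace ℝ (Fin n))) : ℝ :=
  (exists_integral_equivFun_symm b).choose

theorem poissonConst_pos (b : Module.Basis (Fin n) ℝ (EuclideanSpace ℝ (Fin n))) :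
    0 < poissonConst b := (exists_integral_equivFun_symm b).choose_spec.1

/-- The automorphy factor of the theta inversion formula. -/
noncomputable def poissonFactor (b : Module.Basis (Fin n) ℝ (EuclideanSpace ℝ (Fin n))) (w : ℂ) :
    ℂ :=
  poissonConst b * (Real.pi / (-(2 * Real.pi * Complex.I * w))) ^ (n / 2 : ℂ)

/-- Poisson summation for a Gaussian in lattice coordinates. The shift `x` is kept general because
it is later specialised to fractional lattice points and differentiated to produce quadratic
weights. -/
theorem tsum_gaussian (h : IsPolarDual b b') {w : ℂ} (hw : 0 < w.im)
    (x : EuclideanSpace ℝ (Fin n)) :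
    ∑' v, Complex.exp (2 * Real.pi * Complex.I * w * (‖latVec b v + x‖ ^ 2 : ℝ)) =
      poissonFactor b w * ∑' k, Complex.exp (2 * Real.pi * Complex.I * (2 * ⟪latVec b' k, x⟫ : ℝ)) *
        Complex.exp (2 * Real.pi * Complex.I * (-1 / w) * (‖latVec b' k‖ ^ 2 : ℝ)) := by
  obtain ⟨-, hint, hch⟩ := (exists_integral_equivFun_symm b).choose_spec
  change ∀ f : EuclideanSpace ℝ (Fin n) → ℂ,
        ∫ y : Fin n → ℝ, f (b.equivFun.symm y) = poissonConst b • ∫ x, f x at hch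
  have hw0 : w ≠ 0 := by
    rintro rfl
    simp at hw
  have hw' : 0 < (-1 / w).im := by
    rw [neg_div, one_div, Complex.neg_im, Complex.inv_im, neg_div, neg_neg]
    exact div_pos hw (Complex.normSq_pos.mpr hw0)
  let B : ℂ := -(2 * Real.pi * Complex.I * w)
  have hB : 0 < B.re := by
    have : B.re = 2 * Real.pi * w.im := by simp [B]
    rw [this]
    positivity
  have hB0 : B ≠ 0 := by
    intro h
    simp [h] at hB
  let f : EuclideanSpace ℝ (Fin n) → ℂ := fun x => Complex.exp (-B * ‖x‖ ^ 2)
  let T : (Fin n → ℝ) ≃L[ℝ] EuclideanSpace ℝ (Fin n) := b.equivFun.symm.toContinuousLinearEquiv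
  have hf : MeasureTheory.Integrable f := by
    have := GaussianFourier.integrable_cexp_neg_mul_sq_norm_add (V := EuclideanSpace ℝ (Fin n))
      hB 0 0
    simpa [f] using this
  have hfe : ∀ x, f x = Complex.exp (2 * Real.pi * Complex.I * w * (‖x‖ ^ 2 : ℝ)) := by
    intro x
    simp [f, B]
  let c : (Fin n → ℤ) → ℂ := fun k => poissonFactor b w *
    Complex.exp (2 * Real.pi * Complex.I * (-1 / w) * (‖latVec b' k‖ ^ 2 : ℝ))
  have hc : Summable c := by
    refine Summable.mul_left _ (Summable.of_norm ?_)
    have := summable_mul_gaussian b' hw' 0 (c := fun _ => 1) (C := 1) (K := 0) (by simp) 0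
    simpa using this
  have key := poisson_summation_pi (F := fun y => f (T y)) (hint f hf)
    (by simp only [hfe]; fun_prop) ?_ c hc ?_ (T.symm x)
  · have h1 : ∀ k : Fin n → ℤ, (∑ i, (k i : ℝ) * (T.symm x) i) = 2 * ⟪latVec b' k, x⟫ := by
      intro k
      rw [← h.inner_latVec]
      congr 2
      exact T.apply_symm_apply x
    have h2 : ∀ v : Fin n → ℤ, T (T.symm x + fun i => (v i : ℝ)) = latVec b v + x := by
      intro v
      rw [map_add, T.apply_symm_apply, latVec_eq_equivFun, add_comm]
      rfl
    simp only [h1, h2] at key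
    simp only [← hfe]
    rw [key, ← tsum_mul_left]
    refine tsum_congr fun k => ?_
    simp only [c]
    ring
  · intro R
    have hδ : 0 < 2 * Real.pi * w.im := by positivity
    refine ⟨_, summable_exp_sub_normSq_latVec b hδ (2 * (2 * Real.pi * w.im) *
      (‖(T : (Fin n → ℝ) →L[ℝ] EuclideanSpace ℝ (Fin n))‖ * R)), fun v y hy => ?_⟩
    have h2 : T (y + fun i => (v i : ℝ)) = latVec b v + T y := by
      rw [map_add, latVec_eq_equivFun, add_comm]
      rfl
    simp only [h2, hfe, norm_cexp_gaussian]
    refine exp_neg_normSq_add_le hδ.le ?_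
    exact ((T : (Fin n → ℝ) →L[ℝ] EuclideanSpace ℝ (Fin n)).le_opNorm y).trans (by gcongr)
  · intro k
    -- Duality is for 2⟪·,·⟫, so the Fourier character exp(−2πi k·y) becomes exp(−4πi⟪λ'ₖ, x⟫).
    have h1 := hch (fun x => Complex.exp (-B * ‖x‖ ^ 2 +
      (-(4 * Real.pi * Complex.I)) * ⟪latVec b' k, x⟫))
    rw [GaussianFourier.integral_cexp_neg_mul_sq_norm_add hB] at h1
    have h2 : (Module.finrank ℝ (EuclideanSpace ℝ (Fin n)) : ℂ) = n := by simp
    rw [h2] at h1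
    simp only [c, poissonFactor]
    refine (Eq.trans ?_ h1).trans ?_
    · refine MeasureTheory.integral_congr_ae (Filter.Eventually.of_forall fun y => ?_)
      change _ * Complex.exp (-B * ‖b.equivFun.symm y‖ ^ 2) = _
      rw [← h.inner_latVec, ← Complex.exp_add]
      congr 1
      push_cast
      ring
    · rw [Complex.real_smul, ← mul_assoc]
      congr 2
      simp only [B]
      push_cast
      field_simp
      ring_nf

end

/-! ### Theta inversion with quadratic weights. -/

/-- Compare the second derivatives of both sides at t = 0. The Gaussian prefactor contributes the
extra term 2c; its first derivative vanishes at 0, so there is no mixed term. -/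
theorem second_deriv_tsum_cexp {ι : Type*} {a β a' β' : ι → ℂ} {c C : ℂ}
    (h : ∀ R, Summable fun k => ‖a k‖ * Real.exp (R * ‖β k‖))
    (h' : ∀ R, Summable fun k => ‖a' k‖ * Real.exp (R * ‖β' k‖))
    (heq : ∀ t : ℝ, Complex.exp (c * t ^ 2) * ∑' k, a k * Complex.exp (t * β k) =
      C * ∑' k, a' k * Complex.exp (t * β' k)) :
    2 * c * ∑' k, a k + ∑' k, a k * β k ^ 2 = C * ∑' k, a' k * β' k ^ 2 := by
  have key : ∀ {a β : ι → ℂ}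
      (h : ∀ R, Summable fun k => ‖a k‖ * Real.exp (R * ‖β k‖)) (t : ℂ),
      HasDerivAt (fun t : ℂ => ∑' k, a k * Complex.exp (t * β k))
        (∑' k, a k * β k * Complex.exp (t * β k)) t ∧
      HasDerivAt (fun t : ℂ => ∑' k, a k * β k * Complex.exp (t * β k))
        (∑' k, a k * β k * β k * Complex.exp (t * β k)) t := by
    intro a β h t
    exact ⟨hasDerivAt_tsum_cexp (h (‖t‖ + 1)) (lt_add_one _),
      hasDerivAt_tsum_cexp (a := fun k => a k * β k) (R := ‖t‖ + 1)
        (summable_mul_exp_of_lt (lt_add_one _) (h (‖t‖ + 1 + 1))) (lt_add_one _)⟩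
  have hexp : ∀ t : ℂ, HasDerivAt (fun t : ℂ => Complex.exp (c * t ^ 2))
      (Complex.exp (c * t ^ 2) * (c * (2 * t))) t := fun t => by
    have := ((hasDerivAt_pow 2 t).const_mul c).cexp
    exact this.congr_deriv (by simp)
  have hlin : ∀ t : ℂ, HasDerivAt (fun t : ℂ => c * (2 * t)) (c * 2) t := fun t => by
    exact (((hasDerivAt_id t).const_mul 2).const_mul c).congr_deriv (by simp)
  -- The first-order identity is proved for every real t, since it has to be differentiated once
  -- more.
  have e1 : ∀ t : ℝ, Complex.exp (c * t ^ 2) * (c * (2 * t)) * (∑' k, a k * Complex.exp (t * β k)) +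
      Complex.exp (c * t ^ 2) * (∑' k, a k * β k * Complex.exp (t * β k)) =
      C * ∑' k, a' k * β' k * Complex.exp (t * β' k) := by
    intro t
    have d1 := ((hexp t).mul (key h t).1).comp_ofReal
    have d2 := ((key h' t).1.const_mul C).comp_ofReal
    have : (fun t : ℝ => Complex.exp (c * (t : ℂ) ^ 2) * ∑' k, a k * Complex.exp ((t : ℂ) * β k)) =
      fun t : ℝ => C * ∑' k, a' k * Complex.exp ((t : ℂ) * β' k) := funext heq
    rw [← this] at d2
    exact d1.unique d2
  have d1 := ((((hexp 0).mul (hlin 0)).mul (key h 0).1).add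
    ((hexp 0).mul (key h 0).2)).comp_ofReal (z := 0)
  have d2 := ((key h' 0).2.const_mul C).comp_ofReal (z := 0)
  have : (fun t : ℝ => C * ∑' k, a' k * β' k * Complex.exp ((t : ℂ) * β' k)) = _ :=
    funext fun t => (e1 t).symm
  rw [this] at d2
  have := d1.unique d2
  simp only [Pi.mul_apply, ne_eq, OfNat.ofNat_ne_zero, not_false_eq_true, zero_pow, mul_zero, Complex.exp_zero,
    zero_mul, one_mul, mul_one, zero_add, add_zero] at this
  simp only [sq, ← mul_assoc]
  rw [← this]
  ring

section

variable {n : ℕ} {b b' : Module.Basis (Fin n) ℝ (EuclideanSpace ℝ (Fin n))}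

/-- The theta inversion formula for a weight function `h` with Laplacian `2τ`. -/
def ThetaInversion (b b' : Module.Basis (Fin n) ℝ (EuclideanSpace ℝ (Fin n))) (w : ℂ)
    (x : EuclideanSpace ℝ (Fin n)) (h : EuclideanSpace ℝ (Fin n) → ℂ) (τ : ℂ) : Prop :=
  (Summable fun v => h (latVec b v + x) *
      Complex.exp (2 * Real.pi * Complex.I * w * (‖latVec b v + x‖ ^ 2 : ℝ))) ∧
  (Summable fun k => h (latVec b' k) *
      (Complex.exp (2 * Real.pi * Complex.I * (2 * ⟪latVec b' k, x⟫ : ℝ)) *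
      Complex.exp (2 * Real.pi * Complex.I * (-1 / w) * (‖latVec b' k‖ ^ 2 : ℝ)))) ∧
  w ^ 2 * (∑' v, h (latVec b v + x) *
      Complex.exp (2 * Real.pi * Complex.I * w * (‖latVec b v + x‖ ^ 2 : ℝ))) +
    w * τ / (4 * Real.pi * Complex.I) *
      (∑' v, Complex.exp (2 * Real.pi * Complex.I * w * (‖latVec b v + x‖ ^ 2 : ℝ))) =
    poissonFactor b w * ∑' k, h (latVec b' k) *
      (Complex.exp (2 * Real.pi * Complex.I * (2 * ⟪latVec b' k, x⟫ : ℝ)) *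
      Complex.exp (2 * Real.pi * Complex.I * (-1 / w) * (‖latVec b' k‖ ^ 2 : ℝ)))

theorem ThetaInversion.add {w : ℂ} {x : EuclideanSpace ℝ (Fin n)}
    {h h' : EuclideanSpace ℝ (Fin n) → ℂ} {τ τ' : ℂ} (H : ThetaInversion b b' w x h τ)
    (H' : ThetaInversion b b' w x h' τ') :
    ThetaInversion b b' w x (fun y => h y + h' y) (τ + τ') := by
  obtain ⟨h1, h2, h3⟩ := H
  obtain ⟨h1', h2', h3'⟩ := H'
  refine ⟨?_, ?_, ?_⟩
  · simpa only [add_mul] using h1.add h1'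
  · simpa only [add_mul] using h2.add h2'
  · simp only [add_mul]
    rw [h1.tsum_add h1', h2.tsum_add h2', mul_add (poissonFactor b w), ← h3, ← h3']
    ring

theorem ThetaInversion.const_mul {w : ℂ} {x : EuclideanSpace ℝ (Fin n)}
    {h : EuclideanSpace ℝ (Fin n) → ℂ} {τ : ℂ} (H : ThetaInversion b b' w x h τ) (c : ℂ) :
    ThetaInversion b b' w x (fun y => c * h y) (c * τ) := by
  obtain ⟨h1, h2, h3⟩ := H
  refine ⟨?_, ?_, ?_⟩
  · simpa only [mul_assoc] using h1.mul_left c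
  · simpa only [mul_assoc] using h2.mul_left c
  · simp only [mul_assoc c]
    rw [tsum_mul_left, tsum_mul_left, mul_left_comm (poissonFactor b w), ← h3]
    ring

theorem ThetaInversion.sum {w : ℂ} {x : EuclideanSpace ℝ (Fin n)} {ι : Type*} (s : Finset ι)
    {h : ι → EuclideanSpace ℝ (Fin n) → ℂ} {τ : ι → ℂ}
    (H : ∀ i ∈ s, ThetaInversion b b' w x (h i) (τ i)) :
    ThetaInversion b b' w x (fun y => ∑ i ∈ s, h i y) (∑ i ∈ s, τ i) := by
  classical
  induction s using Finset.induction_on with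
  | empty => exact ⟨by simp [summable_zero], by simp [summable_zero], by simp⟩
  | insert i s hi ih =>
    simp only [Finset.sum_insert hi]
    exact (H i (Finset.mem_insert_self _ _)).add
      (ih fun j hj => H j (Finset.mem_insert_of_mem hj))

theorem im_neg_one_div_pos {w : ℂ} (hw : 0 < w.im) : 0 < (-1 / w).im := by
  have hw0 : w ≠ 0 := by
    rintro rfl
    simp at hw
  rw [neg_div, one_div, Complex.neg_im, Complex.inv_im, neg_div, neg_neg]
  exact div_pos hw (Complex.normSq_pos.mpr hw0)

theorem summable_mul_gaussian_dual (b' : Module.Basis (Fin n) ℝ (EuclideanSpace ℝ (Fin n))) {w : ℂ}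
    (hw : 0 < w.im) (x : EuclideanSpace ℝ (Fin n)) {c : (Fin n → ℤ) → ℂ} {C K : ℝ}
    (hc : ∀ v, ‖c v‖ ≤ C * Real.exp (K * ‖latVec b' v‖)) (R : ℝ) :
    Summable fun k => ‖c k * (Complex.exp (2 * Real.pi * Complex.I * (2 * ⟪latVec b' k, x⟫ : ℝ)) *
      Complex.exp (2 * Real.pi * Complex.I * (-1 / w) * (‖latVec b' k‖ ^ 2 : ℝ)))‖
      * Real.exp (R * ‖latVec b' k‖) := by
  have h1 := summable_mul_gaussian b' (im_neg_one_div_pos hw) 0 hc R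
  refine h1.congr fun k => ?_
  congr 1
  rw [norm_mul, norm_mul, norm_mul, add_zero]
  have : ‖Complex.exp (2 * Real.pi * Complex.I * (2 * ⟪latVec b' k, x⟫ : ℝ))‖ = 1 := by
    rw [Complex.norm_exp]
    simp
  rw [this, one_mul]

/-- Move the shift in `tsum_gaussian` along x + t e and take the second derivative at t = 0.
Expanding ‖λ + x + t e‖² leaves a factor exp(2πi w‖e‖²t²), which is the source of the correction
term. -/
theorem thetaInversion_inner_sq (hb : IsPolarDual b b') {w : ℂ} (hw : 0 < w.im)
    (x e : EuclideanSpace ℝ (Fin n)) :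
    ThetaInversion b b' w x (fun y => ((⟪y, e⟫ ^ 2 : ℝ) : ℂ)) ((‖e‖ ^ 2 : ℝ) : ℂ) := by
  have hw0 : w ≠ 0 := by
    rintro rfl
    simp at hw
  have hgrow : ∀ (y x : EuclideanSpace ℝ (Fin n)),
      ‖((⟪y + x, e⟫ ^ 2 : ℝ) : ℂ)‖ ≤ Real.exp (2 * ‖x‖ * ‖e‖) * Real.exp (2 * ‖e‖ * ‖y‖) := by
    intro y x
    rw [Complex.norm_real, Real.norm_eq_abs, abs_pow, ← Real.exp_add]
    have h1 : |⟪y + x, e⟫| ≤ Real.exp (‖y‖ * ‖e‖ + ‖x‖ * ‖e‖) := by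
      calc _ ≤ ‖y + x‖ * ‖e‖ := abs_real_inner_le_norm _ _
        _ ≤ (‖y‖ + ‖x‖) * ‖e‖ := by gcongr; exact norm_add_le _ _
        _ ≤ _ := by linarith [Real.add_one_le_exp (‖y‖ * ‖e‖ + ‖x‖ * ‖e‖)]
    calc _ ≤ Real.exp (‖y‖ * ‖e‖ + ‖x‖ * ‖e‖) ^ 2 := by gcongr
      _ = _ := by
        rw [← Real.exp_nat_mul]
        congr 1
        push_cast
        ring
  refine ⟨?_, ?_, ?_⟩
  · refine Summable.of_norm ?_
    simpa using summable_mul_gaussian b hw x (fun v => hgrow (latVec b v) x) 0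
  · refine Summable.of_norm ?_
    have := summable_mul_gaussian_dual b' hw x (fun v => hgrow (latVec b' v) 0) 0
    simpa using this
  · have hcs : ∀ (y : EuclideanSpace ℝ (Fin n)) (R a : ℝ), 0 ≤ R → 0 ≤ a →
        Real.exp (R * (a * |⟪y, e⟫|)) ≤ Real.exp ((R * a * ‖e‖) * ‖y‖) := by
      intro y R a hR ha
      rw [Real.exp_le_exp, mul_assoc, mul_assoc, mul_comm ‖e‖]
      gcongr
      exact abs_real_inner_le_norm _ _
    let a : (Fin n → ℤ) → ℂ := fun v =>
      Complex.exp (2 * Real.pi * Complex.I * w * (‖latVec b v + x‖ ^ 2 : ℝ))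
    let β : (Fin n → ℤ) → ℂ := fun v => 4 * Real.pi * Complex.I * w * (⟪latVec b v + x, e⟫ : ℝ)
    let a' : (Fin n → ℤ) → ℂ := fun k =>
      Complex.exp (2 * Real.pi * Complex.I * (2 * ⟪latVec b' k, x⟫ : ℝ)) *
      Complex.exp (2 * Real.pi * Complex.I * (-1 / w) * (‖latVec b' k‖ ^ 2 : ℝ))
    let β' : (Fin n → ℤ) → ℂ := fun k => 4 * Real.pi * Complex.I * (⟪latVec b' k, e⟫ : ℝ)
    let c : ℂ := 2 * Real.pi * Complex.I * w * (‖e‖ ^ 2 : ℝ)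
    have hβ : ∀ v, ‖β v‖ = 4 * Real.pi * ‖w‖ * |⟪latVec b v + x, e⟫| := fun v => by
      simp [β, abs_of_pos Real.pi_pos]
    have hβ' : ∀ v, ‖β' v‖ = 4 * Real.pi * |⟪latVec b' v, e⟫| := fun v => by
      simp [β', abs_of_pos Real.pi_pos]
    have hmono : ∀ {u : (Fin n → ℤ) → ℂ} {γ : (Fin n → ℤ) → ℂ},
        (∀ R, 0 ≤ R → Summable fun k => ‖u k‖ * Real.exp (R * ‖γ k‖)) →
        ∀ R, Summable fun k => ‖u k‖ * Real.exp (R * ‖γ k‖) := by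
      intro u γ hu R
      refine Summable.of_nonneg_of_le (fun _ => by positivity) (fun k => ?_)
        (hu |R| (abs_nonneg R))
      gcongr
      exact le_abs_self R
    have hs : ∀ R, Summable fun k => ‖a k‖ * Real.exp (R * ‖β k‖) := by
      refine hmono fun R hR => ?_
      have h1 := (summable_mul_gaussian b hw x (c := fun _ => 1) (C := 1) (K := 0)
        (by simp) (R * (4 * Real.pi * ‖w‖) * ‖e‖)).mul_right
          (Real.exp ((R * (4 * Real.pi * ‖w‖) * ‖e‖) * ‖x‖))
      refine Summable.of_nonneg_of_le (fun _ => by positivity) (fun k => ?_) h1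
      rw [one_mul, mul_assoc, ← Real.exp_add, hβ, ← mul_add]
      refine mul_le_mul_of_nonneg_left ?_ (norm_nonneg _)
      refine (hcs _ R _ hR (by positivity)).trans ?_
      rw [Real.exp_le_exp]
      gcongr
      exact norm_add_le _ _
    have hs' : ∀ R, Summable fun k => ‖a' k‖ * Real.exp (R * ‖β' k‖) := by
      refine hmono fun R hR => ?_
      have h1 := summable_mul_gaussian_dual b' hw x (c := fun _ => 1) (C := 1) (K := 0)
        (by simp) (R * (4 * Real.pi) * ‖e‖)
      refine Summable.of_nonneg_of_le (fun _ => by positivity) (fun k => ?_) h1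
      rw [one_mul, hβ']
      refine mul_le_mul_of_nonneg_left ?_ (norm_nonneg _)
      exact hcs _ R _ hR (by positivity)
    have key := second_deriv_tsum_cexp (c := c) (C := poissonFactor b w) hs hs' (fun t => by
      have h1 := tsum_gaussian hb hw (x + t • e)
      have h2 : ∀ v, Complex.exp (2 * Real.pi * Complex.I * w *
          (‖latVec b v + (x + t • e)‖ ^ 2 : ℝ)) =
          Complex.exp (c * t ^ 2) * (a v * Complex.exp (t * β v)) := by
        intro v
        simp only [a, β, c]
        rw [← Complex.exp_add, ← Complex.exp_add, ← add_assoc, norm_add_sq_real, norm_smul,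
          inner_smul_right, mul_pow, Real.norm_eq_abs, sq_abs]
        congr 1
        push_cast
        ring
      have h3 : ∀ k, Complex.exp (2 * Real.pi * Complex.I * (2 * ⟪latVec b' k, x + t • e⟫ : ℝ)) *
          Complex.exp (2 * Real.pi * Complex.I * (-1 / w) * (‖latVec b' k‖ ^ 2 : ℝ)) =
          a' k * Complex.exp (t * β' k) := by
        intro k
        simp only [a', β']
        rw [← Complex.exp_add, ← Complex.exp_add, ← Complex.exp_add, inner_add_right,
          inner_smul_right]
        congr 1
        push_cast
        ring
      simp only [h2, h3] at h1
      rw [tsum_mul_left] at h1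
      exact h1)
    have e1 : ∀ v, a v * β v ^ 2 = (4 * Real.pi * Complex.I) ^ 2 * w ^ 2 *
        (((⟪latVec b v + x, e⟫ ^ 2 : ℝ) : ℂ) * a v) := by
      intro v
      simp only [β]
      push_cast
      ring
    have e2 : ∀ v, a' v * β' v ^ 2 = (4 * Real.pi * Complex.I) ^ 2 *
        (((⟪latVec b' v, e⟫ ^ 2 : ℝ) : ℂ) * a' v) := by
      intro v
      simp only [β']
      push_cast
      ring
    simp only [e1, e2, tsum_mul_left] at key
    change w ^ 2 * (∑' v, ((⟪latVec b v + x, e⟫ ^ 2 : ℝ) : ℂ) * a v) +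
      w * ((‖e‖ ^ 2 : ℝ) : ℂ) / (4 * Real.pi * Complex.I) * (∑' v, a v) =
      poissonFactor b w * ∑' k, ((⟪latVec b' k, e⟫ ^ 2 : ℝ) : ℂ) * a' k
    have h4 : (4 * Real.pi * Complex.I) ≠ 0 := by
      simp [Real.pi_ne_zero]
    have h5 : w * ((‖e‖ ^ 2 : ℝ) : ℂ) / (4 * Real.pi * Complex.I) =
        (2 * c) / (4 * Real.pi * Complex.I) ^ 2 := by
      simp only [c]
      field_simp
      ring
    rw [h5]
    refine mul_left_cancel₀ (pow_ne_zero 2 h4) ?_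
    rw [mul_left_comm _ (poissonFactor b w), ← key, mul_add, ← mul_assoc, ← mul_assoc,
      mul_div_cancel₀ _ (pow_ne_zero 2 h4)]
    ring

/-- The value `∑ᵢⱼ Hᵢⱼ xᵢ xⱼ` of a quadratic form. -/
noncomputable def quadEval (H : Matrix (Fin n) (Fin n) ℝ) (x : EuclideanSpace ℝ (Fin n)) : ℝ :=
  ∑ i, ∑ j, H i j * (x i * x j)

/-- Polarisation writes yᵢyⱼ as a quarter of (yᵢ+yⱼ)² − (yᵢ−yⱼ)². The same combination of the
corrections ‖eᵢ ± eⱼ‖² is the Kronecker symbol, so they add up to the trace. -/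
theorem thetaInversion_quadEval (hb : IsPolarDual b b') {w : ℂ} (hw : 0 < w.im)
    (x : EuclideanSpace ℝ (Fin n)) (H : Matrix (Fin n) (Fin n) ℝ) :
    ThetaInversion b b' w x (fun y => (quadEval H y : ℂ)) (H.trace : ℂ) := by
  let e : Fin n → EuclideanSpace ℝ (Fin n) := fun i => EuclideanSpace.single i 1
  have h1 : ∀ i j, ThetaInversion b b' w x (fun y => (H i j : ℂ) *
      ((1 / 4 : ℂ) * ((⟪y, e i + e j⟫ ^ 2 : ℝ) : ℂ) +
        (-1 / 4 : ℂ) * ((⟪y, e i - e j⟫ ^ 2 : ℝ) : ℂ)))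
      ((H i j : ℂ) * ((1 / 4 : ℂ) * ((‖e i + e j‖ ^ 2 : ℝ) : ℂ) +
        (-1 / 4 : ℂ) * ((‖e i - e j‖ ^ 2 : ℝ) : ℂ))) := fun i j =>
    (((thetaInversion_inner_sq hb hw x _).const_mul _).add
      ((thetaInversion_inner_sq hb hw x _).const_mul _)).const_mul _
  have h2 := ThetaInversion.sum Finset.univ fun i _ =>
    ThetaInversion.sum Finset.univ fun j _ => h1 i j
  convert h2 using 1
  · funext y
    simp only [quadEval]
    push_cast
    refine Finset.sum_congr rfl fun i _ => Finset.sum_congr rfl fun j _ => ?_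
    simp only [e, inner_add_right, inner_sub_right, EuclideanSpace.inner_single_right]
    simp only [conj_trivial]
    push_cast
    ring
  · rw [Matrix.trace]
    push_cast
    refine Finset.sum_congr rfl fun i _ => ?_
    rw [Finset.sum_eq_single i]
    · rw [sub_self, ← two_smul ℝ (e i), norm_smul]
      simp [e]
      norm_num
    · intro j _ hj
      have h3 : ⟪e i, e j⟫ = 0 := by
        simp [e, EuclideanSpace.inner_single_left, hj.symm]
      rw [← Complex.ofReal_pow, ← Complex.ofReal_pow, norm_add_sq_real, norm_sub_sq_real, h3]
      push_cast
      ring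
    · simp

end

/-! ### Sums over residue classes -/

/-- The standard integral representatives of a vector of residue classes. -/
def residueLift {n q : ℕ} (u : Fin n → ZMod q) : Fin n → ℤ := fun i => (u i).val

/-- Division with remainder in every coordinate. -/
def residueEquiv (n q : ℕ) [NeZero q] : (Fin n → ZMod q) × (Fin n → ℤ) ≃ (Fin n → ℤ) where
  toFun p := residueLift p.1 + (q : ℤ) • p.2
  invFun v := (fun i => (v i : ZMod q), fun i => v i / q)
  left_inv p := by
    have hq : (q : ℤ) ≠ 0 := by exact_mod_cast NeZero.ne q
    ext i
    · simp [residueLift]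
    · have h1 : ((p.1 i).val : ℤ) / q = 0 :=
        Int.ediv_eq_zero_of_lt (by positivity) (by exact_mod_cast ZMod.val_lt _)
      change (((p.1 i).val : ℤ) + q * p.2 i) / q = p.2 i
      rw [Int.add_mul_ediv_left _ _ hq, h1, zero_add]
  right_inv v := by
    funext i
    simp [residueLift, ZMod.val_intCast, Int.emod_add_mul_ediv, -ZMod.natCast_val]

theorem tsum_eq_sum_residue {n : ℕ} (q : ℕ) [NeZero q] {f : (Fin n → ℤ) → ℂ} (hf : Summable f) :
    ∑' v, f v = ∑ u : Fin n → ZMod q, ∑' v, f (residueLift u + (q : ℤ) • v) := by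
  have h1 : Summable fun p => f (residueEquiv n q p) := (residueEquiv n q).summable_iff.mpr hf
  rw [← (residueEquiv n q).tsum_eq, h1.tsum_prod, tsum_fintype]
  rfl

theorem periodic_congr {n q : ℕ} {Φ : (Fin n → ℤ) → ℂ} (hΦ : ∀ v w, Φ (v + (q : ℤ) • w) = Φ v)
    {v w : Fin n → ℤ} (h : ∀ i, (v i : ZMod q) = w i) : Φ v = Φ w := by
  have h1 : ∀ i, ∃ m, w i = v i + q * m := fun i => by
    obtain ⟨m, hm⟩ := (ZMod.intCast_eq_intCast_iff_dvd_sub _ _ _).mp (h i)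
    exact ⟨m, by linarith⟩
  choose m hm using h1
  have : w = v + (q : ℤ) • m := funext fun i => by simp [hm i]
  rw [this, hΦ]

theorem residueLift_cast {n q : ℕ} [NeZero q] (u : Fin n → ZMod q) (i : Fin n) :
    ((residueLift u i : ℤ) : ZMod q) = u i := by
  simp [residueLift]

theorem sum_residue_add {n q : ℕ} [NeZero q] {Φ : (Fin n → ℤ) → ℂ}
    (hΦ : ∀ v w, Φ (v + (q : ℤ) • w) = Φ v) (s : Fin n → ℤ) :
    ∑ u : Fin n → ZMod q, Φ (residueLift u + s) = ∑ u : Fin n → ZMod q, Φ (residueLift u) := by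
  refine Eq.trans ?_ (Equiv.sum_comp (Equiv.addRight fun i => (s i : ZMod q))
    fun u => Φ (residueLift u))
  refine Finset.sum_congr rfl fun u _ => periodic_congr hΦ fun i => ?_
  rw [residueLift_cast]
  simp only [Pi.add_apply, Int.cast_add, residueLift_cast, Equiv.coe_addRight]

/-! ### Theta series -/

section

variable {n : ℕ} {b b' : Module.Basis (Fin n) ℝ (EuclideanSpace ℝ (Fin n))}

/-- The theta series `∑ᵥ c(v) exp(2πi‖λᵥ‖²z)`. -/
noncomputable def thetaSeries (b : Module.Basis (Fin n) ℝ (EuclideanSpace ℝ (Fin n)))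
    (c : (Fin n → ℤ) → ℂ) (z : ℂ) : ℂ :=
  ∑' v, c v * Complex.exp (2 * Real.pi * Complex.I * z * (‖latVec b v‖ ^ 2 : ℝ))

/-- Homogeneous functions of degree `ν` which satisfy the theta inversion formula. -/
structure IsThetaWeight (b b' : Module.Basis (Fin n) ℝ (EuclideanSpace ℝ (Fin n)))
    (h : EuclideanSpace ℝ (Fin n) → ℂ) (ν : ℕ) : Prop where
  homogeneous : ∀ (r : ℝ) x, h (r • x) = (r : ℂ) ^ ν * h x
  growth : ∃ C K : ℝ, ∀ x, ‖h x‖ ≤ C * Real.exp (K * ‖x‖)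
  inversion : ∀ (w : ℂ), 0 < w.im → ∀ x, ∑' v, h (latVec b v + x) *
      Complex.exp (2 * Real.pi * Complex.I * w * (‖latVec b v + x‖ ^ 2 : ℝ)) =
    poissonFactor b w / w ^ ν * ∑' k, h (latVec b' k) *
      (Complex.exp (2 * Real.pi * Complex.I * (2 * ⟪latVec b' k, x⟫ : ℝ)) *
      Complex.exp (2 * Real.pi * Complex.I * (-1 / w) * (‖latVec b' k‖ ^ 2 : ℝ)))

theorem isThetaWeight_one (hb : IsPolarDual b b') : IsThetaWeight b b' (fun _ => 1) 0 where
  homogeneous := by simp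
  growth := ⟨1, 0, by simp⟩
  inversion w hw x := by simpa using tsum_gaussian hb hw x

theorem quadEval_growth (H : Matrix (Fin n) (Fin n) ℝ) :
    ∃ C K : ℝ, ∀ x, ‖(quadEval H x : ℂ)‖ ≤ C * Real.exp (K * ‖x‖) := by
  refine ⟨∑ i, ∑ j, |H i j|, 2, fun x => ?_⟩
  rw [Complex.norm_real, Real.norm_eq_abs, quadEval, Finset.sum_mul]
  refine (Finset.abs_sum_le_sum_abs _ _).trans (Finset.sum_le_sum fun i _ => ?_)
  rw [Finset.sum_mul]
  refine (Finset.abs_sum_le_sum_abs _ _).trans (Finset.sum_le_sum fun j _ => ?_)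
  rw [abs_mul, abs_mul]
  have h1 : ∀ i, |x i| ≤ Real.exp ‖x‖ := fun i => by
    have : |x i| ≤ ‖x‖ := by simpa using PiLp.norm_apply_le x i
    linarith [Real.add_one_le_exp ‖x‖]
  have h2 : Real.exp (2 * ‖x‖) = Real.exp ‖x‖ * Real.exp ‖x‖ := by
    rw [← Real.exp_add, two_mul]
  rw [h2]
  gcongr
  · exact h1 i
  · exact h1 j

/-- This is where harmonicity enters modularity: zero trace removes the correction term from the
inversion formula. -/
theorem isThetaWeight_quadEval (hb : IsPolarDual b b') {H : Matrix (Fin n) (Fin n) ℝ}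
    (hH : H.trace = 0) : IsThetaWeight b b' (fun x => (quadEval H x : ℂ)) 2 where
  homogeneous r x := by
    simp only [quadEval]
    push_cast
    simp only [Finset.mul_sum]
    refine Finset.sum_congr rfl fun i _ => Finset.sum_congr rfl fun j _ => ?_
    simp only [PiLp.smul_apply, smul_eq_mul]
    push_cast
    ring
  growth := quadEval_growth H
  inversion w hw x := by
    have hw0 : w ≠ 0 := by
      rintro rfl
      simp at hw
    have h1 := (thetaInversion_quadEval hb hw x H).2.2
    rw [hH, Complex.ofReal_zero, mul_zero, zero_div, zero_mul, add_zero] at h1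
    rw [div_mul_eq_mul_div, ← h1, mul_div_cancel_left₀ _ (pow_ne_zero 2 hw0)]

theorem summable_thetaSeries (b : Module.Basis (Fin n) ℝ (EuclideanSpace ℝ (Fin n)))
    {c : (Fin n → ℤ) → ℂ} {C K : ℝ} (hc : ∀ v, ‖c v‖ ≤ C * Real.exp (K * ‖latVec b v‖)) {z : ℂ}
    (hz : 0 < z.im) :
    Summable fun v => c v * Complex.exp (2 * Real.pi * Complex.I * z * (‖latVec b v‖ ^ 2 : ℝ)) := by
  refine Summable.of_norm ?_
  simpa using summable_mul_gaussian b hz 0 hc 0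

/-- The Gauss sum `∑ᵤ e((a‖λᵤ‖² + 2⟪ηₖ, λᵤ⟫) / q)` over residue classes modulo `q`. -/
noncomputable def latticeGaussSum (b b' : Module.Basis (Fin n) ℝ (EuclideanSpace ℝ (Fin n)))
    (a : ℤ) (q : ℕ) [NeZero q] (k : Fin n → ℤ) : ℂ :=
  ∑ u : Fin n → ZMod q, Complex.exp (2 * Real.pi * Complex.I *
    ((a * ‖latVec b (residueLift u)‖ ^ 2 + 2 * ⟪latVec b' k, latVec b (residueLift u)⟫) / q : ℝ))

theorem norm_latticeGaussSum_le (b b' : Module.Basis (Fin n) ℝ (EuclideanSpace ℝ (Fin n)))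
    (a : ℤ) (q : ℕ) [NeZero q] (k : Fin n → ℤ) :
    ‖latticeGaussSum b b' a q k‖ ≤ Fintype.card (Fin n → ZMod q) := by
  refine (norm_sum_le _ _).trans ?_
  have : ∀ r : ℝ, ‖Complex.exp (2 * Real.pi * Complex.I * (r : ℂ))‖ = 1 := fun r => by
    rw [Complex.norm_exp]
    simp
  simp only [this]
  simp

theorem cexp_two_pi_int (m : ℤ) : Complex.exp (2 * Real.pi * Complex.I * (m : ℝ)) = 1 := by
  rw [Complex.exp_eq_one_iff]
  exact ⟨m, by push_cast; ring⟩

theorem cexp_two_pi_eq_of_sub_int {x y : ℝ} (h : ∃ m : ℤ, x = y + m) :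
    Complex.exp (2 * Real.pi * Complex.I * (x : ℂ)) =
      Complex.exp (2 * Real.pi * Complex.I * (y : ℂ)) := by
  obtain ⟨m, rfl⟩ := h
  rw [Complex.ofReal_add, mul_add, Complex.exp_add, cexp_two_pi_int, mul_one]

/-- The quadratic form of the lattice is integral. -/
def IsIntegralBasis (b : Module.Basis (Fin n) ℝ (EuclideanSpace ℝ (Fin n))) : Prop :=
  ∀ v, ∃ m : ℤ, ‖latVec b v‖ ^ 2 = m

theorem IsIntegralBasis.inner (hI : IsIntegralBasis b) (v w : Fin n → ℤ) :
    ∃ m : ℤ, 2 * ⟪latVec b v, latVec b w⟫ = m := by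
  obtain ⟨m1, h1⟩ := hI (v + w)
  obtain ⟨m2, h2⟩ := hI v
  obtain ⟨m3, h3⟩ := hI w
  refine ⟨m1 - m2 - m3, ?_⟩
  rw [latVec_add, norm_add_sq_real] at h1
  push_cast
  linarith

theorem IsIntegralBasis.norm_add_smul (hI : IsIntegralBasis b) (v w : Fin n → ℤ) (q : ℤ) :
    ∃ m : ℤ, ‖latVec b (v + q • w)‖ ^ 2 = ‖latVec b v‖ ^ 2 + q * m := by
  obtain ⟨m1, h1⟩ := hI.inner v w
  obtain ⟨m2, h2⟩ := hI w
  refine ⟨m1 + q * m2, ?_⟩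
  rw [latVec_add, latVec_smul, norm_add_sq_real, norm_smul, mul_pow, h2, inner_smul_right,
    Real.norm_eq_abs, sq_abs]
  push_cast
  linear_combination (q : ℝ) * h1

/-- By integrality exp(2πi a‖λ‖²/q) depends only on λ modulo q. Each residue class is q times a
lattice shifted by λᵤ/q, to which inversion applies, and the characters produced by these shifts
combine with the phases into Gauss sums. -/
theorem thetaSeries_rational_add (hI : IsIntegralBasis b)
    {h : EuclideanSpace ℝ (Fin n) → ℂ} {ν : ℕ} (hh : IsThetaWeight b b' h ν) (a : ℤ) (q : ℕ)
    [NeZero q] {w : ℂ} (hw : 0 < w.im) :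
    thetaSeries b (fun v => h (latVec b v)) (a / q + w) =
      poissonFactor b (q ^ 2 * w) / (q * w) ^ ν *
        thetaSeries b' (fun k => h (latVec b' k) * latticeGaussSum b b' a q k)
          (-1 / (q ^ 2 * w)) := by
  have hq : (q : ℂ) ≠ 0 := by exact_mod_cast NeZero.ne q
  have hqr : (q : ℝ) ≠ 0 := by exact_mod_cast NeZero.ne q
  have hw0 : w ≠ 0 := by
    rintro rfl
    simp at hw
  have hw1 : 0 < ((a / q + w : ℂ)).im := by
    have : (a / q : ℂ) = ((a / q : ℝ) : ℂ) := by push_cast; rfl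
    rw [Complex.add_im, this, Complex.ofReal_im, zero_add]
    exact hw
  have hw2 : 0 < ((q : ℂ) ^ 2 * w).im := by
    have : ((q : ℂ) ^ 2) = (((q : ℝ) ^ 2 : ℝ) : ℂ) := by push_cast; rfl
    rw [this, Complex.im_ofReal_mul]
    positivity
  obtain ⟨C, K, hg⟩ := hh.growth
  rw [thetaSeries, tsum_eq_sum_residue q (summable_thetaSeries b (fun v => hg _) hw1)]
  have hterm : ∀ (u : Fin n → ZMod q) (v : Fin n → ℤ),
      h (latVec b (residueLift u + (q : ℤ) • v)) * Complex.exp (2 * Real.pi * Complex.I *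
        (a / q + w) * (‖latVec b (residueLift u + (q : ℤ) • v)‖ ^ 2 : ℝ)) =
      (q : ℂ) ^ ν * Complex.exp (2 * Real.pi * Complex.I *
          (a * ‖latVec b (residueLift u)‖ ^ 2 / q : ℝ)) *
        (h (latVec b v + (q : ℝ)⁻¹ • latVec b (residueLift u)) *
          Complex.exp (2 * Real.pi * Complex.I * (q ^ 2 * w) *
            (‖latVec b v + (q : ℝ)⁻¹ • latVec b (residueLift u)‖ ^ 2 : ℝ))) := by
    intro u v
    have e1 : latVec b (residueLift u + (q : ℤ) • v) =
        (q : ℝ) • (latVec b v + (q : ℝ)⁻¹ • latVec b (residueLift u)) := by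
      rw [latVec_add, latVec_smul, smul_add, smul_smul, mul_inv_cancel₀ hqr, one_smul, add_comm,
        Int.cast_natCast]
    have e2 : Complex.exp (2 * Real.pi * Complex.I * ((a : ℂ) / q) *
        (‖latVec b (residueLift u + (q : ℤ) • v)‖ ^ 2 : ℝ)) =
        Complex.exp (2 * Real.pi * Complex.I *
          (a * ‖latVec b (residueLift u)‖ ^ 2 / q : ℝ)) := by
      obtain ⟨m, hm⟩ := hI.norm_add_smul (residueLift u) v q
      rw [hm, ← cexp_two_pi_eq_of_sub_int (x := a * (‖latVec b (residueLift u)‖ ^ 2 + q * m) / q)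
        ⟨a * m, by push_cast; field_simp⟩]
      congr 1
      push_cast
      field_simp
    rw [mul_add (2 * Real.pi * Complex.I), add_mul, Complex.exp_add, e2, e1, hh.homogeneous,
      norm_smul, mul_pow, Real.norm_eq_abs, sq_abs]
    rw [Complex.ofReal_mul (_ ^ 2), Complex.ofReal_pow (q : ℝ), Complex.ofReal_natCast]
    have e3 : 2 * Real.pi * Complex.I * w * ((q : ℂ) ^ 2 *
        (‖latVec b v + (q : ℝ)⁻¹ • latVec b (residueLift u)‖ ^ 2 : ℝ)) =
      2 * Real.pi * Complex.I * (q ^ 2 * w) *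
        (‖latVec b v + (q : ℝ)⁻¹ • latVec b (residueLift u)‖ ^ 2 : ℝ) := by ring
    rw [e3]
    ring
  simp only [hterm, tsum_mul_left, hh.inversion _ hw2]
  have hsum : ∀ u : Fin n → ZMod q, Summable fun k =>
      Complex.exp (2 * Real.pi * Complex.I * (a * ‖latVec b (residueLift u)‖ ^ 2 / q : ℝ)) *
      (h (latVec b' k) * (Complex.exp (2 * Real.pi * Complex.I *
        (2 * ⟪latVec b' k, (q : ℝ)⁻¹ • latVec b (residueLift u)⟫ : ℝ)) *
      Complex.exp (2 * Real.pi * Complex.I * (-1 / (q ^ 2 * w)) *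
        (‖latVec b' k‖ ^ 2 : ℝ)))) := fun u => by
    refine Summable.mul_left _ (Summable.of_norm ?_)
    simpa only [zero_mul, Real.exp_zero, mul_one] using
      summable_mul_gaussian_dual b' hw2 ((q : ℝ)⁻¹ • latVec b (residueLift u))
        (fun k => hg (latVec b' k)) 0
  -- Rescaling the weight by q gives q^ν by homogeneity, while inversion at q²w costs (q²w)^ν;
  -- together they leave (qw)^ν in the denominator.
  have hfac : (q : ℂ) ^ ν * (poissonFactor b (q ^ 2 * w) / (q ^ 2 * w) ^ ν) =
      poissonFactor b (q ^ 2 * w) / (q * w) ^ ν := by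
    rw [← mul_div_assoc, div_eq_div_iff (by positivity) (by positivity)]
    simp only [mul_pow, ← pow_mul]
    ring
  rw [thetaSeries, ← hfac]
  have hswap : ∀ u : Fin n → ZMod q, (q : ℂ) ^ ν * Complex.exp (2 * Real.pi * Complex.I *
        (a * ‖latVec b (residueLift u)‖ ^ 2 / q : ℝ)) *
      (poissonFactor b (q ^ 2 * w) / (q ^ 2 * w) ^ ν * ∑' k, h (latVec b' k) *
        (Complex.exp (2 * Real.pi * Complex.I *
          (2 * ⟪latVec b' k, (q : ℝ)⁻¹ • latVec b (residueLift u)⟫ : ℝ)) *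
        Complex.exp (2 * Real.pi * Complex.I * (-1 / (q ^ 2 * w)) *
          (‖latVec b' k‖ ^ 2 : ℝ)))) =
      (q : ℂ) ^ ν * (poissonFactor b (q ^ 2 * w) / (q ^ 2 * w) ^ ν) *
        ∑' k, Complex.exp (2 * Real.pi * Complex.I *
          (a * ‖latVec b (residueLift u)‖ ^ 2 / q : ℝ)) * (h (latVec b' k) *
        (Complex.exp (2 * Real.pi * Complex.I *
          (2 * ⟪latVec b' k, (q : ℝ)⁻¹ • latVec b (residueLift u)⟫ : ℝ)) *
        Complex.exp (2 * Real.pi * Complex.I * (-1 / (q ^ 2 * w)) *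
          (‖latVec b' k‖ ^ 2 : ℝ)))) := by
    intro u
    rw [tsum_mul_left]
    ring
  rw [Finset.sum_congr rfl fun u _ => hswap u, ← Finset.mul_sum,
    ← Summable.tsum_finsetSum fun u _ => hsum u]
  congr 1
  refine tsum_congr fun k => ?_
  rw [latticeGaussSum, Finset.mul_sum, Finset.sum_mul]
  refine Finset.sum_congr rfl fun u _ => ?_
  have e4 : Complex.exp (2 * Real.pi * Complex.I * ((a * ‖latVec b (residueLift u)‖ ^ 2 +
      2 * ⟪latVec b' k, latVec b (residueLift u)⟫) / q : ℝ)) =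
      Complex.exp (2 * Real.pi * Complex.I * (a * ‖latVec b (residueLift u)‖ ^ 2 / q : ℝ)) *
      Complex.exp (2 * Real.pi * Complex.I *
        (2 * ⟪latVec b' k, (q : ℝ)⁻¹ • latVec b (residueLift u)⟫ : ℝ)) := by
    rw [← Complex.exp_add, inner_smul_right, ← mul_add, ← Complex.ofReal_add]
    congr 3
    field_simp
  rw [e4]
  ring

end

/-! ### Quadratic Gauss sums over a prime field -/

/-- The number of square roots of t is 1 + χ(t) for the quadratic character χ, so the sum is the
Gauss sum of χ, with square χ(−1)p. The unit `a` is absorbed into the additive character, so the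
square does not depend on it. -/
theorem sum_addChar_mul_self_sq {p : ℕ} [Fact p.Prime] (hp : p ≠ 2) (a : (ZMod p)ˣ) :
    (∑ x : ZMod p, ZMod.stdAddChar ((a : ZMod p) * (x * x))) ^ 2 =
      ((ZMod.χ₄ p : ℤ) : ℂ) * p := by
  have hF : ringChar (ZMod p) ≠ 2 := by rwa [ZMod.ringChar_zmod_n]
  let χ : MulChar (ZMod p) ℂ := (quadraticChar (ZMod p)).ringHomComp (Int.castRingHom ℂ)
  have hχ : χ ≠ 1 := by
    obtain ⟨x, hx⟩ := quadraticChar_exists_neg_one' hF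
    intro h
    have h1 := DFunLike.congr_fun h (x : ZMod p)
    simp [χ, hx] at h1
    norm_num at h1
  have hq : χ.IsQuadratic := (quadraticChar_isQuadratic (ZMod p)).comp _
  let ψ : AddChar (ZMod p) ℂ := ZMod.stdAddChar.mulShift (a : ZMod p)
  have hψ : ψ.IsPrimitive := by
    intro c hc h1
    refine ZMod.isPrimitive_stdAddChar p (mul_ne_zero a.ne_zero hc) ?_
    rw [← h1]
    ext x
    simp [ψ, AddChar.mulShift_apply, mul_assoc]
  have h0 : ∑ x : ZMod p, ψ x = 0 := by
    refine AddChar.sum_eq_zero_of_ne_one ?_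
    have := hψ one_ne_zero
    rwa [AddChar.mulShift_one] at this
  have hsum : ∑ x : ZMod p, ZMod.stdAddChar ((a : ZMod p) * (x * x)) = gaussSum χ ψ := by
    classical
    calc ∑ x : ZMod p, ZMod.stdAddChar ((a : ZMod p) * (x * x)) = ∑ x : ZMod p, ψ (x ^ 2) := by
          simp [ψ, AddChar.mulShift_apply, sq]
      _ = ∑ t : ZMod p, ∑ x : ZMod p with x ^ 2 = t, ψ (x ^ 2) :=
          (Finset.sum_fiberwise _ _ _).symm
      _ = ∑ t : ZMod p, (χ t + 1) * ψ t := by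
          refine Finset.sum_congr rfl fun t _ => ?_
          rw [Finset.sum_congr rfl (g := fun _ => ψ t) (fun x hx => by
            rw [(Finset.mem_filter.mp hx).2]), Finset.sum_const, nsmul_eq_mul]
          congr 1
          have h2 := quadraticChar_card_sqrts hF t
          have h3 : (Finset.univ.filter fun x : ZMod p => x ^ 2 = t) =
              {x : ZMod p | x ^ 2 = t}.toFinset := by
            ext x
            simp
          rw [h3]
          have h4 := congrArg (Int.cast : ℤ → ℂ) h2
          push_cast at h4
          exact h4
      _ = gaussSum χ ψ := by
          simp only [add_mul, one_mul, Finset.sum_add_distrib, h0, add_zero]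
          rfl
  rw [hsum, gaussSum_sq hχ hq hψ, ZMod.card]
  congr 1
  have := quadraticChar_neg_one hF
  rw [ZMod.card] at this
  simp [χ, this]

/-- Diagonalise the form, possible since p is odd; the sum becomes a product of one-variable sums.
Their squares do not depend on the diagonal entries, so after squaring the discriminant disappears.
-/
theorem sum_addChar_bilinForm_sq {n p : ℕ} [Fact p.Prime] (hp : p ≠ 2)
    (B : LinearMap.BilinForm (ZMod p) (Fin n → ZMod p)) (hB : ∀ x y, B x y = B y x)
    (hnd : ∀ x, (∀ y, B x y = 0) → x = 0) :
    (∑ x, ZMod.stdAddChar (B x x)) ^ 2 = (((ZMod.χ₄ p : ℤ) : ℂ) * p) ^ n := by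
  have h2 : (2 : ZMod p) ≠ 0 := by
    have := (ZMod.natCast_eq_zero_iff 2 p).not.mpr
      (fun h => hp ((Nat.prime_dvd_prime_iff_eq Fact.out Nat.prime_two).mp h))
    simpa using this
  let _ : Invertible (2 : ZMod p) := invertibleOfNonzero h2
  let Q : QuadraticForm (ZMod p) (Fin n → ZMod p) := B.toQuadraticMap
  obtain ⟨w, ⟨e⟩⟩ := Q.equivalent_weightedSumSquares_units_of_nondegenerate' (by
    have : QuadraticMap.associated (R := ZMod p) Q = B :=
      QuadraticMap.associated_left_inverse (S := ZMod p) hB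
    rw [this]
    exact hnd)
  have hdim : Module.finrank (ZMod p) (Fin n → ZMod p) = n := by simp
  have h3 : ∑ x, ZMod.stdAddChar (B x x) =
      ∏ i, ∑ x : ZMod p, ZMod.stdAddChar ((w i : ZMod p) * (x * x)) := by
    rw [Finset.prod_univ_sum, Fintype.piFinset_univ,
      ← e.toLinearEquiv.toEquiv.sum_comp]
    refine Finset.sum_congr rfl fun x _ => ?_
    have h4 : B x x = QuadraticMap.weightedSumSquares (ZMod p) w (e x) := (e.map_app x).symm
    rw [h4, QuadraticMap.weightedSumSquares_apply]
    have h5 := map_prod (ZMod.stdAddChar (N := p)).toMonoidHom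
      (fun i => Multiplicative.ofAdd (w i • (e x i * e x i))) Finset.univ
    rw [← ofAdd_sum] at h5
    exact h5
  rw [h3, ← Finset.prod_pow, Finset.prod_congr rfl fun i _ => sum_addChar_mul_self_sq hp (w i)]
  simp [hdim]

section

variable {n : ℕ} {b b' : Module.Basis (Fin n) ℝ (EuclideanSpace ℝ (Fin n))}

theorem latticeGaussSum_zero_sq (hI : IsIntegralBasis b) {p : ℕ} [Fact p.Prime] (hp : p ≠ 2)
    {a : ℤ} (ha : ¬ (p : ℤ) ∣ a)
    (hnd : ∀ v : Fin n → ℤ, (∀ u, ∃ m : ℤ, 2 * ⟪latVec b v, latVec b u⟫ = p * m) →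
      ∀ i, (p : ℤ) ∣ v i) :
    latticeGaussSum b b' a p 0 ^ 2 = (((ZMod.χ₄ p : ℤ) : ℂ) * p) ^ n := by
  have h2 : (2 : ZMod p) ≠ 0 := by
    have := (ZMod.natCast_eq_zero_iff 2 p).not.mpr
      (fun h => hp ((Nat.prime_dvd_prime_iff_eq Fact.out Nat.prime_two).mp h))
    simpa using this
  have ha' : (a : ZMod p) ≠ 0 := by rwa [Ne, ZMod.intCast_zmod_eq_zero_iff_dvd]
  choose M hM using fun i j => hI.inner (Pi.single i 1) (Pi.single j 1)
  have hsingle : ∀ i, latVec b (Pi.single i 1) = b i := fun i => by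
    rw [latVec, Finset.sum_eq_single i]
    · simp
    · intro j _ hj
      simp [Pi.single_eq_of_ne hj]
    · simp
  simp only [hsingle] at hM
  have hMs : ∀ i j, M i j = M j i := fun i j => by
    have := hM i j
    rw [real_inner_comm, hM j i] at this
    exact_mod_cast this.symm
  have hinner : ∀ v u, 2 * ⟪latVec b v, latVec b u⟫ = ((∑ i, ∑ j, v i * M i j * u j : ℤ) : ℝ) := by
    intro v u
    simp only [latVec, sum_inner, inner_sum, inner_smul_left, inner_smul_right, Finset.mul_sum]
    rw [Finset.sum_comm]
    push_cast
    refine Finset.sum_congr rfl fun i _ => Finset.sum_congr rfl fun j _ => ?_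
    rw [← hM i j]
    simp
    ring
  -- `M` is the matrix of the polar form 2⟪·,·⟫, so recovering a‖λ‖² modulo p requires division by
  -- two.
  let M' : Matrix (Fin n) (Fin n) (ZMod p) :=
    Matrix.of fun i j => (a : ZMod p) * (2 : ZMod p)⁻¹ * (M i j : ZMod p)
  let B : LinearMap.BilinForm (ZMod p) (Fin n → ZMod p) := Matrix.toLinearMap₂' (ZMod p) M'
  have hB : ∀ x y, B x y = (a : ZMod p) * (2 : ZMod p)⁻¹ * ∑ i, ∑ j, x i * M i j * y j := by
    intro x y
    simp only [B, Matrix.toLinearMap₂'_apply, M', Matrix.of_apply, Finset.mul_sum, smul_eq_mul]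
    refine Finset.sum_congr rfl fun i _ => Finset.sum_congr rfl fun j _ => ?_
    ring
  have hBs : ∀ x y, B x y = B y x := fun x y => by
    rw [hB, hB, Finset.sum_comm]
    congr 1
    refine Finset.sum_congr rfl fun i _ => Finset.sum_congr rfl fun j _ => ?_
    rw [hMs]
    ring
  rw [← sum_addChar_bilinForm_sq hp B hBs]
  · rw [latticeGaussSum]
    congr 1
    refine Finset.sum_congr rfl fun u _ => ?_
    obtain ⟨m, hm⟩ := hI (residueLift u)
    have h1 : (2 : ℝ) * m = ((∑ i, ∑ j, residueLift u i * M i j * residueLift u j : ℤ) : ℝ) := by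
      rw [← hinner, real_inner_self_eq_norm_sq, hm]
    have h3 : 2 * m = ∑ i, ∑ j, residueLift u i * M i j * residueLift u j := by exact_mod_cast h1
    have h4 : B u u = ((a * m : ℤ) : ZMod p) := by
      have h5 := congrArg (Int.cast : ℤ → ZMod p) h3
      push_cast at h5
      simp only [residueLift_cast] at h5
      rw [hB, ← h5]
      push_cast
      field_simp
    rw [h4, ZMod.stdAddChar_coe, latVec_zero, inner_zero_left, hm]
    congr 1
    push_cast
    ring
  · intro x hx
    have h1 := hnd (residueLift x) (fun u => by
      rw [hinner]
      have h3 := hx (fun i => (u i : ZMod p))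
      rw [hB] at h3
      have h5 : (((∑ i, ∑ j, residueLift x i * M i j * u j : ℤ)) : ZMod p) = 0 := by
        push_cast
        simp only [residueLift_cast]
        rcases mul_eq_zero.mp h3 with h | h
        · exact absurd h (mul_ne_zero ha' (inv_ne_zero h2))
        · exact h
      obtain ⟨m, hm⟩ := (ZMod.intCast_zmod_eq_zero_iff_dvd _ _).mp h5
      exact ⟨m, by rw [hm]; push_cast; rfl⟩)
    funext i
    rw [← residueLift_cast x i]
    exact (ZMod.intCast_zmod_eq_zero_iff_dvd _ _).mpr (h1 i)

/-! ### The automorphy factor -/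

/-- Keeps the base of the complex power in `poissonFactor` off the branch cut, which gives
nonvanishing and holomorphy. -/
theorem re_pi_div_pos {w : ℂ} (hw : 0 < w.im) :
    0 < ((Real.pi : ℂ) / (-(2 * Real.pi * Complex.I * w))).re := by
  have hw0 : w ≠ 0 := by
    rintro rfl
    simp at hw
  have h1 : (Real.pi : ℂ) / (-(2 * Real.pi * Complex.I * w)) =
      ((1 / 2 : ℝ) : ℂ) * (-Complex.I * w)⁻¹ := by
    have : (Real.pi : ℂ) ≠ 0 := by exact_mod_cast Real.pi_ne_zero
    push_cast
    field_simp
  rw [h1, Complex.re_ofReal_mul, Complex.inv_re]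
  have h2 : (-Complex.I * w).re = w.im := by simp
  rw [h2]
  have h3 : 0 < Complex.normSq (-Complex.I * w) := by
    rw [Complex.normSq_pos]
    exact mul_ne_zero (by simp) hw0
  positivity

theorem poissonFactor_ne_zero (b : Module.Basis (Fin n) ℝ (EuclideanSpace ℝ (Fin n))) {w : ℂ}
    (hw : 0 < w.im) : poissonFactor b w ≠ 0 := by
  refine mul_ne_zero (by exact_mod_cast (poissonConst_pos b).ne') ?_
  intro h
  rw [Complex.cpow_eq_zero_iff] at h
  have := re_pi_div_pos hw
  simp [h.1] at this

/-- Squaring turns the exponent n/2 into n, and the base equals i/(2w); no choice of square root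
remains. -/
theorem poissonFactor_sq (b : Module.Basis (Fin n) ℝ (EuclideanSpace ℝ (Fin n))) (w : ℂ) :
    poissonFactor b w ^ 2 = poissonConst b ^ 2 * (Complex.I / 2) ^ n / w ^ n := by
  rw [poissonFactor, mul_pow, ← Complex.cpow_nat_mul]
  have h1 : ((2 : ℕ) : ℂ) * (n / 2) = n := by
    push_cast
    ring
  rw [h1, Complex.cpow_natCast, mul_div_assoc, ← div_pow]
  congr 2
  have : (Real.pi : ℂ) ≠ 0 := by exact_mod_cast Real.pi_ne_zero
  by_cases hw : w = 0
  · simp [hw]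
  field_simp
  simp

theorem differentiableAt_poissonFactor (b : Module.Basis (Fin n) ℝ (EuclideanSpace ℝ (Fin n)))
    {w : ℂ} (hw : 0 < w.im) : DifferentiableAt ℂ (poissonFactor b) w := by
  have hw0 : w ≠ 0 := by
    rintro rfl
    simp at hw
  have : (Real.pi : ℂ) ≠ 0 := by exact_mod_cast Real.pi_ne_zero
  refine DifferentiableAt.const_mul (DifferentiableAt.cpow_const ?_ ?_) _
  · refine DifferentiableAt.div (by fun_prop) (by fun_prop) ?_
    simp [hw0, this]
  · exact Or.inl (re_pi_div_pos hw)

/-! ### Transformation under matrices with prime lower right entry -/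

/-- Completing the square. The vector cη, with η = λ'ₖ, lies in the lattice, so summing over λᵤ − cη
instead of λᵤ does not change the Gauss sum at 0. Since −βc ≡ 1 mod d, the cross term becomes 2⟪η,
λᵤ⟫ and the constant term becomes −c‖η‖², modulo d. -/
theorem latticeGaussSum_eq_mul (hb : IsPolarDual b b') (hI : IsIntegralBasis b) {α β c : ℤ} {d : ℕ}
    [NeZero d] (hdet : α * d - β * c = 1) {k s : Fin n → ℤ}
    (hs : (c : ℝ) • latVec b' k = latVec b s) {m : ℤ} (hm : c * ‖latVec b' k‖ ^ 2 = m) :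
    latticeGaussSum b b' β d k = latticeGaussSum b b' β d 0 *
      Complex.exp (2 * Real.pi * Complex.I * (c * ‖latVec b' k‖ ^ 2 / d : ℝ)) := by
  have hd : (d : ℝ) ≠ 0 := by exact_mod_cast NeZero.ne d
  let Ψ : (Fin n → ℤ) → ℂ := fun v =>
    Complex.exp (2 * Real.pi * Complex.I * (β * ‖latVec b v‖ ^ 2 / d : ℝ))
  have hΨ : ∀ v w, Ψ (v + (d : ℤ) • w) = Ψ v := by
    intro v w
    refine cexp_two_pi_eq_of_sub_int ?_
    obtain ⟨r, hr⟩ := hI.norm_add_smul v w d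
    refine ⟨β * r, ?_⟩
    rw [hr]
    push_cast
    field_simp
  have h0 : latticeGaussSum b b' β d 0 = ∑ u : Fin n → ZMod d, Ψ (residueLift u + -s) := by
    rw [sum_residue_add hΨ, latticeGaussSum]
    refine Finset.sum_congr rfl fun u _ => ?_
    rw [latVec_zero, inner_zero_left, mul_zero, add_zero]
  rw [h0, latticeGaussSum, Finset.sum_mul]
  refine Finset.sum_congr rfl fun u _ => ?_
  simp only [Ψ]
  rw [← Complex.exp_add, ← mul_add, ← Complex.ofReal_add]
  refine cexp_two_pi_eq_of_sub_int ?_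
  have h1 := hb.inner_latVec_latVec k (residueLift u)
  refine ⟨α * (∑ i, k i * residueLift u i) - α * m, ?_⟩
  rw [latVec_add, latVec_neg, ← hs, ← sub_eq_add_neg, norm_sub_sq_real, norm_smul, mul_pow,
    Real.norm_eq_abs, sq_abs, inner_smul_right, real_inner_comm (latVec b' k)]
  push_cast at h1 ⊢
  rw [← h1, ← hm]
  have hdet' : (α * d - β * c : ℝ) = 1 := by exact_mod_cast hdet
  field_simp
  linear_combination (c * ‖latVec b' k‖ ^ 2 - 2 * ⟪latVec b' k, latVec b (residueLift u)⟫) * hdet'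

/-- The multiplier of the theta series of the lattice with basis `b` for a matrix with lower row
`(c, d)` and upper right entry `β`. -/
noncomputable def thetaMultiplier (b b' : Module.Basis (Fin n) ℝ (EuclideanSpace ℝ (Fin n)))
    (β c : ℤ) (d : ℕ) [NeZero d] (z : ℂ) : ℂ :=
  latticeGaussSum b b' β d 0 * poissonFactor b (d * z / (c * z + d)) / poissonFactor b z

theorem denom_ne_zero_of_im_pos {c d : ℤ} (hcd : c ≠ 0 ∨ d ≠ 0) {z : ℂ} (hz : 0 < z.im) :
    (c * z + d : ℂ) ≠ 0 := by
  intro h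
  have h1 := congrArg Complex.im h
  have h2 := congrArg Complex.re h
  simp only [Complex.add_im, Complex.mul_im, Complex.intCast_re, Complex.intCast_im, zero_mul,
    add_zero, Complex.zero_im, Complex.add_re, Complex.mul_re, sub_zero, Complex.zero_re] at h1 h2
  have h3 : (c : ℝ) = 0 := by
    rcases mul_eq_zero.mp h1 with h | h
    · exact h
    · exact absurd h hz.ne'
  rw [h3, zero_mul, zero_add] at h2
  have h4 : c = 0 := by exact_mod_cast h3
  have h5 : d = 0 := by exact_mod_cast h2
  rcases hcd with h | h <;> contradiction

theorem im_mul_div_pos {c : ℤ} {d : ℕ} [NeZero d] {z : ℂ} (hz : 0 < z.im) :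
    0 < ((d : ℂ) * z / (c * z + d)).im := by
  have hd : (0 : ℝ) < d := by exact_mod_cast Nat.pos_of_ne_zero (NeZero.ne d)
  have h0 : (c * z + (d : ℤ) : ℂ) ≠ 0 :=
    denom_ne_zero_of_im_pos (Or.inr (by exact_mod_cast NeZero.ne d)) hz
  rw [Int.cast_natCast] at h0
  have h1 := Complex.normSq_pos.mpr h0
  rw [Complex.div_im]
  simp only [Complex.mul_im, Complex.mul_re, Complex.natCast_re, Complex.natCast_im, zero_mul,
    add_zero, sub_zero, Complex.add_re, Complex.add_im, Complex.intCast_re, Complex.intCast_im]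
  rw [← sub_div]
  refine div_pos ?_ h1
  have : ↑d * z.im * (↑c * z.re + ↑d) - ↑d * z.re * (↑c * z.im) = (d : ℝ) ^ 2 * z.im := by ring
  rw [this]
  positivity

/-- Write γz = β/d + w with w = z/(d(cz+d)) and expand at β/d. The Gauss sums contribute the phase
exp(2πi c‖η‖²/d), and −1/(d²w) = −1/z − c/d, so the two cancel to leave the dual series at −1/z.
Inversion at z turns it back into the original series. -/
theorem thetaSeries_transform (hb : IsPolarDual b b') (hI : IsIntegralBasis b) {α β c : ℤ} {d : ℕ}
    [NeZero d] (hdet : α * d - β * c = 1)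
    (hs : ∀ k, ∃ s, (c : ℝ) • latVec b' k = latVec b s)
    (hm : ∀ k, ∃ m : ℤ, c * ‖latVec b' k‖ ^ 2 = m) {h : EuclideanSpace ℝ (Fin n) → ℂ} {ν : ℕ}
    (hh : IsThetaWeight b b' h ν) {z : ℂ} (hz : 0 < z.im) :
    thetaSeries b (fun v => h (latVec b v)) ((α * z + β) / (c * z + d)) =
      thetaMultiplier b b' β c d z * (c * z + d) ^ ν *
        thetaSeries b (fun v => h (latVec b v)) z := by
  have hd : (d : ℂ) ≠ 0 := by exact_mod_cast NeZero.ne d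
  have h0 : (c * z + (d : ℤ) : ℂ) ≠ 0 :=
    denom_ne_zero_of_im_pos (Or.inr (by exact_mod_cast NeZero.ne d)) hz
  rw [Int.cast_natCast] at h0
  have hz0 : z ≠ 0 := by
    rintro rfl
    simp at hz
  have hdet' : (α * d - β * c : ℂ) = 1 := by exact_mod_cast hdet
  let w : ℂ := z / (d * (c * z + d))
  have hw1 : (d : ℂ) ^ 2 * w = d * z / (c * z + d) := by
    simp only [w]
    field_simp
  have hw : 0 < w.im := by
    have h1 := im_mul_div_pos (c := c) (d := d) hz
    rw [← hw1] at h1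
    have h2 : ((d : ℂ) ^ 2) = (((d : ℝ) ^ 2 : ℝ) : ℂ) := by push_cast; rfl
    rw [h2, Complex.im_ofReal_mul] at h1
    exact pos_of_mul_pos_right h1 (by positivity)
  have hγ : (α * z + β) / (c * z + d) = β / d + w := by
    simp only [w]
    rw [div_add_div _ _ hd (mul_ne_zero hd h0), div_eq_div_iff h0
      (mul_ne_zero hd (mul_ne_zero hd h0))]
    linear_combination d * (c * z + d) * z * hdet'
  have hC := poissonFactor_ne_zero b hz
  rw [hγ, thetaSeries_rational_add hI hh β d hw, hw1, thetaMultiplier]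
  have hinv := hh.inversion z hz 0
  simp only [add_zero, inner_zero_right, mul_zero, Complex.ofReal_zero, Complex.exp_zero,
    one_mul] at hinv
  have h3 : thetaSeries b' (fun k => h (latVec b' k) * latticeGaussSum b b' β d k)
      (-1 / (d * z / (c * z + d))) = latticeGaussSum b b' β d 0 *
      ∑' k, h (latVec b' k) * Complex.exp (2 * Real.pi * Complex.I * (-1 / z) *
        (‖latVec b' k‖ ^ 2 : ℝ)) := by
    rw [thetaSeries, ← tsum_mul_left]
    refine tsum_congr fun k => ?_
    obtain ⟨s, hs⟩ := hs k
    obtain ⟨m, hm⟩ := hm k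
    rw [latticeGaussSum_eq_mul hb hI hdet hs hm]
    have h4 : Complex.exp (2 * Real.pi * Complex.I * (c * ‖latVec b' k‖ ^ 2 / d : ℝ)) *
        Complex.exp (2 * Real.pi * Complex.I * (-1 / (d * z / (c * z + d))) *
          (‖latVec b' k‖ ^ 2 : ℝ)) =
        Complex.exp (2 * Real.pi * Complex.I * (-1 / z) * (‖latVec b' k‖ ^ 2 : ℝ)) := by
      rw [← Complex.exp_add]
      congr 1
      push_cast
      field_simp
      ring
    rw [← h4]
    ring
  rw [h3]
  change _ = _ * thetaSeries b (fun v => h (latVec b v)) z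
  have h5 : thetaSeries b (fun v => h (latVec b v)) z = poissonFactor b z / z ^ ν *
      ∑' k, h (latVec b' k) * Complex.exp (2 * Real.pi * Complex.I * (-1 / z) *
        (‖latVec b' k‖ ^ 2 : ℝ)) := hinv
  rw [h5]
  have h6 : (d : ℂ) * w = z / (c * z + d) := by
    simp only [w]
    field_simp
  rw [h6, div_pow]
  field_simp

/-- The squared Gauss sum is (χ₄(p)p)ⁿ, and the squared quotient of Poisson factors is ((cz+p)/p)ⁿ.
-/
theorem thetaMultiplier_sq (hI : IsIntegralBasis b) {β c : ℤ} {p : ℕ} [Fact p.Prime] (hp : p ≠ 2)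
    (hβ : ¬ (p : ℤ) ∣ β)
    (hnd : ∀ v : Fin n → ℤ, (∀ u, ∃ m : ℤ, 2 * ⟪latVec b v, latVec b u⟫ = p * m) →
      ∀ i, (p : ℤ) ∣ v i) {z : ℂ} (hz : 0 < z.im) :
    thetaMultiplier b b' β c p z ^ 2 = (((ZMod.χ₄ p : ℤ) : ℂ) * (c * z + p)) ^ n := by
  have hd : (p : ℂ) ≠ 0 := by exact_mod_cast NeZero.ne p
  have h0 : (c * z + (p : ℤ) : ℂ) ≠ 0 :=
    denom_ne_zero_of_im_pos (Or.inr (by exact_mod_cast NeZero.ne p)) hz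
  rw [Int.cast_natCast] at h0
  have hz0 : z ≠ 0 := by
    rintro rfl
    simp at hz
  have hκ : (poissonConst b : ℂ) ≠ 0 := by exact_mod_cast (poissonConst_pos b).ne'
  rw [thetaMultiplier, div_pow, mul_pow, latticeGaussSum_zero_sq hI hp hβ hnd, poissonFactor_sq,
    poissonFactor_sq]
  simp only [mul_pow, div_pow]
  have hI0 : Complex.I ^ n ≠ 0 := pow_ne_zero _ Complex.I_ne_zero
  field_simp

theorem differentiableAt_thetaMultiplier {β c : ℤ} {d : ℕ} [NeZero d] {z : ℂ} (hz : 0 < z.im) :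
    DifferentiableAt ℂ (thetaMultiplier b b' β c d) z := by
  have h0 : (c * z + (d : ℤ) : ℂ) ≠ 0 :=
    denom_ne_zero_of_im_pos (Or.inr (by exact_mod_cast NeZero.ne d)) hz
  rw [Int.cast_natCast] at h0
  refine DifferentiableAt.div (DifferentiableAt.const_mul ?_ _)
    (differentiableAt_poissonFactor b hz) (poissonFactor_ne_zero b hz)
  have h1 : DifferentiableAt ℂ (fun z : ℂ => (d : ℂ) * z / (c * z + d)) z :=
    DifferentiableAt.div (by fun_prop) (by fun_prop) h0
  exact DifferentiableAt.comp (g := poissonFactor b) z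
    (differentiableAt_poissonFactor b (im_mul_div_pos hz)) h1

end

/-! ### Wronskians of holomorphic functions -/

/-- The Wronskian `det (fⱼ⁽ᵏ⁾(z))`. -/
noncomputable def wronskian {m : ℕ} (f : Fin m → ℂ → ℂ) (z : ℂ) : ℂ :=
  Matrix.det (Matrix.of fun k j : Fin m => iteratedDeriv k (f j) z)

theorem differentiableOn_iteratedDeriv {U : Set ℂ} (hU : IsOpen U) {f : ℂ → ℂ}
    (hf : DifferentiableOn ℂ f U) (k : ℕ) : DifferentiableOn ℂ (iteratedDeriv k f) U := by
  induction k with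
  | zero => simpa using hf
  | succ k ih =>
    rw [iteratedDeriv_succ]
    exact ih.deriv hU

/-- By induction, differentiating and multiplying by ρ = 1/γ′. The point is that the coefficients do
not depend on `j`, so they form a single triangular matrix with diagonal φρᵏ. -/
theorem exists_iteratedDeriv_comp {U V : Set ℂ} (hU : IsOpen U) (hV : IsOpen V) {ι : Type*}
    {F G : ι → ℂ → ℂ} {γ φ ρ : ℂ → ℂ} (hγ : DifferentiableOn ℂ γ U) (hγV : ∀ z ∈ U, γ z ∈ V)
    (hρ : DifferentiableOn ℂ ρ U) (hργ : ∀ z ∈ U, ρ z * deriv γ z = 1)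
    (hφ : DifferentiableOn ℂ φ U) (hF : ∀ j, DifferentiableOn ℂ (F j) V)
    (hG : ∀ j, DifferentiableOn ℂ (G j) U) (hFG : ∀ j, ∀ z ∈ U, F j (γ z) = φ z * G j z) (k : ℕ) :
    ∃ a : ℕ → ℂ → ℂ, (∀ i, DifferentiableOn ℂ (a i) U) ∧ (∀ i, k < i → a i = 0) ∧
      (∀ z, a k z = φ z * ρ z ^ k) ∧ ∀ j, ∀ z ∈ U,
        iteratedDeriv k (F j) (γ z) = ∑ i ∈ Finset.range (k + 1), a i z * iteratedDeriv i (G j) z := by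
  induction k with
  | zero =>
    refine ⟨fun i => if i = 0 then φ else 0, fun i => ?_, fun i hi => if_neg (by omega),
      by simp, fun j z hz => by simp [hFG j z hz]⟩
    by_cases hi : i = 0
    · simpa [hi] using hφ
    · simp [hi]
  | succ k ih =>
    obtain ⟨a, ha, ha0, hak, haF⟩ := ih
    have ha' : ∀ i, DifferentiableOn ℂ (deriv (a i)) U := fun i => (ha i).deriv hU
    -- The recursion is aᵢ ↦ ρ(aᵢ′ + aᵢ₋₁), without the second summand for i = 0.
    refine ⟨fun i => match i with
      | 0 => fun z => ρ z * deriv (a 0) z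
      | i + 1 => fun z => ρ z * (deriv (a (i + 1)) z + a i z), ?_, ?_, ?_, ?_⟩
    · rintro (_ | i)
      · exact hρ.mul (ha' 0)
      · exact hρ.mul ((ha' _).add (ha _))
    · rintro (_ | i) hi
      · omega
      · funext z
        simp [ha0 (i + 1) (by omega), ha0 i (by omega)]
    · intro z
      simp only [ha0 (k + 1) (by omega), hak]
      simp
      ring
    · intro j z hz
      have hev : (fun z => iteratedDeriv k (F j) (γ z)) =ᶠ[nhds z]
          fun z => ∑ i ∈ Finset.range (k + 1), a i z * iteratedDeriv i (G j) z :=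
        Filter.eventuallyEq_of_mem (hU.mem_nhds hz) (haF j)
      have h1 := hev.deriv_eq
      have hFd := (differentiableOn_iteratedDeriv hV (hF j) k).differentiableAt
        (hV.mem_nhds (hγV z hz))
      have h2 : deriv (fun z => iteratedDeriv k (F j) (γ z)) z =
          iteratedDeriv (k + 1) (F j) (γ z) * deriv γ z := by
        rw [iteratedDeriv_succ]
        exact deriv_comp z hFd (hγ.differentiableAt (hU.mem_nhds hz))
      have hda : ∀ i, DifferentiableAt ℂ (a i) z := fun i =>
        (ha i).differentiableAt (hU.mem_nhds hz)
      have hdG : ∀ i, DifferentiableAt ℂ (iteratedDeriv i (G j)) z := fun i =>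
        (differentiableOn_iteratedDeriv hU (hG j) i).differentiableAt (hU.mem_nhds hz)
      have h3 : deriv (fun z => ∑ i ∈ Finset.range (k + 1), a i z * iteratedDeriv i (G j) z) z =
          ∑ i ∈ Finset.range (k + 1), (deriv (a i) z * iteratedDeriv i (G j) z +
            a i z * iteratedDeriv (i + 1) (G j) z) := by
        rw [deriv_fun_sum fun i _ => (hda i).fun_mul (hdG i)]
        refine Finset.sum_congr rfl fun i _ => ?_
        rw [iteratedDeriv_succ]
        exact deriv_mul (hda i) (hdG i)
      have h4 : iteratedDeriv (k + 1) (F j) (γ z) = ρ z * (iteratedDeriv (k + 1) (F j) (γ z) *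
          deriv γ z) := by
        rw [mul_left_comm, hργ z hz, mul_one]
      have h5 : ∑ i ∈ Finset.range (k + 1), deriv (a i) z * iteratedDeriv i (G j) z =
          ∑ i ∈ Finset.range (k + 1), deriv (a (i + 1)) z * iteratedDeriv (i + 1) (G j) z +
            deriv (a 0) z * iteratedDeriv 0 (G j) z := by
        rw [← Finset.sum_range_succ' (fun i => deriv (a i) z * iteratedDeriv i (G j) z) (k + 1),
          Finset.sum_range_succ _ (k + 1)]
        have : deriv (a (k + 1)) z = 0 := by
          rw [ha0 (k + 1) (by omega)]
          simp
        simp [this]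
      conv_rhs => rw [Finset.sum_range_succ']
      rw [h4, ← h2, h1, h3, Finset.sum_add_distrib, h5]
      simp only [mul_add, add_mul, Finset.sum_add_distrib, Finset.mul_sum, mul_assoc]
      ring

/-- The matrix of derivatives factors as a lower triangular matrix times the matrix for `G`; the
exponent of ρ is 0 + 1 + ⋯ + (m−1). -/
theorem wronskian_comp {U V : Set ℂ} (hU : IsOpen U) (hV : IsOpen V) {m : ℕ}
    {F G : Fin m → ℂ → ℂ} {γ φ ρ : ℂ → ℂ} (hγ : DifferentiableOn ℂ γ U) (hγV : ∀ z ∈ U, γ z ∈ V)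
    (hρ : DifferentiableOn ℂ ρ U) (hργ : ∀ z ∈ U, ρ z * deriv γ z = 1)
    (hφ : DifferentiableOn ℂ φ U) (hF : ∀ j, DifferentiableOn ℂ (F j) V)
    (hG : ∀ j, DifferentiableOn ℂ (G j) U) (hFG : ∀ j, ∀ z ∈ U, F j (γ z) = φ z * G j z) {z : ℂ}
    (hz : z ∈ U) :
    wronskian F (γ z) = φ z ^ m * ρ z ^ (m * (m - 1) / 2) * wronskian G z := by
  choose a ha ha0 hak haF using
    exists_iteratedDeriv_comp hU hV hγ hγV hρ hργ hφ hF hG hFG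
  have h1 : (Matrix.of fun k j : Fin m => iteratedDeriv k (F j) (γ z)) =
      (Matrix.of fun k i : Fin m => a k i z) * Matrix.of fun k j : Fin m =>
        iteratedDeriv k (G j) z := by
    ext k j
    rw [Matrix.mul_apply]
    simp only [Matrix.of_apply]
    rw [haF k j z hz, Fin.sum_univ_eq_sum_range (fun i => a k i z * iteratedDeriv i (G j) z) m]
    refine Finset.sum_subset (Finset.range_subset_range.mpr k.2) fun i _ hi => ?_
    rw [Finset.mem_range, not_lt] at hi
    simp [ha0 k i (by omega)]
  have h2 : (Matrix.of fun k i : Fin m => a k i z).det = φ z ^ m * ρ z ^ (m * (m - 1) / 2) := by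
    rw [Matrix.det_of_isLowerTriangular]
    · simp only [Matrix.of_apply, hak, Finset.prod_mul_distrib, Finset.prod_const, Finset.card_univ,
        Fintype.card_fin, Finset.prod_pow_eq_pow_sum]
      rw [Fin.sum_univ_eq_sum_range (fun i => i) m, Finset.sum_range_id]
    · intro i j hij
      have hij' : (i : ℕ) < j := hij
      simp [ha0 i j hij']
  rw [wronskian, h1, Matrix.det_mul, h2]
  rfl

/-- Where f₀ ≠ 0, divide by it: W(f) = f₀^(m+1) W(1, u₁, …, uₘ), and the last factor equals W(u₁′,
…, uₘ′). By induction the derivatives satisfy a relation, which integrates to one among 1, u₁, …,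
uₘ. The disc shrinks at each division, hence the smaller ball in the conclusion. -/
theorem exists_linear_relation_of_wronskian_eq_zero (m : ℕ) :
    ∀ (f : Fin m → ℂ → ℂ) (x : ℂ) (r : ℝ), 0 < r →
      (∀ j, DifferentiableOn ℂ (f j) (Metric.ball x r)) →
      (∀ z ∈ Metric.ball x r, wronskian f z = 0) →
      ∃ c : Fin m → ℂ, c ≠ 0 ∧ ∃ (x' : ℂ) (r' : ℝ), 0 < r' ∧ Metric.ball x' r' ⊆ Metric.ball x r ∧
        ∀ z ∈ Metric.ball x' r', ∑ j, c j * f j z = 0 := by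
  induction m with
  | zero =>
    intro f x r hr _ hW
    have := hW x (Metric.mem_ball_self hr)
    simp [wronskian] at this
  | succ m ih =>
    intro f x r hr hf hW
    by_cases h0 : ∀ z ∈ Metric.ball x r, f 0 z = 0
    · refine ⟨Pi.single 0 1, by simp, x, r, hr, subset_rfl, fun z hz => ?_⟩
      rw [Fin.sum_univ_succ]
      simp [h0 z hz]
    push Not at h0
    obtain ⟨y, hy, hfy⟩ := h0
    have hopen : IsOpen (Metric.ball x r ∩ f 0 ⁻¹' {0}ᶜ) :=
      (hf 0).continuousOn.isOpen_inter_preimage Metric.isOpen_ball isOpen_compl_singleton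
    obtain ⟨s, hs, hsub⟩ := Metric.isOpen_iff.mp hopen y ⟨hy, hfy⟩
    have hsub1 : Metric.ball y s ⊆ Metric.ball x r := hsub.trans Set.inter_subset_left
    have hne : ∀ z ∈ Metric.ball y s, f 0 z ≠ 0 := fun z hz => (hsub hz).2
    let u : Fin (m + 1) → ℂ → ℂ := fun j z => f j z / f 0 z
    have hu : ∀ j, DifferentiableOn ℂ (u j) (Metric.ball y s) := fun j =>
      ((hf j).mono hsub1).div ((hf 0).mono hsub1) hne
    have hWu : ∀ z ∈ Metric.ball y s, wronskian u z = 0 := by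
      intro z hz
      have h1 := wronskian_comp (γ := id) (φ := f 0) (ρ := fun _ => 1) (F := f) (G := u)
        Metric.isOpen_ball Metric.isOpen_ball differentiableOn_id
        (V := Metric.ball y s) (fun z hz => hz) (differentiableOn_const _) (by simp)
        ((hf 0).mono hsub1) (fun j => (hf j).mono hsub1) hu (fun j z hz => by
          simp only [u, id]
          rw [mul_div_cancel₀ _ (hne z hz)]) hz
      rw [id, hW z (hsub1 hz), one_pow, mul_one] at h1
      exact (mul_eq_zero.mp h1.symm).resolve_left (pow_ne_zero _ (hne z hz))
    have hu0 : ∀ z ∈ Metric.ball y s, ∀ k : ℕ, iteratedDeriv k (u 0) z = if k = 0 then 1 else 0 := by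
      intro z hz k
      have h1 : u 0 =ᶠ[nhds z] fun _ => 1 :=
        Filter.eventuallyEq_of_mem (Metric.isOpen_ball.mem_nhds hz) fun w hw =>
          div_self (hne w hw)
      rw [h1.iteratedDeriv_eq, iteratedDeriv_const]
    -- The column of the constant function 1 is (1, 0, …, 0), so expansion along it leaves the
    -- Wronskian of the derivatives.
    have hW' : ∀ z ∈ Metric.ball y s, wronskian (fun j : Fin m => deriv (u j.succ)) z = 0 := by
      intro z hz
      have h1 := hWu z hz
      rw [wronskian, Matrix.det_succ_column_zero, Fin.sum_univ_succ] at h1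
      simp only [Matrix.of_apply, hu0 z hz] at h1
      simp only [Fin.val_succ, Nat.succ_ne_zero, if_false, mul_zero, zero_mul, Finset.sum_const_zero,
        add_zero, Fin.val_zero, if_true, pow_zero, one_mul] at h1
      rw [← h1, wronskian]
      congr 1
      ext k j
      simp [iteratedDeriv_succ']
    obtain ⟨c, hc, x', r', hr', hsub2, hrel⟩ := ih (fun j => deriv (u j.succ)) y s hs
      (fun j => (hu _).deriv Metric.isOpen_ball) hW'
    have hconst : ∃ C, ∀ z ∈ Metric.ball x' r', ∑ j, c j * u j.succ z = C := by
      refine ⟨∑ j, c j * u j.succ x', fun z hz => ?_⟩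
      have hd : ∀ j, ∀ w ∈ Metric.ball x' r', DifferentiableAt ℂ (u j) w := fun j w hw =>
        (hu j).differentiableAt (Metric.isOpen_ball.mem_nhds (hsub2 hw))
      refine (convex_ball x' r').is_const_of_fderivWithin_eq_zero (𝕜 := ℂ)
        (f := fun z => ∑ j, c j * u j.succ z) ?_ ?_ hz (Metric.mem_ball_self hr')
      · intro w hw
        exact (DifferentiableAt.fun_sum fun j _ =>
          (hd _ w hw).const_mul (c j)).differentiableWithinAt
      · intro w hw
        rw [fderivWithin_of_isOpen Metric.isOpen_ball hw]
        ext
        rw [fderiv_apply_one_eq_deriv, deriv_fun_sum fun j _ => (hd _ w hw).const_mul (c j)]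
        simp only [deriv_const_mul_field]
        simpa using hrel w hw
    obtain ⟨C, hC⟩ := hconst
    -- The constant of integration, with its sign changed, is the coefficient of f₀.
    refine ⟨Fin.cons (-C) c, ?_, x', r', hr', hsub2.trans hsub1, fun z hz => ?_⟩
    · intro h
      refine hc (funext fun j => ?_)
      have := congrFun h j.succ
      simpa using this
    · have h1 := hC z hz
      have h2 := hne z (hsub2 hz)
      rw [Fin.sum_univ_succ]
      simp only [Fin.cons_zero, Fin.cons_succ]
      rw [← h1, neg_mul, Finset.sum_mul, neg_add_eq_zero]
      refine Finset.sum_congr rfl fun j _ => ?_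
      simp only [u]
      field_simp

/-! ### Analytic properties of theta series -/

section

variable {n : ℕ} {b : Module.Basis (Fin n) ℝ (EuclideanSpace ℝ (Fin n))} {c : (Fin n → ℤ) → ℂ}

/-- Coefficients which grow at most exponentially in the length of the lattice vector. -/
def IsTempered (b : Module.Basis (Fin n) ℝ (EuclideanSpace ℝ (Fin n))) (c : (Fin n → ℤ) → ℂ) :
    Prop :=
  ∃ C K : ℝ, ∀ v, ‖c v‖ ≤ C * Real.exp (K * ‖latVec b v‖)

theorem IsTempered.mul {c' : (Fin n → ℤ) → ℂ} (hc : IsTempered b c) (hc' : IsTempered b c') :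
    IsTempered b fun v => c v * c' v := by
  obtain ⟨C, K, h⟩ := hc
  obtain ⟨C', K', h'⟩ := hc'
  refine ⟨C * C', K + K', fun v => ?_⟩
  rw [norm_mul, add_mul, Real.exp_add]
  calc _ ≤ (C * Real.exp (K * ‖latVec b v‖)) * (C' * Real.exp (K' * ‖latVec b v‖)) :=
        mul_le_mul (h v) (h' v) (norm_nonneg _) ((norm_nonneg _).trans (h v))
    _ = _ := by ring

theorem isTempered_of_bounded {M : ℝ} (h : ∀ v, ‖c v‖ ≤ M) : IsTempered b c :=
  ⟨M, 0, fun v => by simpa using h v⟩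

theorem isTempered_frequency :
    IsTempered b fun v => 2 * Real.pi * Complex.I * ((‖latVec b v‖ ^ 2 : ℝ) : ℂ) := by
  refine ⟨2 * Real.pi, 2, fun v => ?_⟩
  have h1 : ‖latVec b v‖ ≤ Real.exp ‖latVec b v‖ := by
    linarith [Real.add_one_le_exp ‖latVec b v‖]
  have h2 : ‖latVec b v‖ ^ 2 ≤ Real.exp (2 * ‖latVec b v‖) := by
    rw [two_mul, Real.exp_add, sq]
    exact mul_le_mul h1 h1 (norm_nonneg _) (Real.exp_pos _).le
  rw [norm_mul, norm_mul, norm_mul, Complex.norm_I, Complex.norm_real, Complex.norm_real,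
    Complex.norm_ofNat, Real.norm_eq_abs, Real.norm_eq_abs, abs_of_pos Real.pi_pos,
    abs_of_nonneg (sq_nonneg _), mul_one]
  exact mul_le_mul_of_nonneg_left h2 (by positivity)

theorem IsTempered.mul_frequency_pow (hc : IsTempered b c) (k : ℕ) :
    IsTempered b fun v => c v * (2 * Real.pi * Complex.I * ((‖latVec b v‖ ^ 2 : ℝ) : ℂ)) ^ k := by
  induction k with
  | zero => simpa using hc
  | succ k ih =>
    have := ih.mul isTempered_frequency
    simp only [mul_assoc (c _), ← pow_succ] at this
    exact this

theorem IsTempered.hasDerivAt_thetaSeries (hc : IsTempered b c) {z : ℂ} (hz : 0 < z.im) :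
    HasDerivAt (thetaSeries b c) (thetaSeries b (fun v => c v *
      (2 * Real.pi * Complex.I * ((‖latVec b v‖ ^ 2 : ℝ) : ℂ))) z) z := by
  obtain ⟨C, K, h⟩ := hc
  let β : (Fin n → ℤ) → ℂ := fun v => 2 * Real.pi * Complex.I * ((‖latVec b v‖ ^ 2 : ℝ) : ℂ)
  let a : (Fin n → ℤ) → ℂ := fun v => c v *
    Complex.exp (2 * Real.pi * Complex.I * z * (‖latVec b v‖ ^ 2 : ℝ))
  have hβ : ∀ v, ‖β v‖ = 2 * Real.pi * ‖latVec b v‖ ^ 2 := fun v => by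
    simp only [β]
    rw [norm_mul, norm_mul, norm_mul, Complex.norm_I, Complex.norm_real, Complex.norm_real,
      Complex.norm_ofNat, Real.norm_eq_abs, Real.norm_eq_abs, abs_of_pos Real.pi_pos,
      abs_of_nonneg (sq_nonneg _), mul_one]
  -- With radius half the height of z, the majorant is the norm of the same series at half that
  -- height, still in the upper half-plane.
  have hs : Summable fun v => ‖a v‖ * Real.exp (z.im / 2 * ‖β v‖) := by
    have h1 : 0 < (z - (z.im / 2 : ℝ) * Complex.I).im := by
      simp
      linarith
    refine (summable_thetaSeries b h h1).norm.congr fun v => ?_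
    simp only [a]
    rw [norm_mul, norm_mul, norm_cexp_gaussian, norm_cexp_gaussian, hβ, mul_assoc ‖c v‖,
      ← Real.exp_add]
    congr 2
    simp
    ring
  have h2 := hasDerivAt_tsum_cexp hs (t := z - z) (by simpa using hz)
  have h3 := HasDerivAt.comp (h := fun w : ℂ => w - z) z h2 ((hasDerivAt_id z).sub_const z)
  have key : ∀ (e : (Fin n → ℤ) → ℂ) (w : ℂ), ∑' v, e v *
      Complex.exp (2 * Real.pi * Complex.I * z * (‖latVec b v‖ ^ 2 : ℝ)) *
      Complex.exp ((w - z) * β v) = thetaSeries b e w := fun e w => tsum_congr fun v => by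
    rw [mul_assoc, ← Complex.exp_add]
    congr 2
    simp only [β]
    ring
  rw [mul_one] at h3
  have h4 : (fun t => ∑' v, a v * Complex.exp (t * β v)) ∘ (fun w => w - z) = thetaSeries b c := by
    funext w
    exact key c w
  have h5 : ∑' v, a v * β v * Complex.exp ((z - z) * β v) = thetaSeries b (fun v => c v *
      (2 * Real.pi * Complex.I * ((‖latVec b v‖ ^ 2 : ℝ) : ℂ))) z := by
    rw [← key]
    refine tsum_congr fun v => ?_
    simp only [a, β]
    ring
  rw [← h5, ← h4]
  exact h3

theorem isOpen_im_pos : IsOpen {z : ℂ | 0 < z.im} := isOpen_lt continuous_const Complex.continuous_im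

theorem IsTempered.differentiableOn_thetaSeries (hc : IsTempered b c) :
    DifferentiableOn ℂ (thetaSeries b c) {z | 0 < z.im} := fun _ hz =>
  (hc.hasDerivAt_thetaSeries hz).differentiableAt.differentiableWithinAt

theorem IsTempered.iteratedDeriv_thetaSeries (hc : IsTempered b c) (k : ℕ) {z : ℂ}
    (hz : 0 < z.im) :
    iteratedDeriv k (thetaSeries b c) z = thetaSeries b (fun v => c v *
      (2 * Real.pi * Complex.I * ((‖latVec b v‖ ^ 2 : ℝ) : ℂ)) ^ k) z := by
  induction k generalizing z with
  | zero => simp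
  | succ k ih =>
    rw [iteratedDeriv_succ]
    have h1 : iteratedDeriv k (thetaSeries b c) =ᶠ[nhds z] thetaSeries b (fun v => c v *
        (2 * Real.pi * Complex.I * ((‖latVec b v‖ ^ 2 : ℝ) : ℂ)) ^ k) :=
      Filter.eventuallyEq_of_mem (isOpen_im_pos.mem_nhds hz) fun w hw => ih hw
    rw [h1.deriv_eq, ((hc.mul_frequency_pow k).hasDerivAt_thetaSeries hz).deriv]
    simp only [pow_succ, mul_assoc]

/-- Each term decreases in absolute value as the height grows, so the values at i dominate. -/
theorem IsTempered.exists_bound_thetaSeries (hc : IsTempered b c) :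
    ∃ M : ℝ, ∀ z : ℂ, 1 ≤ z.im → ‖thetaSeries b c z‖ ≤ M := by
  obtain ⟨C, K, h⟩ := hc
  have hs := (summable_thetaSeries b h (z := Complex.I) (by simp)).norm
  refine ⟨_, fun z hz => tsum_of_norm_bounded hs.hasSum fun v => ?_⟩
  rw [norm_mul, norm_mul, norm_cexp_gaussian, norm_cexp_gaussian]
  refine mul_le_mul_of_nonneg_left (Real.exp_le_exp.mpr ?_) (norm_nonneg _)
  have : 0 ≤ 2 * Real.pi * ‖latVec b v‖ ^ 2 := by positivity
  rw [Complex.I_im]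
  nlinarith

theorem exists_bound_wronskian_thetaSeries {m : ℕ} {c : Fin m → (Fin n → ℤ) → ℂ}
    (hc : ∀ j, IsTempered b (c j)) :
    ∃ M : ℝ, ∀ z : ℂ, 1 ≤ z.im → ‖wronskian (fun j => thetaSeries b (c j)) z‖ ≤ M := by
  choose M hM using fun (k j : Fin m) => ((hc j).mul_frequency_pow k).exists_bound_thetaSeries
  refine ⟨∑ σ : Equiv.Perm (Fin m), ∏ i, M (σ i) i, fun z hz => ?_⟩
  rw [wronskian, Matrix.det_apply]
  refine (norm_sum_le _ _).trans (Finset.sum_le_sum fun σ _ => ?_)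
  rw [Units.smul_def, zsmul_eq_mul, norm_mul]
  have h1 : ‖(((Equiv.Perm.sign σ : ℤˣ) : ℤ) : ℂ)‖ = 1 := by
    rcases Int.units_eq_one_or (Equiv.Perm.sign σ) with h | h <;> simp [h]
  rw [h1, one_mul, norm_prod]
  refine Finset.prod_le_prod (fun _ _ => norm_nonneg _) fun i _ => ?_
  rw [Matrix.of_apply, (hc i).iteratedDeriv_thetaSeries _ (by linarith)]
  exact hM _ _ z hz

end

/-! ### Wronskians of theta series under modular substitutions -/

section

variable {n : ℕ} {b b' : Module.Basis (Fin n) ℝ (EuclideanSpace ℝ (Fin n))}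

theorem IsThetaWeight.isTempered {h : EuclideanSpace ℝ (Fin n) → ℂ} {ν : ℕ}
    (hh : IsThetaWeight b b' h ν) (B : Module.Basis (Fin n) ℝ (EuclideanSpace ℝ (Fin n))) :
    IsTempered B fun v => h (latVec B v) := by
  obtain ⟨C, K, hCK⟩ := hh.growth
  exact ⟨C, K, fun v => hCK _⟩

theorem thetaSeries_add_one (hI : IsIntegralBasis b) (c : (Fin n → ℤ) → ℂ) (z : ℂ) :
    thetaSeries b c (z + 1) = thetaSeries b c z := by
  refine tsum_congr fun v => ?_
  obtain ⟨m, hm⟩ := hI v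
  rw [hm, mul_add, add_mul, Complex.exp_add, mul_one, cexp_two_pi_int, mul_one]

theorem iteratedDeriv_comp_add {f : ℂ → ℂ} (k : ℕ) (t z : ℂ) :
    iteratedDeriv k (fun z => f (z + t)) z = iteratedDeriv k f (z + t) :=
  congrFun (iteratedDeriv_comp_add_const k f t) z

theorem wronskian_comp_add {m : ℕ} (f : Fin m → ℂ → ℂ) (t z : ℂ) :
    wronskian (fun j z => f j (z + t)) z = wronskian f (z + t) := by
  simp only [wronskian, iteratedDeriv_comp_add]

theorem wronskian_thetaSeries_add_one (hI : IsIntegralBasis b) {m : ℕ}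
    (c : Fin m → (Fin n → ℤ) → ℂ) (z : ℂ) :
    wronskian (fun j => thetaSeries b (c j)) (z + 1) =
      wronskian (fun j => thetaSeries b (c j)) z := by
  rw [← wronskian_comp_add]
  simp only [thetaSeries_add_one hI]

theorem im_moebius_pos {α β c d : ℤ} (hdet : α * d - β * c = 1) {z : ℂ} (hz : 0 < z.im) :
    0 < ((α * z + β) / (c * z + d) : ℂ).im := by
  have h0 : (c * z + d : ℂ) ≠ 0 := by
    refine denom_ne_zero_of_im_pos ?_ hz
    by_contra! h
    simp [h.1, h.2] at hdet
  have h1 := Complex.normSq_pos.mpr h0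
  have hdet' : (α * d - β * c : ℝ) = 1 := by exact_mod_cast hdet
  rw [Complex.div_im, ← sub_div]
  refine div_pos ?_ h1
  simp only [Complex.mul_im, Complex.mul_re, Complex.intCast_re, Complex.intCast_im, zero_mul,
    add_zero, sub_zero, Complex.add_re, Complex.add_im]
  have : ↑α * z.im * (↑c * z.re + ↑d) - (↑α * z.re + ↑β) * (↑c * z.im) = z.im := by
    linear_combination z.im * hdet'
  rwa [this]

theorem deriv_moebius {α β c d : ℤ} (hdet : α * d - β * c = 1) {z : ℂ} (hz : 0 < z.im) :
    HasDerivAt (fun z : ℂ => (α * z + β) / (c * z + d)) (1 / (c * z + d) ^ 2) z := by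
  have h0 : (c * z + d : ℂ) ≠ 0 := by
    refine denom_ne_zero_of_im_pos ?_ hz
    by_contra! h
    simp [h.1, h.2] at hdet
  have hdet' : (α * d - β * c : ℂ) = 1 := by exact_mod_cast hdet
  have h1 : HasDerivAt (fun z : ℂ => α * z + β) α z := by
    simpa using ((hasDerivAt_id z).const_mul (α : ℂ)).add_const (β : ℂ)
  have h2 : HasDerivAt (fun z : ℂ => c * z + d) c z := by
    simpa using ((hasDerivAt_id z).const_mul (c : ℂ)).add_const (d : ℂ)
  refine (h1.div h2 h0).congr_deriv ?_
  congr 1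
  linear_combination hdet'

/-- Here 1/γ′ = (cz+d)². After squaring, only φ² enters, so the multiplier is needed only up to
sign. -/
theorem wronskian_moebius {α β c d : ℤ} (hdet : α * d - β * c = 1) {m : ℕ} {F G : Fin m → ℂ → ℂ}
    {φ : ℂ → ℂ} (hφ : DifferentiableOn ℂ φ {z | 0 < z.im})
    (hF : ∀ j, DifferentiableOn ℂ (F j) {z | 0 < z.im})
    (hG : ∀ j, DifferentiableOn ℂ (G j) {z | 0 < z.im})
    (hFG : ∀ j z, 0 < z.im → F j ((α * z + β) / (c * z + d)) = φ z * G j z) {z : ℂ}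
    (hz : 0 < z.im) :
    wronskian F ((α * z + β) / (c * z + d)) ^ 2 =
      (φ z ^ 2) ^ m * (c * z + d) ^ (2 * (m * (m - 1))) * wronskian G z ^ 2 := by
  have h0 : ∀ z : ℂ, 0 < z.im → (c * z + d : ℂ) ≠ 0 := by
    intro z hz
    refine denom_ne_zero_of_im_pos ?_ hz
    by_contra! h
    simp [h.1, h.2] at hdet
  have h1 := wronskian_comp (γ := fun z : ℂ => (α * z + β) / (c * z + d))
    (ρ := fun z => (c * z + d) ^ 2) isOpen_im_pos isOpen_im_pos
    (fun z hz => (deriv_moebius hdet hz).differentiableAt.differentiableWithinAt)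
    (fun z hz => im_moebius_pos hdet hz) (by fun_prop)
    (fun z hz => by
      rw [(deriv_moebius hdet hz).deriv, mul_one_div_cancel (pow_ne_zero _ (h0 z hz))])
    hφ hF hG (fun j z hz => hFG j z hz) hz
  have h2 : 2 * (m * (m - 1) / 2) = m * (m - 1) :=
    Nat.mul_div_cancel' (Nat.even_mul_pred_self m).two_dvd
  rw [h1, mul_pow, mul_pow, ← pow_mul, ← pow_mul, ← pow_mul, ← pow_mul]
  congr 3
  · rw [mul_comm]
  · omega

theorem wronskian_thetaSeries_transform (hb : IsPolarDual b b') (hI : IsIntegralBasis b)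
    {α β c : ℤ} {p : ℕ} [Fact p.Prime] (hp : p ≠ 2) (hdet : α * p - β * c = 1)
    (hs : ∀ k, ∃ s, (c : ℝ) • latVec b' k = latVec b s)
    (hm : ∀ k, ∃ m : ℤ, c * ‖latVec b' k‖ ^ 2 = m)
    (hnd : ∀ v : Fin n → ℤ, (∀ u, ∃ m : ℤ, 2 * ⟪latVec b v, latVec b u⟫ = p * m) →
      ∀ i, (p : ℤ) ∣ v i) {m ν : ℕ} {h : Fin m → EuclideanSpace ℝ (Fin n) → ℂ}
    (hh : ∀ j, IsThetaWeight b b' (h j) ν) {z : ℂ} (hz : 0 < z.im) :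
    wronskian (fun j => thetaSeries b (fun v => h j (latVec b v))) ((α * z + β) / (c * z + p)) ^ 2 =
      ((ZMod.χ₄ p : ℤ) : ℂ) ^ (n * m) * (c * z + p) ^ (m * (n + 2 * ν) + 2 * (m * (m - 1))) *
      wronskian (fun j => thetaSeries b (fun v => h j (latVec b v))) z ^ 2 := by
  have hβ : ¬ (p : ℤ) ∣ β := by
    intro h
    have h1 : (p : ℤ) ∣ 1 := hdet ▸ (dvd_mul_left _ _).sub (h.mul_right _)
    exact (Fact.out : p.Prime).one_lt.ne' (by exact_mod_cast Int.eq_one_of_dvd_one (by positivity) h1)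
  have h1 := wronskian_moebius (F := fun j => thetaSeries b (fun v => h j (latVec b v)))
    (G := fun j => thetaSeries b (fun v => h j (latVec b v)))
    (φ := fun z => thetaMultiplier b b' β c p z * (c * z + p) ^ ν) (d := p)
    hdet (fun z hz => ((differentiableAt_thetaMultiplier hz).fun_mul
      (by fun_prop)).differentiableWithinAt)
    (fun j => ((hh j).isTempered b).differentiableOn_thetaSeries)
    (fun j => ((hh j).isTempered b).differentiableOn_thetaSeries)
    (fun j z hz => by
      rw [Int.cast_natCast]
      exact thetaSeries_transform hb hI hdet hs hm (hh j) hz) hz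
  rw [Int.cast_natCast] at h1
  rw [h1, mul_pow, thetaMultiplier_sq hI hp hβ hnd hz, mul_pow _ (c * z + p : ℂ)]
  congr 1
  generalize (c * z + p : ℂ) = X
  ring

/-- Write γz = α/c − 1/(c(cz+d)) and expand at α/c. All theta series become one common factor times
series over the dual lattice at z + d/c, whose coefficients are tempered since Gauss sums are
bounded. The Wronskian of these is bounded high up, and the common factor has the growth of the
stated power of cz+d. No level is involved. -/
theorem exists_bound_wronskian_moebius (hI : IsIntegralBasis b)
    {α β c d : ℤ} (hc : c ≠ 0) (hdet : α * d - β * c = 1) {m : ℕ}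
    {h : Fin m → EuclideanSpace ℝ (Fin n) → ℂ} (hh : ∀ j, IsThetaWeight b b' (h j) 2) :
    ∃ M : ℝ, ∀ z : ℂ, 1 ≤ z.im →
      ‖wronskian (fun j => thetaSeries b (fun v => h j (latVec b v)))
        ((α * z + β) / (c * z + d)) ^ 2‖ ≤
        M * ‖(c * z + d : ℂ) ^ (m * (n + 4) + 2 * (m * (m - 1)))‖ := by
  have hcC : (c : ℂ) ≠ 0 := by exact_mod_cast hc
  let q := c.natAbs
  have : NeZero q := ⟨Int.natAbs_ne_zero.mpr hc⟩
  -- The modulus of a Gauss sum is a positive natural number, so the sign of c is moved to the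
  -- numerator: α/c = αε/q.
  obtain ⟨ε, hε, hq⟩ : ∃ ε : ℤ, ε * ε = 1 ∧ c = ε * q := by
    refine ⟨c.sign, ?_, (Int.sign_mul_natAbs c).symm⟩
    rcases lt_or_gt_of_ne hc with h | h
    · rw [Int.sign_eq_neg_one_of_neg h]
      norm_num
    · rw [Int.sign_eq_one_of_pos h]
      norm_num
  have hqC : (q : ℂ) ≠ 0 := by exact_mod_cast NeZero.ne q
  have hqC' : (c : ℂ) = ε * q := by exact_mod_cast hq
  have hεC : (ε : ℂ) * ε = 1 := by exact_mod_cast hε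
  have hq2 : (q : ℂ) ^ 2 = c ^ 2 := by
    rw [hqC']
    linear_combination (-(q : ℂ) ^ 2) * hεC
  have h0 : ∀ z : ℂ, 0 < z.im → (c * z + d : ℂ) ≠ 0 := fun z hz =>
    denom_ne_zero_of_im_pos (Or.inl hc) hz
  have hdet' : (α * d - β * c : ℂ) = 1 := by exact_mod_cast hdet
  let e : Fin m → (Fin n → ℤ) → ℂ := fun j k =>
    h j (latVec b' k) * latticeGaussSum b b' (α * ε) q k
  have he : ∀ j, IsTempered b' (e j) := fun j =>
    ((hh j).isTempered b').mul (isTempered_of_bounded (norm_latticeGaussSum_le b b' _ _))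
  let t : ℂ := d / c
  have htim : t.im = 0 := by
    have : t = ((d / c : ℝ) : ℂ) := by
      simp [t]
    rw [this, Complex.ofReal_im]
  have ht : ∀ z : ℂ, 0 < z.im → 0 < (z + t).im := fun z hz => by
    rw [Complex.add_im, htim, add_zero]
    exact hz
  have ht0 : ∀ z : ℂ, (c * z + d : ℂ) = c * (z + t) := fun z => by
    simp only [t]
    field_simp
  have ht1 : ∀ z : ℂ, 0 < z.im → z + t ≠ 0 := fun z hz h => by
    have := ht z hz
    rw [h] at this
    simp at this
  have hw : ∀ z : ℂ, 0 < z.im → 0 < (-1 / (z + t)).im := fun z hz =>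
    im_neg_one_div_pos (ht z hz)
  have key : ∀ j z, 0 < z.im → thetaSeries b (fun v => h j (latVec b v))
      ((α * z + β) / (c * z + d)) = (poissonFactor b (-1 / (z + t)) * (c * z + d) ^ 2) *
        thetaSeries b' (e j) (z + t) := by
    intro j z hz
    let w : ℂ := -1 / (c * (c * z + d))
    have hw1 : (q : ℂ) ^ 2 * w = -1 / (z + t) := by
      simp only [w]
      have := ht1 z hz
      rw [hq2, ht0]
      field_simp
    have hw2 : 0 < w.im := by
      have h1 := hw z hz
      rw [← hw1] at h1
      have h2 : ((q : ℂ) ^ 2) = (((q : ℝ) ^ 2 : ℝ) : ℂ) := by push_cast; rfl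
      rw [h2, Complex.im_ofReal_mul] at h1
      exact pos_of_mul_pos_right h1 (by positivity)
    have hγ : (α * z + β) / (c * z + d) = (α * ε : ℤ) / q + w := by
      have h1 : ((α * ε : ℤ) : ℂ) / q = α / c := by
        rw [div_eq_div_iff hqC hcC]
        push_cast
        rw [hqC']
        linear_combination α * q * hεC
      rw [h1]
      have := h0 z hz
      simp only [w]
      rw [div_add_div _ _ hcC (mul_ne_zero hcC this), div_eq_div_iff this
        (mul_ne_zero hcC (mul_ne_zero hcC this))]
      linear_combination (- c * (c * z + d)) * hdet'
    have h3 : -1 / (-1 / (z + t)) = z + t := by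
      have := ht1 z hz
      field_simp
    have h4 : ((q : ℂ) * w) ^ 2 = 1 / (c * z + d) ^ 2 := by
      have := h0 z hz
      simp only [w]
      rw [mul_pow, hq2]
      field_simp
    rw [hγ, thetaSeries_rational_add hI (hh j) _ q hw2, hw1, h3, h4]
    simp only [e]
    field_simp
  obtain ⟨M, hM⟩ := exists_bound_wronskian_thetaSeries he
  refine ⟨‖((poissonConst b : ℂ) ^ 2 * (Complex.I / 2) ^ n * (-1 / c) ^ n) ^ m‖ * M ^ 2,
    fun z hz1 => ?_⟩
  have hz : 0 < z.im := by linarith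
  have h1 := wronskian_moebius (F := fun j => thetaSeries b (fun v => h j (latVec b v)))
    (G := fun j z => thetaSeries b' (e j) (z + t))
    (φ := fun z => poissonFactor b (-1 / (z + t)) * (c * z + d) ^ 2)
    hdet (fun z hz => (DifferentiableAt.fun_mul
      (DifferentiableAt.comp (g := poissonFactor b) z (differentiableAt_poissonFactor b (hw z hz))
        (by
          have := ht1 z hz
          fun_prop (disch := assumption)))
      (by fun_prop)).differentiableWithinAt)
    (fun j => ((hh j).isTempered b).differentiableOn_thetaSeries)
    (fun j => (he j).differentiableOn_thetaSeries.comp (by fun_prop) fun z hz => ht z hz)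
    key hz
  have h2 : poissonFactor b (-1 / (z + t)) ^ 2 =
      (poissonConst b : ℂ) ^ 2 * (Complex.I / 2) ^ n * (-1 / c) ^ n * (c * z + d) ^ n := by
    have := ht1 z hz
    have h5 : (-1 / c * (c * (z + t)) : ℂ) = (-1 / (z + t))⁻¹ := by field_simp
    rw [poissonFactor_sq, ht0, mul_assoc _ ((-1 / c : ℂ) ^ n), ← mul_pow (-1 / c : ℂ), h5,
      inv_pow, ← div_eq_mul_inv]
  rw [h1, mul_pow, h2, wronskian_comp_add (fun j => thetaSeries b' (e j))]
  have h3 : ∀ A X Y : ℂ, (A * X ^ n * (X ^ 2) ^ 2) ^ m * X ^ (2 * (m * (m - 1))) * Y ^ 2 =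
      A ^ m * Y ^ 2 * X ^ (m * (n + 4) + 2 * (m * (m - 1))) := fun A X Y => by ring
  rw [h3, norm_mul, norm_mul]
  gcongr
  rw [norm_pow]
  gcongr
  refine hM _ ?_
  rw [Complex.add_im, htim, add_zero]
  exact hz1

end

/-! ### Quadratic polynomials and symmetric matrices -/

section

variable {n : ℕ}

/-- The quadratic polynomial `∑ Hᵢⱼ XᵢXⱼ`. -/
noncomputable def quadPoly (H : Matrix (Fin n) (Fin n) ℝ) : MvPolynomial (Fin n) ℝ :=
  ∑ i, ∑ j, MvPolynomial.monomial (Finsupp.single i 1 + Finsupp.single j 1) (H i j)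

theorem eval_quadPoly (H : Matrix (Fin n) (Fin n) ℝ) (x : EuclideanSpace ℝ (Fin n)) :
    MvPolynomial.eval (fun i => x i) (quadPoly H) = quadEval H x := by
  classical
  simp only [quadPoly, quadEval, map_sum, MvPolynomial.eval_monomial]
  refine Finset.sum_congr rfl fun i _ => Finset.sum_congr rfl fun j _ => ?_
  rw [Finsupp.prod_add_index' (by simp) (by simp [pow_add]), Finsupp.prod_single_index (by simp),
    Finsupp.prod_single_index (by simp), pow_one, pow_one]

theorem quadPoly_add (H K : Matrix (Fin n) (Fin n) ℝ) :
    quadPoly (H + K) = quadPoly H + quadPoly K := by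
  simp [quadPoly, Finset.sum_add_distrib]

theorem quadPoly_smul (r : ℝ) (H : Matrix (Fin n) (Fin n) ℝ) :
    quadPoly (r • H) = r • quadPoly H := by
  simp [quadPoly, Finset.smul_sum, MvPolynomial.smul_monomial]

theorem quadPoly_sum {ι : Type*} (s : Finset ι) (H : ι → Matrix (Fin n) (Fin n) ℝ) :
    quadPoly (∑ i ∈ s, H i) = ∑ i ∈ s, quadPoly (H i) := by
  classical
  induction s using Finset.induction_on with
  | empty => simp [quadPoly]
  | insert a s ha ih => rw [Finset.sum_insert ha, Finset.sum_insert ha, quadPoly_add, ih]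

theorem quadPoly_mem_homogeneousSubmodule (H : Matrix (Fin n) (Fin n) ℝ) :
    quadPoly H ∈ MvPolynomial.homogeneousSubmodule (Fin n) ℝ 2 := by
  refine Submodule.sum_mem _ fun i _ => Submodule.sum_mem _ fun j _ => ?_
  rw [MvPolynomial.mem_homogeneousSubmodule]
  refine MvPolynomial.isHomogeneous_monomial _ ?_
  rw [map_add, Finsupp.degree_single, Finsupp.degree_single]

/-- Off the diagonal two matrix entries meet in one monomial; on the diagonal one entry occurs, but
the factorial is 2. Hence a formula without case distinction. -/
theorem factorial_mul_coeff_quadPoly (K : Matrix (Fin n) (Fin n) ℝ) (i j : Fin n) :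
    (∏ l, (((Finsupp.single i 1 + Finsupp.single j 1 : Fin n →₀ ℕ) l).factorial : ℝ)) *
      (quadPoly K).coeff (Finsupp.single i 1 + Finsupp.single j 1) = K i j + K j i := by
  classical
  have hiff : ∀ k l : Fin n, (Finsupp.single k 1 + Finsupp.single l 1 : Fin n →₀ ℕ) =
      Finsupp.single i 1 + Finsupp.single j 1 ↔ k = i ∧ l = j ∨ k = j ∧ l = i := by
    intro k l
    rw [Finsupp.single_add_single_eq_single_add_single one_ne_zero one_ne_zero]
    simp
  simp only [quadPoly, MvPolynomial.coeff_sum, MvPolynomial.coeff_monomial, hiff]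
  by_cases hij : i = j
  · subst hij
    have h1 : (∏ l, (((Finsupp.single i 1 + Finsupp.single i 1 : Fin n →₀ ℕ) l).factorial : ℝ)) =
        2 := by
      rw [Finset.prod_eq_single i]
      · simp
      · intro l _ hl
        simp [hl.symm]
      · simp
    rw [h1]
    simp only [or_self, ite_and, Finset.sum_ite_eq', Finset.mem_univ, if_true,
      Finset.sum_ite_irrel, Finset.sum_const_zero]
    ring
  · have h1 : (∏ l, (((Finsupp.single i 1 + Finsupp.single j 1 : Fin n →₀ ℕ) l).factorial : ℝ)) =
        1 := by
      refine Finset.prod_eq_one fun l _ => ?_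
      by_cases hi : i = l
      · subst hi
        simp [Ne.symm hij]
      · by_cases hj : j = l <;> simp [hi, hj]
    have h2 : ∀ k l : Fin n, (if k = i ∧ l = j ∨ k = j ∧ l = i then K k l else 0) =
        (if k = i then (if l = j then K k l else 0) else 0) +
        (if k = j then (if l = i then K k l else 0) else 0) := by
      intro k l
      by_cases h3 : k = i
      · have : k ≠ j := fun h => hij (h3.symm.trans h)
        simp [h3, hij]
      · simp [h3, ite_and]
    rw [h1, one_mul, Finset.sum_congr rfl fun k _ => Finset.sum_congr rfl fun l _ => h2 k l]
    simp only [Finset.sum_add_distrib, Finset.sum_ite_eq', Finset.mem_univ, if_true,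
      Finset.sum_ite_irrel, Finset.sum_const_zero]

theorem quadPoly_injective {H K : Matrix (Fin n) (Fin n) ℝ} (hH : H.IsSymm) (hK : K.IsSymm)
    (h : quadPoly H = quadPoly K) : H = K := by
  ext i j
  have h1 := factorial_mul_coeff_quadPoly H i j
  rw [h, factorial_mul_coeff_quadPoly, hH.apply i j, hK.apply i j] at h1
  linarith

theorem diffPairing_add_left (p p' q : MvPolynomial (Fin n) ℝ) :
    diffPairing (p + p') q = diffPairing p q + diffPairing p' q := by
  classical
  let T := (p + p').support ∪ p.support ∪ p'.support
  rw [diffPairing_eq_of_subset (p + p') q T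
      (Finset.subset_union_left.trans Finset.subset_union_left),
    diffPairing_eq_of_subset p q T (Finset.subset_union_right.trans Finset.subset_union_left),
    diffPairing_eq_of_subset p' q T Finset.subset_union_right, ← Finset.sum_add_distrib]
  exact Finset.sum_congr rfl fun s _ => by simp; ring

theorem diffPairing_sum_left {ι : Type*} (s : Finset ι) (p : ι → MvPolynomial (Fin n) ℝ)
    (q : MvPolynomial (Fin n) ℝ) :
    diffPairing (∑ i ∈ s, p i) q = ∑ i ∈ s, diffPairing (p i) q := by
  classical
  induction s using Finset.induction_on with
  | empty => simp [diffPairing, applyDiffOp]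
  | insert a s ha ih => rw [Finset.sum_insert ha, Finset.sum_insert ha, diffPairing_add_left, ih]

theorem diffPairing_monomial_left (s : Fin n →₀ ℕ) (a : ℝ) (q : MvPolynomial (Fin n) ℝ) :
    diffPairing (MvPolynomial.monomial s a) q =
      a * ((∏ i, ((s i).factorial : ℝ)) * q.coeff s) := by
  classical
  rw [diffPairing_eq_of_subset _ _ {s} MvPolynomial.support_monomial_subset]
  simp

theorem diffPairing_quadPoly (H : Matrix (Fin n) (Fin n) ℝ) {K : Matrix (Fin n) (Fin n) ℝ}
    (hK : K.IsSymm) : diffPairing (quadPoly H) (quadPoly K) = 2 * (H * K).trace := by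
  rw [quadPoly, diffPairing_sum_left]
  simp only [diffPairing_sum_left, diffPairing_monomial_left, factorial_mul_coeff_quadPoly]
  simp only [Matrix.trace, Matrix.diag_apply, Matrix.mul_apply, Finset.mul_sum]
  refine Finset.sum_congr rfl fun i _ => Finset.sum_congr rfl fun j _ => ?_
  rw [hK.apply i j]
  ring

theorem laplacian_quadPoly (H : Matrix (Fin n) (Fin n) ℝ) :
    laplacian n (quadPoly H) = MvPolynomial.C (2 * H.trace) := by
  classical
  have h1 : quadPoly H = ∑ i, ∑ j, MvPolynomial.C (H i j) *
      (MvPolynomial.X i * MvPolynomial.X j) := by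
    refine Finset.sum_congr rfl fun i _ => Finset.sum_congr rfl fun j _ => ?_
    rw [MvPolynomial.X, MvPolynomial.X, MvPolynomial.monomial_mul, MvPolynomial.C_mul_monomial,
      mul_one, mul_one]
  have h2 : ∀ k i j : Fin n, MvPolynomial.pderiv k (MvPolynomial.pderiv k
      (MvPolynomial.C (H i j) * (MvPolynomial.X i * MvPolynomial.X j))) =
      if k = i then if k = j then MvPolynomial.C (2 * H i j) else 0 else 0 := by
    intro k i j
    by_cases hi : k = i <;> by_cases hj : k = j <;>
      simp [MvPolynomial.pderiv_X, Pi.single_apply, hi, hj, Ne.symm, two_mul, mul_add]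
    all_goals simp_all [eq_comm]
  rw [laplacian, LinearMap.sum_apply]
  change ∑ k, MvPolynomial.pderiv k (MvPolynomial.pderiv k (quadPoly H)) = _
  rw [h1]
  simp only [map_sum, h2]
  simp [Matrix.trace, Finset.mul_sum]

theorem quadPoly_mem_harmonicQuadratic (H : Matrix (Fin n) (Fin n) ℝ) :
    quadPoly H ∈ harmonicQuadratic n ↔ H.trace = 0 := by
  rw [harmonicQuadratic, Submodule.mem_inf, LinearMap.mem_ker, laplacian_quadPoly]
  have := quadPoly_mem_homogeneousSubmodule H
  simp_all

theorem exists_eq_quadPoly {p : MvPolynomial (Fin n) ℝ}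
    (hp : p ∈ MvPolynomial.homogeneousSubmodule (Fin n) ℝ 2) :
    ∃ H : Matrix (Fin n) (Fin n) ℝ, H.IsSymm ∧ p = quadPoly H := by
  classical
  have key : ∀ s ∈ p.support, ∃ H : Matrix (Fin n) (Fin n) ℝ, H.IsSymm ∧
      MvPolynomial.monomial s (p.coeff s) = quadPoly H := by
    intro s hs
    have h1 : s.degree = 2 := by
      by_contra h
      exact MvPolynomial.mem_support_iff.mp hs
        (((MvPolynomial.mem_homogeneousSubmodule _ _).mp hp).coeff_eq_zero h)
    obtain ⟨i, j, hij⟩ : ∃ i j, s = Finsupp.single i 1 + Finsupp.single j 1 := by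
      have h2 : Multiset.card (Finsupp.toMultiset s) = 2 := by
        rw [Finsupp.card_toMultiset, ← h1]
        rfl
      obtain ⟨i, j, h3⟩ := Multiset.card_eq_two.mp h2
      refine ⟨i, j, ?_⟩
      rw [← Finsupp.toMultiset_toFinsupp s, h3]
      exact (Multiset.toFinsupp_add {i} {j}).trans (by simp)
    -- Half of the coefficient goes to each of the positions (i, j) and (j, i), also when they
    -- coincide.
    let S : Matrix (Fin n) (Fin n) ℝ := Matrix.single i j (p.coeff s / 2)
    refine ⟨S + S.transpose, Matrix.isSymm_add_transpose_self S, ?_⟩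
    have h4 : ∀ (k l : Fin n) (a : ℝ), quadPoly (Matrix.single k l a) =
        MvPolynomial.monomial (Finsupp.single k 1 + Finsupp.single l 1) a := by
      intro k l a
      simp only [quadPoly, Matrix.single_apply, apply_ite (MvPolynomial.monomial _), map_zero,
        ite_and]
      simp
    rw [quadPoly_add, Matrix.transpose_single, h4, h4, add_comm (Finsupp.single j 1), ← hij,
      ← map_add, add_halves]
  choose! H hH hpH using key
  refine ⟨∑ s ∈ p.support, H s, ?_, ?_⟩
  · ext i j
    simp only [Matrix.transpose_apply, Matrix.sum_apply]
    exact Finset.sum_congr rfl fun s hs => (hH s hs).apply i j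
  · rw [quadPoly_sum, ← Finset.sum_congr rfl hpH]
    exact p.as_sum

/-- Orthonormal bases of the space of traceless symmetric matrices for the form `2 tr(HK)`. -/
structure IsTracelessONB {ι : Type*} [Fintype ι] [DecidableEq ι]
    (H : ι → Matrix (Fin n) (Fin n) ℝ) : Prop where
  isSymm : ∀ i, (H i).IsSymm
  trace_eq_zero : ∀ i, (H i).trace = 0
  pairing_eq : ∀ i j, 2 * (H i * H j).trace = if i = j then 1 else 0
  expansion : ∀ K : Matrix (Fin n) (Fin n) ℝ, K.IsSymm → K.trace = 0 →
    ∑ i, (2 * (H i * K).trace) • H i = K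

theorem IsHarmonicONB.exists_quadPoly {h : Fin (harmonicDim n) → MvPolynomial (Fin n) ℝ}
    (hh : IsHarmonicONB n h) : ∃ H, IsTracelessONB H ∧ h = fun i => quadPoly (H i) := by
  have h1 : ∀ i, ∃ H : Matrix (Fin n) (Fin n) ℝ, H.IsSymm ∧ h i = quadPoly H := fun i =>
    exists_eq_quadPoly (hh.mem i).1
  choose H hH hq using h1
  have hpair : ∀ i j, 2 * (H i * H j).trace = if i = j then 1 else 0 := fun i j => by
    rw [← diffPairing_quadPoly (H i) (hH j), ← hq, ← hq]
    exact hh.pairing_eq i j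
  refine ⟨H, ⟨hH, fun i => ?_, hpair, fun K hK hK0 => ?_⟩, funext hq⟩
  · rw [← quadPoly_mem_harmonicQuadratic, ← hq]
    exact hh.mem i
  · have h2 := (quadPoly_mem_harmonicQuadratic K).mpr hK0
    rw [← hh.span_eq, Submodule.mem_span_range_iff_exists_fun] at h2
    obtain ⟨r, hr⟩ := h2
    have h3 : ∑ i, r i • H i = K := by
      refine quadPoly_injective ?_ hK ?_
      · ext i j
        simp only [Matrix.transpose_apply, Matrix.sum_apply, Matrix.smul_apply]
        exact Finset.sum_congr rfl fun s _ => by rw [(hH s).apply i j]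
      · rw [quadPoly_sum, ← hr]
        exact Finset.sum_congr rfl fun i _ => by rw [quadPoly_smul, hq]
    have h4 : ∀ i, 2 * (H i * K).trace = r i := fun i => by
      rw [← h3, Matrix.mul_sum, Matrix.trace_sum, Finset.mul_sum]
      simp only [Matrix.mul_smul, Matrix.trace_smul, smul_eq_mul, mul_left_comm (2 : ℝ), hpair]
      simp
    simp only [h4, h3]

/-- The matrix of pairings between the two bases is orthogonal; later only the square of its
determinant is used. -/
theorem IsTracelessONB.exists_orthogonal {ι : Type*} [Fintype ι] [DecidableEq ι]
    {H H' : ι → Matrix (Fin n) (Fin n) ℝ} (h : IsTracelessONB H) (h' : IsTracelessONB H') :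
    ∃ O : Matrix ι ι ℝ, O.det ^ 2 = 1 ∧ ∀ j, H' j = ∑ i, O i j • H i := by
  let O : Matrix ι ι ℝ := Matrix.of fun i j => 2 * (H i * H' j).trace
  have h1 : ∀ j, H' j = ∑ i, O i j • H i := fun j =>
    (h.expansion _ (h'.isSymm j) (h'.trace_eq_zero j)).symm
  refine ⟨O, ?_, h1⟩
  have h2 : O.transpose * O = 1 := by
    ext j k
    rw [Matrix.mul_apply, Matrix.one_apply, ← h'.pairing_eq j k]
    conv_rhs => rw [h1 j, Matrix.sum_mul, Matrix.trace_sum, Finset.mul_sum]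
    refine Finset.sum_congr rfl fun i _ => ?_
    rw [Matrix.smul_mul, Matrix.trace_smul, smul_eq_mul, Matrix.transpose_apply]
    simp only [O, Matrix.of_apply]
    ring
  have h3 := congrArg Matrix.det h2
  rwa [Matrix.det_mul, Matrix.det_transpose, Matrix.det_one, ← sq] at h3

end

/-! ### The determinant as a Wronskian, and its invariance -/

section

variable {n : ℕ}

theorem latVec_ofZLatticeBasis {Λ : Submodule ℤ (EuclideanSpace ℝ (Fin n))}
    [DiscreteTopology Λ] [IsZLattice ℝ Λ] (b : Module.Basis (Fin n) ℤ Λ) (v : Fin n → ℤ) :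
    latVec (b.ofZLatticeBasis ℝ Λ) v = (b.equivFun.symm v : Λ) := by
  rw [latVec, Module.Basis.equivFun_symm_apply, Submodule.coe_sum]
  refine Finset.sum_congr rfl fun i _ => ?_
  rw [Module.Basis.ofZLatticeBasis_apply, Submodule.coe_smul, Int.cast_smul_eq_zsmul]

/-- The theta series with coefficients given by a quadratic form. -/
noncomputable def quadTheta (b : Module.Basis (Fin n) ℝ (EuclideanSpace ℝ (Fin n)))
    (H : Matrix (Fin n) (Fin n) ℝ) : ℂ → ℂ :=
  thetaSeries b fun v => (quadEval H (latVec b v) : ℂ)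

theorem isTempered_quadEval (b : Module.Basis (Fin n) ℝ (EuclideanSpace ℝ (Fin n)))
    (H : Matrix (Fin n) (Fin n) ℝ) : IsTempered b fun v => (quadEval H (latVec b v) : ℂ) := by
  obtain ⟨C, K, h⟩ := quadEval_growth H
  exact ⟨C, K, fun v => h _⟩

theorem differentiableOn_quadTheta (b : Module.Basis (Fin n) ℝ (EuclideanSpace ℝ (Fin n)))
    (H : Matrix (Fin n) (Fin n) ℝ) : DifferentiableOn ℂ (quadTheta b H) {z | 0 < z.im} :=
  (isTempered_quadEval b H).differentiableOn_thetaSeries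

theorem harmonicTheta_quadPoly {Λ : Submodule ℤ (EuclideanSpace ℝ (Fin n))}
    [DiscreteTopology Λ] [IsZLattice ℝ Λ] (b : Module.Basis (Fin n) ℤ Λ)
    (H : Matrix (Fin n) (Fin n) ℝ) (z : ℍ) :
    harmonicTheta Λ (quadPoly H) z = quadTheta (b.ofZLatticeBasis ℝ Λ) H z := by
  rw [harmonicTheta, ← b.equivFun.symm.toEquiv.tsum_eq]
  refine tsum_congr fun v => ?_
  simp only [LinearEquiv.coe_toEquiv]
  rw [latVec_ofZLatticeBasis, eval_quadPoly]
  congr 2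
  ring

theorem normalizedDerivOfComplex_iterate {F : ℍ → ℂ} {f : ℂ → ℂ} (h : ∀ z : ℍ, F z = f z) (k : ℕ)
    (z : ℍ) : Derivative.normalizedDerivOfComplex^[k] F z =
      (2 * Real.pi * Complex.I)⁻¹ ^ k * iteratedDeriv k f z := by
  induction k generalizing z with
  | zero => simp [h]
  | succ k ih =>
    rw [Function.iterate_succ_apply', Derivative.normalizedDerivOfComplex]
    have h1 : Derivative.normalizedDerivOfComplex^[k] F ∘ UpperHalfPlane.ofComplex =ᶠ[nhds (z : ℂ)]
        fun w => (2 * Real.pi * Complex.I)⁻¹ ^ k * iteratedDeriv k f w := by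
      refine Filter.eventuallyEq_of_mem (isOpen_im_pos.mem_nhds z.2) fun w hw => ?_
      rw [Function.comp_apply, ih, UpperHalfPlane.ofComplex_apply_of_im_pos hw]
    rw [h1.deriv_eq, deriv_const_mul_field, iteratedDeriv_succ, pow_succ]
    ring

/-- The normalised derivatives put the factor (2πi)⁻ᵏ on row k. Pulling it out moves the problem to
Wronskians of functions on ℂ. -/
theorem detDTheta_quadPoly {Λ : Submodule ℤ (EuclideanSpace ℝ (Fin n))}
    [DiscreteTopology Λ] [IsZLattice ℝ Λ] (b : Module.Basis (Fin n) ℤ Λ)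
    (H : Fin (harmonicDim n) → Matrix (Fin n) (Fin n) ℝ) (z : ℍ) :
    detDTheta Λ (fun i => quadPoly (H i)) z =
      (∏ k : Fin (harmonicDim n), (2 * Real.pi * Complex.I)⁻¹ ^ (k : ℕ)) *
        wronskian (fun j => quadTheta (b.ofZLatticeBasis ℝ Λ) (H j)) z := by
  rw [detDTheta, wronskian, ← Matrix.det_mul_column]
  congr 1
  ext k j
  exact normalizedDerivOfComplex_iterate (harmonicTheta_quadPoly b (H j)) k z

theorem wronskian_linear_combination {U : Set ℂ} (hU : IsOpen U) {m : ℕ} {f : Fin m → ℂ → ℂ}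
    (hf : ∀ j, DifferentiableOn ℂ (f j) U) (O : Matrix (Fin m) (Fin m) ℂ) {z : ℂ} (hz : z ∈ U) :
    wronskian (fun j z => ∑ i, O i j * f i z) z = wronskian f z * O.det := by
  rw [wronskian, wronskian, ← Matrix.det_mul]
  congr 1
  ext k j
  have hd : ∀ i, ContDiffAt ℂ k (f i) z := fun i =>
    ((hf i).analyticAt (hU.mem_nhds hz)).contDiffAt
  rw [Matrix.mul_apply, Matrix.of_apply,
    iteratedDeriv_fun_sum fun i _ => contDiffAt_const.mul (hd i)]
  refine Finset.sum_congr rfl fun i _ => ?_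
  rw [iteratedDeriv_const_mul_field, Matrix.of_apply, mul_comm]

theorem summable_quadTheta (b : Module.Basis (Fin n) ℝ (EuclideanSpace ℝ (Fin n)))
    (H : Matrix (Fin n) (Fin n) ℝ) {z : ℂ} (hz : 0 < z.im) :
    Summable fun v => (quadEval H (latVec b v) : ℂ) *
      Complex.exp (2 * Real.pi * Complex.I * z * (‖latVec b v‖ ^ 2 : ℝ)) := by
  obtain ⟨C, K, h⟩ := isTempered_quadEval b H
  exact summable_thetaSeries b h hz

theorem quadEval_sum_smul {ι : Type*} (s : Finset ι) (r : ι → ℝ)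
    (H : ι → Matrix (Fin n) (Fin n) ℝ) (x : EuclideanSpace ℝ (Fin n)) :
    quadEval (∑ i ∈ s, r i • H i) x = ∑ i ∈ s, r i * quadEval (H i) x := by
  rw [← eval_quadPoly, quadPoly_sum, map_sum]
  refine Finset.sum_congr rfl fun i _ => ?_
  rw [quadPoly_smul, MvPolynomial.smul_eval, eval_quadPoly]

theorem quadTheta_sum_smul (b : Module.Basis (Fin n) ℝ (EuclideanSpace ℝ (Fin n))) {ι : Type*}
    (s : Finset ι) (r : ι → ℝ) (H : ι → Matrix (Fin n) (Fin n) ℝ) {z : ℂ} (hz : 0 < z.im) :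
    quadTheta b (∑ i ∈ s, r i • H i) z = ∑ i ∈ s, (r i : ℂ) * quadTheta b (H i) z := by
  simp only [quadTheta, thetaSeries, ← tsum_mul_left]
  rw [← Summable.tsum_finsetSum fun i _ => (summable_quadTheta b (H i) hz).mul_left _]
  refine tsum_congr fun v => ?_
  rw [quadEval_sum_smul]
  push_cast
  rw [Finset.sum_mul]
  exact Finset.sum_congr rfl fun i _ => by ring

theorem IsTracelessONB.detDTheta_sq_eq {Λ : Submodule ℤ (EuclideanSpace ℝ (Fin n))}
    [DiscreteTopology Λ] [IsZLattice ℝ Λ] (b : Module.Basis (Fin n) ℤ Λ)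
    {H H' : Fin (harmonicDim n) → Matrix (Fin n) (Fin n) ℝ} (h : IsTracelessONB H)
    (h' : IsTracelessONB H') (z : ℍ) :
    detDTheta Λ (fun i => quadPoly (H' i)) z ^ 2 = detDTheta Λ (fun i => quadPoly (H i)) z ^ 2 := by
  obtain ⟨O, hO, hH⟩ := h.exists_orthogonal h'
  rw [detDTheta_quadPoly b, detDTheta_quadPoly b]
  let B := b.ofZLatticeBasis ℝ Λ
  have h1 : wronskian (fun j => quadTheta B (H' j)) z =
      wronskian (fun j z => ∑ i, (O.map Complex.ofReal) i j * quadTheta B (H i) z) z := by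
    simp only [wronskian]
    congr 1
    ext k j
    refine Filter.EventuallyEq.iteratedDeriv_eq k
      (Filter.eventuallyEq_of_mem (isOpen_im_pos.mem_nhds z.2) fun w hw => ?_)
    rw [hH j, quadTheta_sum_smul B _ _ _ hw]
    rfl
  have h2 : (O.map Complex.ofReal).det = (O.det : ℂ) := (Complex.ofRealHom.map_det O).symm
  rw [h1, wronskian_linear_combination isOpen_im_pos
    (fun j => differentiableOn_quadTheta B (H j)) _ z.2, h2, mul_pow, mul_pow, mul_pow,
    ← Complex.ofReal_pow, hO]
  simp [B]

theorem exists_isTracelessONB (n : ℕ) : ∃ H : Fin (harmonicDim n) → Matrix (Fin n) (Fin n) ℝ,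
    IsTracelessONB H ∧ harmonicONB n = fun i => quadPoly (H i) :=
  IsHarmonicONB.exists_quadPoly (exists_isHarmonicONB n).choose_spec

theorem IsHarmonicONB.detDTheta_sq_eq {Λ : Submodule ℤ (EuclideanSpace ℝ (Fin n))}
    [DiscreteTopology Λ] [IsZLattice ℝ Λ] (b : Module.Basis (Fin n) ℤ Λ)
    {h : Fin (harmonicDim n) → MvPolynomial (Fin n) ℝ} (hh : IsHarmonicONB n h) (z : ℍ) :
    detDTheta Λ h z ^ 2 = detSqDTheta Λ z := by
  obtain ⟨H, hH, rfl⟩ := hh.exists_quadPoly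
  obtain ⟨H', hH', h'⟩ := exists_isTracelessONB n
  rw [detSqDTheta, h']
  exact hH'.detDTheta_sq_eq b hH z

/-- The matrix of a linear isometry in the standard basis. -/
noncomputable def isometryMatrix (φ : EuclideanSpace ℝ (Fin n) ≃ₗᵢ[ℝ] EuclideanSpace ℝ (Fin n)) :
    Matrix (Fin n) (Fin n) ℝ :=
  Matrix.of fun i j => φ (EuclideanSpace.single j 1) i

theorem isometry_apply (φ : EuclideanSpace ℝ (Fin n) ≃ₗᵢ[ℝ] EuclideanSpace ℝ (Fin n))
    (x : EuclideanSpace ℝ (Fin n)) (i : Fin n) : φ x i = ∑ j, isometryMatrix φ i j * x j := by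
  have h1 : x = ∑ j, x j • EuclideanSpace.single j (1 : ℝ) := by
    ext i
    simp [Finset.sum_apply, Pi.single_apply]
  conv_lhs => rw [h1]
  simp [isometryMatrix, mul_comm]

theorem transpose_isometryMatrix_mul
    (φ : EuclideanSpace ℝ (Fin n) ≃ₗᵢ[ℝ] EuclideanSpace ℝ (Fin n)) :
    (isometryMatrix φ).transpose * isometryMatrix φ = 1 := by
  ext j k
  have h1 := φ.inner_map_map (EuclideanSpace.single k (1 : ℝ)) (EuclideanSpace.single j 1)
  simp only [PiLp.inner_apply, RCLike.inner_apply, conj_trivial] at h1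
  rw [Matrix.mul_apply, Matrix.one_apply]
  simp only [Matrix.transpose_apply, isometryMatrix, Matrix.of_apply]
  rw [h1]
  simp [eq_comm]

theorem quadEval_eq_dotProduct (H : Matrix (Fin n) (Fin n) ℝ) (x : EuclideanSpace ℝ (Fin n)) :
    quadEval H x = dotProduct (fun i => x i) (H.mulVec fun i => x i) := by
  simp only [quadEval, dotProduct, Matrix.mulVec, Finset.mul_sum]
  exact Finset.sum_congr rfl fun i _ => Finset.sum_congr rfl fun j _ => by ring

theorem quadEval_isometry (φ : EuclideanSpace ℝ (Fin n) ≃ₗᵢ[ℝ] EuclideanSpace ℝ (Fin n))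
    (H : Matrix (Fin n) (Fin n) ℝ) (x : EuclideanSpace ℝ (Fin n)) :
    quadEval H (φ x) = quadEval ((isometryMatrix φ).transpose * H * isometryMatrix φ) x := by
  have h2 : (fun i => φ x i) = (isometryMatrix φ).mulVec fun i => x i :=
    funext fun i => isometry_apply φ x i
  rw [quadEval_eq_dotProduct, quadEval_eq_dotProduct, h2, ← Matrix.mulVec_mulVec,
    ← Matrix.mulVec_mulVec, Matrix.dotProduct_mulVec _
    (isometryMatrix φ).transpose, Matrix.vecMul_transpose]

theorem IsTracelessONB.conj {ι : Type*} [Fintype ι] [DecidableEq ι]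
    {H : ι → Matrix (Fin n) (Fin n) ℝ} (h : IsTracelessONB H) {P : Matrix (Fin n) (Fin n) ℝ}
    (hP : P.transpose * P = 1) : IsTracelessONB fun i => P.transpose * H i * P := by
  have hP' : P * P.transpose = 1 := mul_eq_one_comm.mp hP
  have hsymm : ∀ {K : Matrix (Fin n) (Fin n) ℝ} (Q : Matrix (Fin n) (Fin n) ℝ), K.IsSymm →
      (Q.transpose * K * Q).IsSymm := fun {K} Q hK => by
    rw [Matrix.IsSymm, Matrix.transpose_mul, Matrix.transpose_mul, Matrix.transpose_transpose,
      hK.eq, Matrix.mul_assoc]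
  have htr : ∀ K : Matrix (Fin n) (Fin n) ℝ, (P.transpose * K * P).trace = K.trace := fun K => by
    rw [Matrix.trace_mul_comm, ← Matrix.mul_assoc, hP', Matrix.one_mul]
  refine ⟨fun i => hsymm P (h.isSymm i), fun i => (htr _).trans (h.trace_eq_zero i),
    fun i j => ?_, fun K hK hK0 => ?_⟩
  · have : P.transpose * H i * P * (P.transpose * H j * P) = P.transpose * (H i * H j) * P := by
      calc _ = P.transpose * H i * (P * P.transpose) * H j * P := by
            simp only [Matrix.mul_assoc]
        _ = _ := by
            rw [hP', Matrix.mul_one]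
            simp only [Matrix.mul_assoc]
    rw [this, htr]
    exact h.pairing_eq i j
  · have h1 := h.expansion (P * K * P.transpose)
      (by simpa using hsymm P.transpose hK)
      (by rw [Matrix.trace_mul_comm, ← Matrix.mul_assoc, hP, Matrix.one_mul, hK0])
    have h2 : ∀ i, (P.transpose * H i * P * K).trace = (H i * (P * K * P.transpose)).trace := by
      intro i
      rw [Matrix.mul_assoc, Matrix.mul_assoc, Matrix.trace_mul_comm]
      simp only [Matrix.mul_assoc]
    have h3 : P.transpose * (P * K * P.transpose) * P = K := by
      calc _ = (P.transpose * P) * K * (P.transpose * P) := by simp only [Matrix.mul_assoc]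
        _ = K := by rw [hP, Matrix.one_mul, Matrix.mul_one]
    simp only [h2]
    rw [← h3]
    nth_rw 2 [← h1]
    rw [Matrix.mul_sum, Matrix.sum_mul]
    simp only [Matrix.mul_smul, Matrix.smul_mul, h3]

/-- Reindexing the sums by the isometry, with matrix P, replaces each H by ᵗP H P. These form
another orthonormal basis of traceless matrices, so basis independence applies. -/
theorem detSqDTheta_map {Λ : Submodule ℤ (EuclideanSpace ℝ (Fin n))}
    [DiscreteTopology Λ] [IsZLattice ℝ Λ] (b : Module.Basis (Fin n) ℤ Λ)
    (φ : EuclideanSpace ℝ (Fin n) ≃ₗᵢ[ℝ] EuclideanSpace ℝ (Fin n)) :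
    detSqDTheta (Λ.map (φ.toLinearEquiv.toLinearMap.restrictScalars ℤ)) = detSqDTheta Λ := by
  obtain ⟨H, hH, h⟩ := exists_isTracelessONB n
  funext z
  have h1 : ∀ i, harmonicTheta (Λ.map (φ.toLinearEquiv.toLinearMap.restrictScalars ℤ))
      (quadPoly (H i)) = harmonicTheta Λ
        (quadPoly ((isometryMatrix φ).transpose * H i * isometryMatrix φ)) := by
    intro i
    funext z
    let e := Submodule.equivMapOfInjective (φ.toLinearEquiv.toLinearMap.restrictScalars ℤ)
      φ.injective Λ
    rw [harmonicTheta, ← e.toEquiv.tsum_eq]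
    refine tsum_congr fun v => ?_
    have h2 : ((e.toEquiv v : _) : EuclideanSpace ℝ (Fin n)) = φ v := rfl
    rw [h2, φ.norm_map, eval_quadPoly, eval_quadPoly, quadEval_isometry]
  have h2 : detDTheta (Λ.map (φ.toLinearEquiv.toLinearMap.restrictScalars ℤ))
      (fun i => quadPoly (H i)) z = detDTheta Λ
        (fun i => quadPoly ((isometryMatrix φ).transpose * H i * isometryMatrix φ)) z := by
    simp only [detDTheta, h1]
  rw [detSqDTheta, detSqDTheta, h, h2]
  exact hH.detDTheta_sq_eq b (hH.conj (transpose_isometryMatrix_mul φ)) z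

end

/-! ### Lattices of level `N` and the action of `Γ₀(N)` -/

section

variable {n : ℕ} {b b' : Module.Basis (Fin n) ℝ (EuclideanSpace ℝ (Fin n))}

/-- `N‖w‖²` is integral on the lattice spanned by `b'`. -/
def HasLevelDividing (b' : Module.Basis (Fin n) ℝ (EuclideanSpace ℝ (Fin n))) (N : ℤ) : Prop :=
  ∀ k, ∃ m : ℤ, N * ‖latVec b' k‖ ^ 2 = m

theorem HasLevelDividing.of_dvd {N c : ℤ} (h : HasLevelDividing b' N) (hc : N ∣ c) :
    HasLevelDividing b' c := by
  obtain ⟨t, rfl⟩ := hc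
  intro k
  obtain ⟨m, hm⟩ := h k
  refine ⟨t * m, ?_⟩
  push_cast
  rw [← hm]
  ring

theorem IsPolarDual.exists_eq_latVec (hb : IsPolarDual b b') {x : EuclideanSpace ℝ (Fin n)}
    (h : ∀ i, ∃ m : ℤ, 2 * ⟪b' i, x⟫ = m) : ∃ s, x = latVec b s := by
  choose s hs using h
  refine ⟨s, ?_⟩
  rw [latVec, ← b.sum_repr x]
  exact Finset.sum_congr rfl fun i _ => by rw [hb.repr_eq, hs]

theorem latVec_single (i : Fin n) : latVec b (Pi.single i 1) = b i := by
  rw [latVec, Finset.sum_eq_single i]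
  · simp
  · intro j _ hj
    simp [hj]
  · simp

/-- Polarising the integrality of N‖·‖² on the dual lattice shows that Nη pairs integrally with the
dual lattice, hence lies in the lattice by biduality. -/
theorem HasLevelDividing.smul_mem (hb : IsPolarDual b b') {N : ℤ} (h : HasLevelDividing b' N)
    (k : Fin n → ℤ) : ∃ s, (N : ℝ) • latVec b' k = latVec b s := by
  refine hb.exists_eq_latVec fun i => ?_
  obtain ⟨m1, h1⟩ := h (Pi.single i 1 + k)
  obtain ⟨m2, h2⟩ := h (Pi.single i 1)
  obtain ⟨m3, h3⟩ := h k
  rw [latVec_add, norm_add_sq_real, latVec_single] at h1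
  rw [latVec_single] at h2
  refine ⟨m1 - m2 - m3, ?_⟩
  rw [inner_smul_right]
  push_cast
  linarith

/-- The polar form is nondegenerate modulo every prime p ∤ N: if v pairs into pℤ, then v/p lies in
the dual lattice, so Nv/p is a lattice vector and p ∣ N vᵢ. -/
theorem HasLevelDividing.dvd_of_forall_dvd_inner (hb : IsPolarDual b b') {N : ℤ}
    (h : HasLevelDividing b' N) {p : ℕ} (hp : p.Prime) (hpN : ¬ (p : ℤ) ∣ N) (v : Fin n → ℤ)
    (hv : ∀ u, ∃ m : ℤ, 2 * ⟪latVec b v, latVec b u⟫ = p * m) (i : Fin n) : (p : ℤ) ∣ v i := by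
  have hp0 : (p : ℝ) ≠ 0 := by exact_mod_cast hp.ne_zero
  obtain ⟨k, hk⟩ := hb.symm.exists_eq_latVec (x := (p : ℝ)⁻¹ • latVec b v) fun i => by
    obtain ⟨m, hm⟩ := hv (Pi.single i 1)
    refine ⟨m, ?_⟩
    rw [latVec_single, real_inner_comm] at hm
    rw [inner_smul_right, mul_left_comm, hm, inv_mul_cancel_left₀ hp0]
  obtain ⟨s, hs⟩ := h.smul_mem hb k
  have h1 : latVec b (N • v) = latVec b ((p : ℤ) • s) := by
    rw [latVec_smul, latVec_smul, ← hs, ← hk, smul_smul, smul_smul]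
    congr 1
    push_cast
    field_simp
  have h2 := congrFun (latVec_injective b h1) i
  have h3 : (p : ℤ) ∣ N * v i := ⟨s i, h2⟩
  exact ((Nat.prime_iff_prime_int.mp hp).dvd_or_dvd h3).resolve_left hpN

theorem wronskian_thetaSeries_add_int (hI : IsIntegralBasis b) {m : ℕ}
    (c : Fin m → (Fin n → ℤ) → ℂ) (z : ℂ) (k : ℤ) :
    wronskian (fun j => thetaSeries b (c j)) (z + k) =
      wronskian (fun j => thetaSeries b (c j)) z := by
  induction k using Int.induction_on with
  | zero => simp
  | succ k ih =>
    rw [← ih]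
    push_cast
    rw [← add_assoc, wronskian_thetaSeries_add_one hI]
  | pred k ih =>
    rw [← ih, ← wronskian_thetaSeries_add_one hI]
    push_cast
    congr 1
    ring

/-- Put d = p + ck. Then γz = γ′(z + k), where γ′ has lower row (c, p) and upper right entry β − αk,
and the Wronskian is invariant under integral translations. -/
theorem wronskian_thetaSeries_gamma0 (hb : IsPolarDual b b') (hI : IsIntegralBasis b) {N : ℤ}
    (hN : HasLevelDividing b' N) {α β c d : ℤ} (hdet : α * d - β * c = 1) (hc : N ∣ c) {p : ℕ}
    (hp : p.Prime) (hp2 : p ≠ 2) (hpN : ¬ (p : ℤ) ∣ N) (hpd : (p : ℤ) ≡ d [ZMOD c]) {m ν : ℕ}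
    {h : Fin m → EuclideanSpace ℝ (Fin n) → ℂ} (hh : ∀ j, IsThetaWeight b b' (h j) ν) {z : ℂ}
    (hz : 0 < z.im) :
    wronskian (fun j => thetaSeries b (fun v => h j (latVec b v))) ((α * z + β) / (c * z + d)) ^ 2 =
      ((ZMod.χ₄ p : ℤ) : ℂ) ^ (n * m) * (c * z + d) ^ (m * (n + 2 * ν) + 2 * (m * (m - 1))) *
      wronskian (fun j => thetaSeries b (fun v => h j (latVec b v))) z ^ 2 := by
  have : Fact p.Prime := ⟨hp⟩
  obtain ⟨k, hk⟩ := hpd.dvd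
  have hpc : (p : ℤ) = d - c * k := by linarith
  have hdet' : α * p - (β - α * k) * c = 1 := by
    rw [hpc]
    linarith
  have h1 := wronskian_thetaSeries_transform hb hI hp2 hdet'
    ((hN.of_dvd hc).smul_mem hb) (hN.of_dvd hc)
    (fun v hv i => hN.dvd_of_forall_dvd_inner hb hp hpN v hv i) hh (z := z + k) (by simpa using hz)
  have hpC : (p : ℂ) = d - c * k := by exact_mod_cast hpc
  have h2 : (c * (z + k) + p : ℂ) = c * z + d := by
    rw [hpC]
    ring
  have h3 : (α * (z + k) + (β - α * k : ℤ) : ℂ) = α * z + β := by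
    push_cast
    ring
  rwa [h2, h3, wronskian_thetaSeries_add_int hI] at h1

theorem exists_prime_gt_modEq {a q : ℤ} (hq : q ≠ 0) (h : IsCoprime a q) (B : ℕ) :
    ∃ p : ℕ, B < p ∧ p.Prime ∧ (p : ℤ) ≡ a [ZMOD q] := by
  have h1 : IsCoprime a (q.natAbs : ℤ) := by
    rw [Int.isCoprime_iff_gcd_eq_one] at h ⊢
    simpa only [Int.gcd, Int.natAbs_natCast] using h
  obtain ⟨p, hp1, hp2, hp3⟩ :=
    Nat.forall_exists_prime_gt_and_zmodEq B (Int.natAbs_ne_zero.mpr hq) h1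
  exact ⟨p, hp1, hp2, Int.modEq_of_dvd (Int.natAbs_dvd.mp hp3.dvd)⟩

theorem thetaSeries_one_I_ne_zero (b : Module.Basis (Fin n) ℝ (EuclideanSpace ℝ (Fin n))) :
    thetaSeries b (fun _ => 1) Complex.I ≠ 0 := by
  have h1 : thetaSeries b (fun _ => 1) Complex.I =
      ((∑' v, Real.exp (-(2 * Real.pi) * ‖latVec b v‖ ^ 2) : ℝ) : ℂ) := by
    rw [Complex.ofReal_tsum]
    refine tsum_congr fun v => ?_
    push_cast
    rw [one_mul]
    congr 1
    linear_combination 2 * Real.pi * (‖latVec b v‖ : ℂ) ^ 2 * Complex.I_mul_I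
  rw [h1, Complex.ofReal_ne_zero]
  have hs := summable_exp_neg_normSq_latVec b (δ := 2 * Real.pi) (by positivity)
  exact (hs.tsum_pos (fun v => (Real.exp_pos _).le) 0 (Real.exp_pos _)).ne'

/-- If 4 ∤ N, Dirichlet gives large primes p ≡ 1 and r ≡ 3 mod 4, both ≡ 1 mod N. Applied to the
plain theta series and the matrix with rows (1, 0) and (N, 1), the transformation law computes the
same value with the signs 1 and (−1)ⁿ = −1, a contradiction because Θ(i) ≠ 0. -/
theorem four_dvd_of_odd (hb : IsPolarDual b b') (hI : IsIntegralBasis b) {N : ℕ} (hN0 : N ≠ 0)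
    (hN : HasLevelDividing b' N) (hn : Odd n) : 4 ∣ N := by
  by_contra h4
  have hN0' : (N : ℤ) ≠ 0 := by exact_mod_cast hN0
  have hNz : (4 * N : ℤ) ≠ 0 := by omega
  have hgt : ∀ {p : ℕ}, p.Prime → N + 2 < p → p ≠ 2 ∧ ¬ (p : ℤ) ∣ N := by
    intro p hp h
    refine ⟨by omega, fun h1 => ?_⟩
    have := Nat.le_of_dvd (Nat.pos_of_ne_zero hN0) (Int.natCast_dvd_natCast.mp h1)
    omega
  -- Solvable precisely because N is not divisible by 4; the resulting class is coprime to both 4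
  -- and N.
  obtain ⟨t, ht⟩ : ∃ t : ℤ, (1 + N * t) % 4 = 3 := by
    have h1 : N % 4 = 1 ∨ N % 4 = 2 ∨ N % 4 = 3 := by omega
    rcases h1 with h1 | h1 | h1
    · exact ⟨2, by omega⟩
    · exact ⟨1, by omega⟩
    · exact ⟨2, by omega⟩
  have hco : IsCoprime (1 + N * t) (4 * N : ℤ) := by
    refine IsCoprime.mul_right ?_ ⟨1, -t, by ring⟩
    have h1 : ∃ s, 1 + (N : ℤ) * t = 4 * s + 3 := ⟨(1 + N * t) / 4, by omega⟩
    obtain ⟨s, hs⟩ := h1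
    rw [hs]
    exact ⟨-1, s + 1, by ring⟩
  obtain ⟨p, hp1, hp, hp3⟩ := exists_prime_gt_modEq hNz (isCoprime_one_left (x := (4 * N : ℤ)))
    (N + 2)
  obtain ⟨r, hr1, hr, hr3⟩ := exists_prime_gt_modEq hNz hco (N + 2)
  have hpN : (p : ℤ) ≡ 1 [ZMOD N] := hp3.of_mul_left 4
  have hrN : (r : ℤ) ≡ 1 [ZMOD N] := by
    refine (hr3.of_mul_left 4).trans ?_
    exact (Int.modEq_iff_dvd.mpr ⟨-t, by ring⟩)
  have hp4 : p % 4 = 1 := by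
    have := hp3.of_mul_right N
    simp only [Int.ModEq] at this
    omega
  have hr4 : r % 4 = 3 := by
    have := hr3.of_mul_right N
    simp only [Int.ModEq] at this
    omega
  -- With a single function the Wronskian is the theta series itself.
  have hh : ∀ j : Fin 1, IsThetaWeight b b' (fun _ => (1 : ℂ)) 0 := fun _ => isThetaWeight_one hb
  have e1 := wronskian_thetaSeries_gamma0 hb hI hN (α := 1) (β := 0) (c := N) (d := 1) (by ring)
    dvd_rfl hp (hgt hp hp1).1 (hgt hp hp1).2 hpN hh (z := Complex.I) (by simp)
  have e2 := wronskian_thetaSeries_gamma0 hb hI hN (α := 1) (β := 0) (c := N) (d := 1) (by ring)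
    dvd_rfl hr (hgt hr hr1).1 (hgt hr hr1).2 hrN hh (z := Complex.I) (by simp)
  have hW : wronskian (fun _ : Fin 1 => thetaSeries b fun _ => 1) Complex.I ≠ 0 := by
    simpa [wronskian] using thetaSeries_one_I_ne_zero b
  have hden := denom_ne_zero_of_im_pos (c := N) (d := 1) (Or.inl hN0') (z := Complex.I) (by simp)
  rw [e1, ZMod.χ₄_nat_one_mod_four hp4, ZMod.χ₄_nat_three_mod_four hr4, mul_one] at e2
  have h2 := mul_right_cancel₀ (pow_ne_zero 2 hW) e2
  have h3 := mul_right_cancel₀ (pow_ne_zero _ hden) h2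
  rw [Int.cast_one, one_pow, Int.cast_neg, Int.cast_one, hn.neg_one_pow] at h3
  norm_num at h3

/-- The character of `det²` on lower right entries. -/
def thetaCharacter (n : ℕ) (d : ℤ) : ℤ := if n % 4 = 3 then ZMod.χ₄ d else 1

/-- Decides when the sign χ₄(p)^(nm) survives. For n ≡ 1 mod 4 the dimension m is even, for n ≡ 3
mod 4 it is odd. -/
theorem harmonicDim_parity (n : ℕ) :
    (n % 4 ≠ 3 → Even (n * harmonicDim n)) ∧
    (n % 4 = 3 → Odd (n * harmonicDim n) ∧ Odd n) := by
  have hn : n = 4 * (n / 4) + n % 4 := by omega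
  have h4 : n % 4 < 4 := Nat.mod_lt _ (by norm_num)
  set q := n / 4
  have h0 : n % 4 = 0 ∨ n % 4 = 1 ∨ n % 4 = 2 ∨ n % 4 = 3 := by omega
  rcases h0 with h | h | h | h <;> rw [h] at hn ⊢
  · refine ⟨fun _ => Even.mul_right ⟨2 * q, by omega⟩ _, by omega⟩
  · refine ⟨fun _ => Even.mul_left ?_ _, by omega⟩
    have : harmonicDim n = 2 * (4 * q ^ 2 + 3 * q) := by
      rw [harmonicDim, hn]
      have : (4 * q + 1) ^ 2 + (4 * q + 1) - 2 = 2 * (2 * (4 * q ^ 2 + 3 * q)) := by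
        zify
        rw [Nat.cast_sub (by nlinarith)]
        push_cast
        ring
      omega
    rw [this]
    exact even_two_mul _
  · refine ⟨fun _ => Even.mul_right ⟨2 * q + 1, by omega⟩ _, by omega⟩
  · refine ⟨by omega, fun _ => ?_⟩
    have hno : Odd n := ⟨2 * q + 1, by omega⟩
    refine ⟨hno.mul ?_, hno⟩
    have : harmonicDim n = 2 * (4 * q ^ 2 + 7 * q + 2) + 1 := by
      rw [harmonicDim, hn]
      have : (4 * q + 3) ^ 2 + (4 * q + 3) - 2 = 2 * (2 * (4 * q ^ 2 + 7 * q + 2) + 1) := by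
        zify
        rw [Nat.cast_sub (by nlinarith)]
        push_cast
        ring
      omega
    rw [this]
    exact odd_two_mul_add_one _

/-- For n > 0 both identities are consequences of 2m = n² + n − 2; n = 0 is separate because there
the natural subtraction truncates. -/
theorem harmonicDim_weight (n : ℕ) :
    harmonicDim n * (n + 2 * 2) + 2 * (harmonicDim n * (harmonicDim n - 1)) =
      n * harmonicDim n * (n + 2) ∧
    ((n : ℤ) + 2) ^ 2 * n * (n - 1) / 2 = (n * harmonicDim n * (n + 2) : ℕ) := by
  rcases Nat.eq_zero_or_pos n with rfl | hn
  · constructor <;> rfl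
  have h1 : 2 * harmonicDim n = n ^ 2 + n - 2 := by
    rw [harmonicDim]
    refine Nat.mul_div_cancel' ?_
    have : n ^ 2 + n = n * (n + 1) := by ring
    rw [this]
    exact Nat.dvd_sub (Nat.even_mul_succ_self n).two_dvd dvd_rfl
  have h2 : (2 * harmonicDim n : ℤ) = n ^ 2 + n - 2 := by
    have h3 : 2 ≤ n ^ 2 + n := by nlinarith
    zify [h3] at h1
    exact h1
  constructor
  · rcases Nat.eq_zero_or_pos (harmonicDim n) with h | h
    · simp [h]
    · zify [Nat.one_le_iff_ne_zero.mpr h.ne']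
      linear_combination (harmonicDim n : ℤ) * h2
  · refine Int.ediv_eq_of_eq_mul_right (by norm_num) ?_
    push_cast
    linear_combination (- (n : ℤ) * (n + 2)) * h2

theorem chi_four_pow {n : ℕ} {p : ℕ} (hp : p % 2 = 1) :
    (ZMod.χ₄ p : ℤ) ^ (n * harmonicDim n) = thetaCharacter n p := by
  have hsq : (ZMod.χ₄ p : ℤ) = 1 ∨ (ZMod.χ₄ p : ℤ) = -1 := by
    rw [ZMod.χ₄_nat_eq_if_mod_four, if_neg (by omega)]
    split_ifs <;> simp
  rw [thetaCharacter]
  split_ifs with hn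
  · obtain ⟨h1, -⟩ := (harmonicDim_parity n).2 hn
    rw [Int.cast_natCast]
    rcases hsq with h | h
    · rw [h, one_pow]
    · rw [h, h1.neg_one_pow]
  · have h1 := (harmonicDim_parity n).1 hn
    rcases hsq with h | h
    · rw [h, one_pow]
    · rw [h, h1.neg_one_pow]

/-- Covers c = 0, d = ±1. At d = −1 the character and the weight have the same parity: χ₄(−1) = −1
goes with odd weight. -/
theorem thetaCharacter_mul_pow_of_mul_eq_one {α d : ℤ} (h : α * d = 1) :
    ((thetaCharacter n d : ℤ) : ℂ) * (d : ℂ) ^ (n * harmonicDim n * (n + 2)) = 1 := by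
  rcases Int.eq_one_or_neg_one_of_mul_eq_one' h with ⟨-, rfl⟩ | ⟨-, rfl⟩
  · simp [thetaCharacter]
  · rw [thetaCharacter]
    split_ifs with hn
    · obtain ⟨h1, h2⟩ := (harmonicDim_parity n).2 hn
      have h3 : Odd (n * harmonicDim n * (n + 2)) := h1.mul (h2.add_even even_two)
      rw [Int.cast_neg, Int.cast_one, Int.cast_neg, Int.cast_one, h3.neg_one_pow]
      have : (ZMod.χ₄ (-1)) = -1 := by decide
      rw [this]
      norm_num
    · have h1 := ((harmonicDim_parity n).1 hn).mul_right (n + 2)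
      rw [Int.cast_neg, Int.cast_one, h1.neg_one_pow]
      simp

theorem wronskian_quadTheta_gamma0 (hb : IsPolarDual b b') (hI : IsIntegralBasis b) {N : ℕ}
    (hN0 : N ≠ 0) (hN : HasLevelDividing b' N) {α β c d : ℤ} (hdet : α * d - β * c = 1)
    (hc : (N : ℤ) ∣ c) {H : Fin (harmonicDim n) → Matrix (Fin n) (Fin n) ℝ}
    (hH : ∀ j, (H j).trace = 0) {z : ℂ} (hz : 0 < z.im) :
    wronskian (fun j => quadTheta b (H j)) ((α * z + β) / (c * z + d)) ^ 2 =
      (thetaCharacter n d : ℂ) * (c * z + d) ^ (n * harmonicDim n * (n + 2)) *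
      wronskian (fun j => quadTheta b (H j)) z ^ 2 := by
  -- For c = 0 there is no modulus for Dirichlet's theorem, but then γ acts as an integral
  -- translation.
  by_cases hc0 : c = 0
  · subst hc0
    rw [mul_zero, sub_zero] at hdet
    rw [Int.cast_zero, zero_mul, zero_add, thetaCharacter_mul_pow_of_mul_eq_one hdet, one_mul]
    have h1 : (α * z + β) / d = z + ((β * α : ℤ) : ℂ) := by
      have hdet' : (α * d : ℂ) = 1 := by exact_mod_cast hdet
      have hd : (d : ℂ) ≠ 0 := right_ne_zero_of_mul_eq_one hdet'
      have hsq : (α : ℂ) = d := by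
        rcases Int.eq_one_or_neg_one_of_mul_eq_one' hdet with ⟨h1, h2⟩ | ⟨h1, h2⟩ <;> rw [h1, h2]
      rw [div_eq_iff hd]
      push_cast
      linear_combination z * hsq - β * hdet'
    rw [h1]
    congr 1
    exact wronskian_thetaSeries_add_int hI (fun j v => (quadEval (H j) (latVec b v) : ℂ)) z _
  · have hco : IsCoprime d c := ⟨α, -β, by linarith⟩
    obtain ⟨p, hpN, hp, hpd⟩ := exists_prime_gt_modEq hc0 hco (N + 2)
    have hp2 : p ≠ 2 := by omega
    have hpN' : ¬ (p : ℤ) ∣ N := fun h => by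
      have := Nat.le_of_dvd (Nat.pos_of_ne_zero hN0) (Int.natCast_dvd_natCast.mp h)
      omega
    have h1 := wronskian_thetaSeries_gamma0 hb hI hN hdet hc hp hp2 hpN' hpd
      (fun j => isThetaWeight_quadEval hb (hH j)) hz
    rw [(harmonicDim_weight n).1, ← Int.cast_pow,
      chi_four_pow (Nat.odd_iff.mp (hp.odd_of_ne_two hp2))] at h1
    -- The prime is congruent to d only modulo c; χ₄ sees this because n odd forces 4 ∣ N ∣ c.
    have h2 : thetaCharacter n p = thetaCharacter n d := by
      rw [thetaCharacter, thetaCharacter]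
      split_ifs with hn
      · have h4 : (4 : ℤ) ∣ c := by
          have := four_dvd_of_odd hb hI hN0 hN ((harmonicDim_parity n).2 hn).2
          exact (Int.natCast_dvd_natCast.mpr this).trans hc
        congr 1
        exact (ZMod.intCast_eq_intCast_iff _ _ 4).mpr (hpd.of_dvd h4)
      · rfl
    rw [h2] at h1
    exact h1

end

/-! ### Modularity of `det²` -/

section

variable {n : ℕ} {Λ : Submodule ℤ (EuclideanSpace ℝ (Fin n))} [DiscreteTopology Λ] [IsZLattice ℝ Λ]

theorem exists_lattice_basis (Λ : Submodule ℤ (EuclideanSpace ℝ (Fin n))) [DiscreteTopology Λ]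
    [IsZLattice ℝ Λ] : Nonempty (Module.Basis (Fin n) ℤ Λ) := by
  have := ZLattice.module_free ℝ Λ
  have := ZLattice.module_finite ℝ Λ
  refine ⟨Module.finBasisOfFinrankEq ℤ Λ ?_⟩
  rw [ZLattice.rank ℝ Λ, finrank_euclideanSpace_fin]

theorem IsIntegralLattice.isIntegralBasis (h : IsIntegralLattice Λ)
    (b : Module.Basis (Fin n) ℤ Λ) : IsIntegralBasis (b.ofZLatticeBasis ℝ Λ) := fun v => by
  rw [latVec_ofZLatticeBasis]
  exact h _ (b.equivFun.symm v).2

theorem IsLevel.hasLevelDividing {N : ℕ} (h : IsLevel Λ N) (b : Module.Basis (Fin n) ℤ Λ)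
    {b' : Module.Basis (Fin n) ℝ (EuclideanSpace ℝ (Fin n))}
    (hb : IsPolarDual (b.ofZLatticeBasis ℝ Λ) b') : HasLevelDividing b' N := fun k => by
  refine h.1.2 _ fun v hv => ⟨∑ i, k i * b.equivFun ⟨v, hv⟩ i, ?_⟩
  rw [← hb.inner_latVec_latVec, latVec_ofZLatticeBasis, LinearEquiv.symm_apply_apply,
    real_inner_comm]

theorem detSqDTheta_eq_wronskian (b : Module.Basis (Fin n) ℤ Λ)
    {H : Fin (harmonicDim n) → Matrix (Fin n) (Fin n) ℝ}
    (hH : harmonicONB n = fun i => quadPoly (H i)) (z : ℍ) :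
    detSqDTheta Λ z = (∏ k : Fin (harmonicDim n), (2 * Real.pi * Complex.I)⁻¹ ^ (k : ℕ)) ^ 2 *
        wronskian (fun j => quadTheta (b.ofZLatticeBasis ℝ Λ) (H j)) z ^ 2 := by
  rw [detSqDTheta, hH, detDTheta_quadPoly b, mul_pow]

theorem detSqDTheta_slash_apply (γ : SL(2, ℤ)) (z : ℍ) (b : Module.Basis (Fin n) ℤ Λ)
    {H : Fin (harmonicDim n) → Matrix (Fin n) (Fin n) ℝ}
    (hH : harmonicONB n = fun i => quadPoly (H i)) :
    (detSqDTheta Λ ∣[((n : ℤ) + 2) ^ 2 * n * (n - 1) / 2] γ) z =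
      (∏ k : Fin (harmonicDim n), (2 * Real.pi * Complex.I)⁻¹ ^ (k : ℕ)) ^ 2 *
      (wronskian (fun j => quadTheta (b.ofZLatticeBasis ℝ Λ) (H j))
        ((γ 0 0 * z + γ 0 1) / (γ 1 0 * z + γ 1 1)) ^ 2 *
        ((γ 1 0 * z + γ 1 1 : ℂ) ^ (n * harmonicDim n * (n + 2)))⁻¹) := by
  rw [ModularForm.SL_slash_apply, detSqDTheta_eq_wronskian b hH, (harmonicDim_weight n).2,
    zpow_neg, zpow_natCast, ModularGroup.denom_apply,
    UpperHalfPlane.coe_specialLinearGroup_apply, mul_assoc]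
  simp

theorem det_entries_eq (γ : SL(2, ℤ)) : γ 0 0 * γ 1 1 - γ 0 1 * γ 1 0 = 1 := by
  rw [← Matrix.det_fin_two]
  exact γ.2

theorem denom_entries_ne_zero (γ : SL(2, ℤ)) (z : ℍ) : (γ 1 0 * z + γ 1 1 : ℂ) ≠ 0 := by
  refine denom_ne_zero_of_im_pos ?_ z.2
  by_contra! h
  have := det_entries_eq γ
  rw [h.1, h.2] at this
  simp at this

theorem detSqDTheta_slash_gamma0 {N : ℕ} (hΛ : IsIntegralLattice Λ) (hN : IsLevel Λ N)
    {γ : SL(2, ℤ)} (hγ : γ ∈ CongruenceSubgroup.Gamma0 N) :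
    detSqDTheta Λ ∣[((n : ℤ) + 2) ^ 2 * n * (n - 1) / 2] γ =
      (thetaCharacter n (γ 1 1) : ℂ) • detSqDTheta Λ := by
  obtain ⟨b⟩ := exists_lattice_basis Λ
  obtain ⟨b', hb⟩ := exists_isPolarDual (b.ofZLatticeBasis ℝ Λ)
  obtain ⟨H, hH, hh⟩ := exists_isTracelessONB n
  have hc : (N : ℤ) ∣ γ 1 0 := by
    rw [CongruenceSubgroup.Gamma0_mem] at hγ
    exact (ZMod.intCast_zmod_eq_zero_iff_dvd _ _).mp hγ
  funext z
  rw [detSqDTheta_slash_apply γ z b hh, wronskian_quadTheta_gamma0 hb (hΛ.isIntegralBasis b)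
    hN.1.1.ne' (hN.hasLevelDividing b hb) (det_entries_eq γ) hc hH.trace_eq_zero z.2,
    Pi.smul_apply, detSqDTheta_eq_wronskian b hh, smul_eq_mul]
  have := pow_ne_zero (n * harmonicDim n * (n + 2)) (denom_entries_ne_zero γ z)
  field_simp

theorem isBoundedAtImInfty_detSqDTheta_slash (hΛ : IsIntegralLattice Λ) (γ : SL(2, ℤ)) :
    UpperHalfPlane.IsBoundedAtImInfty
      (detSqDTheta Λ ∣[((n : ℤ) + 2) ^ 2 * n * (n - 1) / 2] γ) := by
  obtain ⟨b⟩ := exists_lattice_basis Λ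
  obtain ⟨b', hb⟩ := exists_isPolarDual (b.ofZLatticeBasis ℝ Λ)
  obtain ⟨H, hH, hh⟩ := exists_isTracelessONB n
  have hI := hΛ.isIntegralBasis b
  rw [UpperHalfPlane.isBoundedAtImInfty_iff]
  obtain ⟨M, hM⟩ : ∃ M : ℝ, ∀ z : ℂ, 1 ≤ z.im →
      ‖wronskian (fun j => quadTheta (b.ofZLatticeBasis ℝ Λ) (H j))
        ((γ 0 0 * z + γ 0 1) / (γ 1 0 * z + γ 1 1)) ^ 2‖ ≤
        M * ‖(γ 1 0 * z + γ 1 1 : ℂ) ^ (n * harmonicDim n * (n + 2))‖ := by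
    have hdet := det_entries_eq γ
    by_cases hc : γ 1 0 = 0
    · obtain ⟨M, hM⟩ := exists_bound_wronskian_thetaSeries
        (fun j => isTempered_quadEval (b.ofZLatticeBasis ℝ Λ) (H j))
      refine ⟨M ^ 2, fun z hz => ?_⟩
      rw [hc, mul_zero, sub_zero] at hdet
      have hn : ‖((γ 1 1 : ℤ) : ℂ)‖ = 1 := by
        rcases Int.eq_one_or_neg_one_of_mul_eq_one' hdet with ⟨-, h⟩ | ⟨-, h⟩ <;> simp [h]
      have hre : ((γ 0 0 * z + γ 0 1) / (γ 1 1) : ℂ) = z + ((γ 0 1 * γ 0 0 : ℤ) : ℂ) := by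
        have hdet' : (γ 0 0 * γ 1 1 : ℂ) = 1 := by exact_mod_cast hdet
        have hd : (γ 1 1 : ℂ) ≠ 0 := right_ne_zero_of_mul_eq_one hdet'
        have hsq : (γ 0 0 : ℂ) = γ 1 1 := by
          rcases Int.eq_one_or_neg_one_of_mul_eq_one' hdet with ⟨h1, h2⟩ | ⟨h1, h2⟩ <;>
            rw [h1, h2]
        rw [div_eq_iff hd]
        push_cast
        linear_combination z * hsq - γ 0 1 * hdet'
      rw [hc, Int.cast_zero, zero_mul, zero_add, norm_pow _ (n * harmonicDim n * (n + 2)), hn,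
        one_pow, mul_one, norm_pow, hre]
      gcongr
      exact hM _ (by simpa using hz)
    · obtain ⟨M, hM⟩ := exists_bound_wronskian_moebius hI hc hdet
        (fun j => isThetaWeight_quadEval hb (hH.trace_eq_zero j))
      rw [(harmonicDim_weight n).1] at hM
      exact ⟨M, hM⟩
  refine ⟨‖(∏ k : Fin (harmonicDim n), (2 * Real.pi * Complex.I)⁻¹ ^ (k : ℕ)) ^ 2‖ * M, 1,
    fun z hz => ?_⟩
  rw [detSqDTheta_slash_apply γ z b hh, norm_mul, norm_mul _ (_⁻¹), norm_inv]
  gcongr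
  rw [← div_eq_mul_inv, div_le_iff₀]
  · exact hM z hz
  · exact norm_pos_iff.mpr (pow_ne_zero _ (denom_entries_ne_zero γ z))

theorem mdifferentiable_detSqDTheta (Λ : Submodule ℤ (EuclideanSpace ℝ (Fin n)))
    [DiscreteTopology Λ] [IsZLattice ℝ Λ] :
    MDifferentiable (modelWithCornersSelf ℂ ℂ) (modelWithCornersSelf ℂ ℂ) (detSqDTheta Λ) := by
  obtain ⟨b⟩ := exists_lattice_basis Λ
  obtain ⟨H, hH, hh⟩ := exists_isTracelessONB n
  rw [UpperHalfPlane.mdifferentiable_iff]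
  have h1 : DifferentiableOn ℂ (wronskian fun j => quadTheta (b.ofZLatticeBasis ℝ Λ) (H j))
      {z | 0 < z.im} := by
    have : (wronskian fun j => quadTheta (b.ofZLatticeBasis ℝ Λ) (H j)) = fun z =>
        ∑ σ : Equiv.Perm (Fin (harmonicDim n)), ((Equiv.Perm.sign σ : ℤ) : ℂ) *
          ∏ i, iteratedDeriv (σ i) (quadTheta (b.ofZLatticeBasis ℝ Λ) (H i)) z := by
      funext z
      rw [wronskian, Matrix.det_apply']
      rfl
    rw [this]
    refine DifferentiableOn.fun_sum fun σ _ => DifferentiableOn.const_mul ?_ _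
    exact DifferentiableOn.fun_finsetProd fun i _ =>
      differentiableOn_iteratedDeriv isOpen_im_pos (differentiableOn_quadTheta _ _) _
  refine ((h1.pow 2).const_mul ((∏ k : Fin (harmonicDim n),
    (2 * Real.pi * Complex.I)⁻¹ ^ (k : ℕ)) ^ 2)).congr fun z hz => ?_
  rw [Function.comp_apply, detSqDTheta_eq_wronskian b hh,
    UpperHalfPlane.ofComplex_apply_of_im_pos hz]
  rfl

/-- For a subgroup of finite index all cusps are SL₂(ℤ)-translates of infinity, so boundedness of
every slash translate gives holomorphy at all of them. -/
theorem exists_modularForm_detSqDTheta (hΛ : IsIntegralLattice Λ) (Γ : Subgroup SL(2, ℤ))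
    [Γ.FiniteIndex] (hΓ : ∀ γ ∈ Γ, detSqDTheta Λ ∣[((n : ℤ) + 2) ^ 2 * n * (n - 1) / 2] γ =
      detSqDTheta Λ) :
    ∃ f : ModularForm (Γ.map (Matrix.SpecialLinearGroup.mapGL ℝ))
      (((n : ℤ) + 2) ^ 2 * n * (n - 1) / 2), ⇑f = detSqDTheta Λ := by
  refine ⟨{ toFun := detSqDTheta Λ
            slash_action_eq' := ?_
            holo' := mdifferentiable_detSqDTheta Λ
            bdd_at_cusps' := fun {c} hc => ?_ }, rfl⟩
  · rintro _ ⟨γ, hγ, rfl⟩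
    exact hΓ γ hγ
  · rw [Subgroup.IsArithmetic.isCusp_iff_isCusp_SL2Z] at hc
    rw [OnePoint.isBoundedAt_iff_forall_SL2Z hc]
    exact fun γ _ => isBoundedAtImInfty_detSqDTheta_slash hΛ γ

theorem detSqDTheta_modularity {N : ℕ} (hΛ : IsIntegralLattice Λ) (hN : IsLevel Λ N) :
    (n % 4 ≠ 3 →
      ∃ f : ModularForm ((CongruenceSubgroup.Gamma0 N).map (Matrix.SpecialLinearGroup.mapGL ℝ))
          (((n : ℤ) + 2) ^ 2 * n * (n - 1) / 2),
        ⇑f = detSqDTheta Λ) ∧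
    (n % 4 = 3 →
      (∃ f : ModularForm ((CongruenceSubgroup.Gamma1 N).map (Matrix.SpecialLinearGroup.mapGL ℝ))
          (((n : ℤ) + 2) ^ 2 * n * (n - 1) / 2),
        ⇑f = detSqDTheta Λ) ∧
      ∀ γ ∈ CongruenceSubgroup.Gamma0 N,
        detSqDTheta Λ ∣[((n : ℤ) + 2) ^ 2 * n * (n - 1) / 2] γ =
          ((ZMod.χ₄ (γ 1 1 : ZMod 4) : ℤ) : ℂ) • detSqDTheta Λ) := by
  have : NeZero N := ⟨hN.1.1.ne'⟩
  refine ⟨fun hn => ?_, fun hn => ?_⟩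
  · refine exists_modularForm_detSqDTheta hΛ _ fun γ hγ => ?_
    rw [detSqDTheta_slash_gamma0 hΛ hN hγ, thetaCharacter, if_neg hn, Int.cast_one, one_smul]
  · have h0 : ∀ γ ∈ CongruenceSubgroup.Gamma0 N,
        detSqDTheta Λ ∣[((n : ℤ) + 2) ^ 2 * n * (n - 1) / 2] γ =
          ((ZMod.χ₄ (γ 1 1 : ZMod 4) : ℤ) : ℂ) • detSqDTheta Λ := fun γ hγ => by
      rw [detSqDTheta_slash_gamma0 hΛ hN hγ, thetaCharacter, if_pos hn]
    refine ⟨exists_modularForm_detSqDTheta hΛ _ fun γ hγ => ?_, h0⟩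
    obtain ⟨b⟩ := exists_lattice_basis Λ
    obtain ⟨b', hb⟩ := exists_isPolarDual (b.ofZLatticeBasis ℝ Λ)
    rw [h0 γ (CongruenceSubgroup.Gamma1_in_Gamma0 N hγ)]
    rw [CongruenceSubgroup.Gamma1_mem] at hγ
    -- Since 4 ∣ N, lower right entries ≡ 1 mod N are ≡ 1 mod 4, so the character is trivial on
    -- Γ₁(N).
    have h4 : 4 ∣ N := four_dvd_of_odd hb (hΛ.isIntegralBasis b) hN.1.1.ne'
      (hN.hasLevelDividing b hb) ((harmonicDim_parity n).2 hn).2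
    have h1 : ((γ 1 1 : ℤ) : ZMod 4) = 1 := by
      have h2 := congrArg (ZMod.castHom h4 (ZMod 4)) hγ.2.1
      rwa [map_intCast, map_one] at h2
    rw [h1]
    simp

end

/-! ### Degeneracy of the theta map -/

section

variable {n : ℕ} {b b' : Module.Basis (Fin n) ℝ (EuclideanSpace ℝ (Fin n))}

theorem abs_quadEval_le (H : Matrix (Fin n) (Fin n) ℝ) (x : EuclideanSpace ℝ (Fin n)) :
    |quadEval H x| ≤ (∑ i, ∑ j, |H i j|) * ‖x‖ ^ 2 := by
  rw [quadEval, Finset.sum_mul]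
  refine (Finset.abs_sum_le_sum_abs _ _).trans (Finset.sum_le_sum fun i _ => ?_)
  rw [Finset.sum_mul]
  refine (Finset.abs_sum_le_sum_abs _ _).trans (Finset.sum_le_sum fun j _ => ?_)
  have h1 : ∀ i, |x i| ≤ ‖x‖ := fun i => by simpa using PiLp.norm_apply_le x i
  rw [abs_mul, abs_mul, sq]
  exact mul_le_mul_of_nonneg_left (mul_le_mul (h1 i) (h1 j) (abs_nonneg _) (norm_nonneg _))
    (abs_nonneg _)

/-- Only the zero vector survives as y → ∞; the terms at y = 1 dominate. -/
theorem tendsto_tsum_gaussian (b : Module.Basis (Fin n) ℝ (EuclideanSpace ℝ (Fin n))) :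
    Filter.Tendsto (fun y : ℝ => ∑' v, Real.exp (-(2 * Real.pi * y) * ‖latVec b v‖ ^ 2))
      Filter.atTop (nhds 1) := by
  classical
  have hs := summable_exp_neg_normSq_latVec b (δ := 2 * Real.pi) (by positivity)
  have h1 := tendsto_tsum_of_dominated_convergence (𝓕 := Filter.atTop)
    (f := fun (y : ℝ) v => Real.exp (-(2 * Real.pi * y) * ‖latVec b v‖ ^ 2))
    (g := fun v => if v = 0 then (1 : ℝ) else 0) hs (fun v => ?_) ?_
  · simpa using h1
  · by_cases hv : v = 0
    · subst hv
      simp [latVec_zero]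
    · have h2 : 0 < ‖latVec b v‖ ^ 2 := by
        have : latVec b v ≠ 0 := fun h => hv (latVec_injective b (h.trans (latVec_zero b).symm))
        positivity
      simp only [hv, if_false]
      refine Real.tendsto_exp_atBot.comp ?_
      simp only [neg_mul]
      refine Filter.tendsto_neg_atTop_atBot.comp ?_
      refine Filter.Tendsto.atTop_mul_const h2 ?_
      exact Filter.tendsto_id.const_mul_atTop (by positivity)
  · filter_upwards [Filter.eventually_ge_atTop 1] with y hy v
    rw [Real.norm_eq_abs, abs_of_pos (Real.exp_pos _), Real.exp_le_exp]
    have h3 : 2 * Real.pi ≤ 2 * Real.pi * y := le_mul_of_one_le_right (by positivity) hy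
    exact mul_le_mul_of_nonneg_right (neg_le_neg h3) (sq_nonneg _)

/-- The form vanishes at the origin, and elsewhere the factor y is harmless because y‖λ‖² ≤
exp(y‖λ‖²) and the Gaussian has decay to spare. -/
theorem tendsto_tsum_quadEval_gaussian
    (b : Module.Basis (Fin n) ℝ (EuclideanSpace ℝ (Fin n))) (H : Matrix (Fin n) (Fin n) ℝ) :
    Filter.Tendsto (fun y : ℝ => ∑' v, y * (quadEval H (latVec b v) *
      Real.exp (-(2 * Real.pi * y) * ‖latVec b v‖ ^ 2))) Filter.atTop (nhds 0) := by
  let S := ∑ i, ∑ j, |H i j|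
  have hS : 0 ≤ S := Finset.sum_nonneg fun i _ => Finset.sum_nonneg fun j _ => abs_nonneg _
  have hle : ∀ y : ℝ, 0 ≤ y → ∀ v, ‖y * (quadEval H (latVec b v) *
      Real.exp (-(2 * Real.pi * y) * ‖latVec b v‖ ^ 2))‖ ≤
      S * Real.exp (-y * ‖latVec b v‖ ^ 2) := by
    intro y hy v
    rw [norm_mul, norm_mul, Real.norm_eq_abs, Real.norm_eq_abs, Real.norm_eq_abs,
      abs_of_nonneg hy, abs_of_pos (Real.exp_pos _)]
    have h1 := abs_quadEval_le H (latVec b v)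
    set r := ‖latVec b v‖ ^ 2
    have hr : 0 ≤ r := sq_nonneg _
    have h2 : y * r ≤ Real.exp (y * r) := by linarith [Real.add_one_le_exp (y * r)]
    have h3 : Real.exp (-(2 * Real.pi * y) * r) ≤ Real.exp (-(2 * y) * r) := by
      rw [Real.exp_le_exp]
      have : 1 ≤ Real.pi := by linarith [Real.pi_gt_three]
      nlinarith [mul_nonneg hy hr]
    calc y * (|quadEval H (latVec b v)| * Real.exp (-(2 * Real.pi * y) * r))
        ≤ y * ((S * r) * Real.exp (-(2 * y) * r)) := by gcongr
      _ = S * ((y * r) * Real.exp (-(2 * y) * r)) := by ring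
      _ ≤ S * (Real.exp (y * r) * Real.exp (-(2 * y) * r)) := by gcongr
      _ = _ := by
        rw [← Real.exp_add]
        ring_nf
  have hs := (summable_exp_neg_normSq_latVec b one_pos).mul_left S
  have h1 := tendsto_tsum_of_dominated_convergence (𝓕 := Filter.atTop)
    (f := fun (y : ℝ) v => y * (quadEval H (latVec b v) *
      Real.exp (-(2 * Real.pi * y) * ‖latVec b v‖ ^ 2)))
    (g := fun _ => (0 : ℝ)) hs (fun v => ?_) ?_
  · simpa using h1
  · by_cases hv : ‖latVec b v‖ ^ 2 = 0
    · have h2 := abs_quadEval_le H (latVec b v)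
      rw [hv, mul_zero] at h2
      have h3 := abs_eq_zero.mp (le_antisymm h2 (abs_nonneg _))
      simp [h3]
    · have h2 : 0 < ‖latVec b v‖ ^ 2 := lt_of_le_of_ne (sq_nonneg _) (Ne.symm hv)
      refine squeeze_zero_norm' (a := fun y => S * Real.exp (-y * ‖latVec b v‖ ^ 2)) ?_ ?_
      · filter_upwards [Filter.eventually_ge_atTop 0] with y hy
        exact hle y hy v
      · rw [← mul_zero S]
        refine Filter.Tendsto.const_mul _ (Real.tendsto_exp_atBot.comp ?_)
        simp only [neg_mul]
        exact Filter.tendsto_neg_atTop_atBot.comp (Filter.tendsto_id.atTop_mul_const h2)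
  · filter_upwards [Filter.eventually_ge_atTop 1] with y hy v
    refine (hle y (by linarith) v).trans ?_
    refine mul_le_mul_of_nonneg_left (Real.exp_le_exp.mpr ?_) hS
    exact mul_le_mul_of_nonneg_right (neg_le_neg hy) (sq_nonneg _)

/-- If Θ_H = 0, inversion at w = i/y says that tr H · Σ exp(−2πy‖λ'‖²) equals 4πy Σ H(λ')
exp(−2πy‖λ'‖²), both sums over the dual lattice. As y → ∞ the left side tends to tr H and the right
side to 0. -/
theorem trace_eq_zero_of_quadTheta_eq_zero {H : Matrix (Fin n) (Fin n) ℝ}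
    (h : ∀ z : ℂ, 0 < z.im → quadTheta b H z = 0) : H.trace = 0 := by
  obtain ⟨b', hb⟩ := exists_isPolarDual b
  have key : ∀ y : ℝ, 0 < y →
      H.trace * (∑' v, Real.exp (-(2 * Real.pi * y) * ‖latVec b' v‖ ^ 2)) =
      4 * Real.pi * ∑' v, y * (quadEval H (latVec b' v) *
        Real.exp (-(2 * Real.pi * y) * ‖latVec b' v‖ ^ 2)) := by
    intro y hy
    have hyC : (y : ℂ) ≠ 0 := by exact_mod_cast hy.ne'
    have hπ : (Real.pi : ℂ) ≠ 0 := by exact_mod_cast Real.pi_ne_zero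
    let w : ℂ := Complex.I / y
    have hw : 0 < w.im := by
      simp only [w]
      rw [Complex.div_ofReal_im, Complex.I_im]
      positivity
    have hw1 : -1 / w = y * Complex.I := by
      simp only [w]
      field_simp
      simp
    have hexp : ∀ v, Complex.exp (2 * Real.pi * Complex.I * (-1 / w) * (‖latVec b' v‖ ^ 2 : ℝ)) =
        (Real.exp (-(2 * Real.pi * y) * ‖latVec b' v‖ ^ 2) : ℂ) := by
      intro v
      rw [hw1]
      push_cast
      congr 1
      linear_combination 2 * Real.pi * y * (‖latVec b' v‖ : ℂ) ^ 2 * Complex.I_mul_I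
    obtain ⟨-, -, h1⟩ := thetaInversion_quadEval hb hw 0 H
    have h2 := tsum_gaussian hb hw 0
    simp only [add_zero, inner_zero_right, mul_zero, Complex.ofReal_zero, Complex.exp_zero,
      one_mul, hexp] at h1 h2
    have h3 : ∑' v, (quadEval H (latVec b v) : ℂ) *
        Complex.exp (2 * Real.pi * Complex.I * w * (‖latVec b v‖ ^ 2 : ℝ)) = 0 := h w hw
    rw [h2, h3, mul_zero, zero_add] at h1
    have h4 : w * H.trace / (4 * Real.pi * Complex.I) = H.trace / (4 * Real.pi * y) := by
      simp only [w]
      field_simp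
    rw [h4, mul_left_comm] at h1
    have h5 := mul_left_cancel₀ (poissonFactor_ne_zero b hw) h1
    rw [tsum_mul_left]
    apply Complex.ofReal_injective
    push_cast [Complex.ofReal_tsum]
    push_cast at h5
    rw [← h5]
    field_simp
  have h1 := (tendsto_tsum_gaussian b').const_mul H.trace
  have h2 := (tendsto_tsum_quadEval_gaussian b' H).const_mul (4 * Real.pi)
  rw [mul_one] at h1
  rw [mul_zero] at h2
  refine tendsto_nhds_unique h1 (h2.congr' ?_)
  filter_upwards [Filter.eventually_gt_atTop 0] with y hy
  exact (key y hy).symm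

theorem quadTheta_neg_conj (b : Module.Basis (Fin n) ℝ (EuclideanSpace ℝ (Fin n)))
    (H : Matrix (Fin n) (Fin n) ℝ) (z : ℂ) :
    quadTheta b H (-(starRingEnd ℂ) z) = (starRingEnd ℂ) (quadTheta b H z) := by
  rw [quadTheta, thetaSeries, thetaSeries, Complex.conj_tsum]
  refine tsum_congr fun v => ?_
  rw [map_mul, ← Complex.exp_conj, Complex.conj_ofReal]
  congr 2
  simp only [map_mul, Complex.conj_ofReal, Complex.conj_I, map_ofNat]
  ring

/-- The relation found on a small disc extends by the identity theorem. The coefficients of the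
theta series are real, so reflection in the imaginary axis shows that the conjugate coefficients
also give a relation. Hence so do the real and the imaginary parts, and one of these is nonzero. -/
theorem exists_quadTheta_eq_zero_of_wronskian {m : ℕ} {H : Fin m → Matrix (Fin n) (Fin n) ℝ}
    (hW : ∀ z : ℂ, 0 < z.im → wronskian (fun j => quadTheta b (H j)) z = 0) :
    ∃ r : Fin m → ℝ, r ≠ 0 ∧ ∀ z : ℂ, 0 < z.im → quadTheta b (∑ j, r j • H j) z = 0 := by
  have hball : Metric.ball Complex.I 1 ⊆ {z : ℂ | 0 < z.im} := fun z hz => by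
    have h1 : |(z - Complex.I).im| < 1 := (Complex.abs_im_le_norm _).trans_lt (by
      rwa [Metric.mem_ball, dist_eq_norm] at hz)
    rw [Complex.sub_im, Complex.I_im, abs_lt] at h1
    change 0 < z.im
    linarith [h1.1]
  obtain ⟨c, hc, x, r, hr, hsub, hrel⟩ := exists_linear_relation_of_wronskian_eq_zero m
    (fun j => quadTheta b (H j)) Complex.I 1 one_pos
    (fun j => (differentiableOn_quadTheta b (H j)).mono hball) fun z hz => hW z (hball hz)
  have hrel' : ∀ z : ℂ, 0 < z.im → ∑ j, c j * quadTheta b (H j) z = 0 := by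
    have h1 : AnalyticOnNhd ℂ (fun z => ∑ j, c j * quadTheta b (H j) z) {z | 0 < z.im} :=
      (DifferentiableOn.fun_sum fun j _ =>
        (differentiableOn_quadTheta b (H j)).const_mul (c j)).analyticOnNhd isOpen_im_pos
    have h2 := h1.eqOn_zero_of_preconnected_of_eventuallyEq_zero
      (convex_halfSpace_im_gt 0).isPreconnected (hball (hsub (Metric.mem_ball_self hr)))
      (Filter.eventuallyEq_of_mem (Metric.isOpen_ball.mem_nhds (Metric.mem_ball_self hr)) hrel)
    exact fun z hz => h2 hz
  have hconj : ∀ z : ℂ, 0 < z.im → ∑ j, (starRingEnd ℂ) (c j) * quadTheta b (H j) z = 0 := by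
    intro z hz
    have h1 := congrArg (starRingEnd ℂ) (hrel' (-(starRingEnd ℂ) z) (by simpa using hz))
    rw [map_sum, map_zero] at h1
    rw [← h1]
    refine Finset.sum_congr rfl fun j _ => ?_
    rw [map_mul, quadTheta_neg_conj, Complex.conj_conj]
  by_cases hre : (fun j => (c j).re) = 0
  · refine ⟨fun j => (c j).im, fun him => hc (funext fun j => ?_), fun z hz => ?_⟩
    · exact Complex.ext (congrFun hre j) (congrFun him j)
    · rw [quadTheta_sum_smul b _ _ _ hz]
      have h1 : ∀ j, (((c j).im : ℝ) : ℂ) * quadTheta b (H j) z =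
          (2 * Complex.I)⁻¹ * (c j * quadTheta b (H j) z -
            (starRingEnd ℂ) (c j) * quadTheta b (H j) z) := fun j => by
        rw [← sub_mul, Complex.sub_conj]
        field_simp
        push_cast
        ring
      simp only [h1]
      rw [← Finset.mul_sum, Finset.sum_sub_distrib, hrel' z hz, hconj z hz]
      simp
  · refine ⟨fun j => (c j).re, hre, fun z hz => ?_⟩
    rw [quadTheta_sum_smul b _ _ _ hz]
    have h1 : ∀ j, (((c j).re : ℝ) : ℂ) * quadTheta b (H j) z =
        2⁻¹ * (c j * quadTheta b (H j) z +
          (starRingEnd ℂ) (c j) * quadTheta b (H j) z) := fun j => by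
      rw [← add_mul, Complex.add_conj]
      push_cast
      ring
    simp only [h1]
    rw [← Finset.mul_sum, Finset.sum_add_distrib, hrel' z hz, hconj z hz]
    simp

theorem wronskian_eq_zero_of_quadTheta {m : ℕ} {H : Fin m → Matrix (Fin n) (Fin n) ℝ}
    {r : Fin m → ℝ} (hr : r ≠ 0)
    (h : ∀ z : ℂ, 0 < z.im → quadTheta b (∑ j, r j • H j) z = 0) {z : ℂ} (hz : 0 < z.im) :
    wronskian (fun j => quadTheta b (H j)) z = 0 := by
  rw [wronskian, ← Matrix.exists_mulVec_eq_zero_iff]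
  refine ⟨fun j => (r j : ℂ), fun h0 => hr (funext fun j => ?_), funext fun k => ?_⟩
  · exact Complex.ofReal_injective (congrFun h0 j)
  · have hd : ∀ i, ContDiffAt ℂ k (quadTheta b (H i)) z := fun i =>
      ((differentiableOn_quadTheta b (H i)).analyticAt (isOpen_im_pos.mem_nhds hz)).contDiffAt
    have h1 : (fun z => ∑ j, (r j : ℂ) * quadTheta b (H j) z) =ᶠ[nhds z] fun _ => 0 :=
      Filter.eventuallyEq_of_mem (isOpen_im_pos.mem_nhds hz) fun w hw => by
        rw [← quadTheta_sum_smul b _ _ _ hw]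
        exact h w hw
    have h2 := h1.iteratedDeriv_eq k
    rw [iteratedDeriv_fun_sum fun i _ => contDiffAt_const.mul (hd i), iteratedDeriv_const] at h2
    simp only [iteratedDeriv_const_mul_field, ite_self] at h2
    rw [Pi.zero_apply, ← h2, Matrix.mulVec, dotProduct]
    exact Finset.sum_congr rfl fun j _ => by rw [Matrix.of_apply, mul_comm]

end

/-! ### The differential of the theta map -/

section

variable {n : ℕ}

/-- The matrix whose columns are the vectors of a basis. -/
noncomputable def columnMatrix (b : Module.Basis (Fin n) ℝ (EuclideanSpace ℝ (Fin n))) :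
    Matrix (Fin n) (Fin n) ℝ :=
  (EuclideanSpace.basisFun (Fin n) ℝ).toBasis.toMatrix b

theorem columnMatrix_apply (b : Module.Basis (Fin n) ℝ (EuclideanSpace ℝ (Fin n))) (i j : Fin n) :
    columnMatrix b i j = b j i := by
  simp [columnMatrix, Module.Basis.toMatrix_apply]

theorem isUnit_det_columnMatrix (b : Module.Basis (Fin n) ℝ (EuclideanSpace ℝ (Fin n))) :
    IsUnit (columnMatrix b).det := by
  have : Invertible (columnMatrix b) :=
    (EuclideanSpace.basisFun (Fin n) ℝ).toBasis.invertibleToMatrix b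
  exact Matrix.isUnit_det_of_invertible _

theorem latVec_apply (b : Module.Basis (Fin n) ℝ (EuclideanSpace ℝ (Fin n))) (v : Fin n → ℤ)
    (i : Fin n) : latVec b v i = (columnMatrix b).mulVec (fun j => (v j : ℝ)) i := by
  simp [latVec, Matrix.mulVec, dotProduct, columnMatrix_apply, mul_comm]

theorem quadEval_latVec (b : Module.Basis (Fin n) ℝ (EuclideanSpace ℝ (Fin n)))
    (H : Matrix (Fin n) (Fin n) ℝ) (v : Fin n → ℤ) :
    quadEval H (latVec b v) = dotProduct (fun i => (v i : ℝ))
      (((columnMatrix b).transpose * H * columnMatrix b).mulVec fun i => (v i : ℝ)) := by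
  have h2 : (fun i => latVec b v i) = (columnMatrix b).mulVec fun i => (v i : ℝ) :=
    funext fun i => latVec_apply b v i
  rw [quadEval_eq_dotProduct, h2, ← Matrix.mulVec_mulVec, ← Matrix.mulVec_mulVec,
    Matrix.dotProduct_mulVec _ (columnMatrix b).transpose, Matrix.vecMul_transpose]

theorem quadEval_one (x : EuclideanSpace ℝ (Fin n)) :
    quadEval (1 : Matrix (Fin n) (Fin n) ℝ) x = ‖x‖ ^ 2 := by
  rw [quadEval_eq_dotProduct, Matrix.one_mulVec, EuclideanSpace.norm_sq_eq]
  simp [dotProduct, sq]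

variable {Λ : Submodule ℤ (EuclideanSpace ℝ (Fin n))} [DiscreteTopology Λ] [IsZLattice ℝ Λ]

theorem latticeGram_eq (b : Module.Basis (Fin n) ℤ Λ) :
    latticeGram b = (columnMatrix (b.ofZLatticeBasis ℝ Λ)).transpose *
      columnMatrix (b.ofZLatticeBasis ℝ Λ) := by
  ext i j
  rw [latticeGram, Matrix.gram_apply, Matrix.mul_apply, PiLp.inner_apply]
  refine Finset.sum_congr rfl fun k _ => ?_
  rw [Matrix.transpose_apply, columnMatrix_apply, columnMatrix_apply,
    Module.Basis.ofZLatticeBasis_apply, Module.Basis.ofZLatticeBasis_apply]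
  simp [mul_comm]

/-- The matrix in orthonormal coordinates of the quadratic form with matrix `B` in the
coordinates of the lattice basis `b`. -/
noncomputable def coordinateForm (b : Module.Basis (Fin n) ℤ Λ) (B : Matrix (Fin n) (Fin n) ℝ) :
    Matrix (Fin n) (Fin n) ℝ :=
  (columnMatrix (b.ofZLatticeBasis ℝ Λ))⁻¹.transpose * B * (columnMatrix (b.ofZLatticeBasis ℝ Λ))⁻¹

theorem transpose_mul_coordinateForm_mul (b : Module.Basis (Fin n) ℤ Λ)
    (B : Matrix (Fin n) (Fin n) ℝ) :
    (columnMatrix (b.ofZLatticeBasis ℝ Λ)).transpose * coordinateForm b B *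
      columnMatrix (b.ofZLatticeBasis ℝ Λ) = B := by
  have h := isUnit_det_columnMatrix (b.ofZLatticeBasis ℝ Λ)
  set P := columnMatrix (b.ofZLatticeBasis ℝ Λ)
  calc _ = (P⁻¹ * P).transpose * B * (P⁻¹ * P) := by
        rw [Matrix.transpose_mul, coordinateForm]
        simp only [Matrix.mul_assoc, P]
    _ = B := by rw [Matrix.nonsing_inv_mul _ h, Matrix.transpose_one, Matrix.one_mul, Matrix.mul_one]

theorem coordinateForm_transpose_mul_mul (b : Module.Basis (Fin n) ℤ Λ)
    (H : Matrix (Fin n) (Fin n) ℝ) :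
    coordinateForm b ((columnMatrix (b.ofZLatticeBasis ℝ Λ)).transpose * H *
      columnMatrix (b.ofZLatticeBasis ℝ Λ)) = H := by
  have h := isUnit_det_columnMatrix (b.ofZLatticeBasis ℝ Λ)
  rw [coordinateForm]
  set P := columnMatrix (b.ofZLatticeBasis ℝ Λ)
  calc _ = (P * P⁻¹).transpose * H * (P * P⁻¹) := by
        rw [Matrix.transpose_mul]
        simp only [Matrix.mul_assoc]
    _ = H := by rw [Matrix.mul_nonsing_inv _ h, Matrix.transpose_one, Matrix.one_mul, Matrix.mul_one]

theorem trace_coordinateForm (b : Module.Basis (Fin n) ℤ Λ) (B : Matrix (Fin n) (Fin n) ℝ) :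
    (coordinateForm b B).trace = ((latticeGram b)⁻¹ * B).trace := by
  rw [latticeGram_eq, Matrix.mul_inv_rev, coordinateForm, Matrix.trace_mul_comm,
    ← Matrix.mul_assoc, Matrix.transpose_nonsing_inv]

theorem isSymm_transpose_mul_mul {B : Matrix (Fin n) (Fin n) ℝ} (hB : B.IsSymm)
    (Q : Matrix (Fin n) (Fin n) ℝ) : (Q.transpose * B * Q).IsSymm := by
  rw [Matrix.IsSymm, Matrix.transpose_mul, Matrix.transpose_mul, Matrix.transpose_transpose,
    hB.eq, Matrix.mul_assoc]

/-- The form A + tB takes the value ‖λ‖² + tH(λ) at a lattice vector, so t enters linearly in the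
exponent and the series can be differentiated termwise. Neither symmetry of `B` nor positivity of A
+ tB is assumed: small t is enough. -/
theorem hasLineDerivAt_thetaMap (b : Module.Basis (Fin n) ℤ Λ) (B : Matrix (Fin n) (Fin n) ℝ)
    (z : ℍ) : HasLineDerivAt ℝ (fun A => thetaMap A z)
      (2 * Real.pi * Complex.I * z *
        quadTheta (b.ofZLatticeBasis ℝ Λ) (coordinateForm b B) z) (latticeGram b) B := by
  let e := b.ofZLatticeBasis ℝ Λ
  let H := coordinateForm b B
  let S := ∑ i, ∑ j, |H i j|
  have hS : 0 ≤ S := Finset.sum_nonneg fun i _ => Finset.sum_nonneg fun j _ => abs_nonneg _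
  have hz : 0 < (z : ℂ).im := z.2
  let a : (Fin n → ℤ) → ℂ := fun v =>
    Complex.exp (2 * Real.pi * Complex.I * z * (‖latVec e v‖ ^ 2 : ℝ))
  let β : (Fin n → ℤ) → ℂ := fun v => 2 * Real.pi * Complex.I * z * (quadEval H (latVec e v) : ℂ)
  -- Chosen so that the perturbation uses up at most half of the Gaussian decay; the added 1 keeps
  -- the denominator positive when H = 0.
  let R : ℝ := (z : ℂ).im / (2 * (‖(z : ℂ)‖ * S + 1))
  have hR : 0 < R := by positivity
  have hsum : Summable fun v => ‖a v‖ * Real.exp (R * ‖β v‖) := by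
    refine Summable.of_nonneg_of_le (fun v => by positivity) (fun v => ?_)
      (summable_exp_neg_normSq_latVec e (δ := Real.pi * (z : ℂ).im) (by positivity))
    simp only [a, β]
    rw [norm_cexp_gaussian, ← Real.exp_add, Real.exp_le_exp]
    have h1 := abs_quadEval_le H (latVec e v)
    have h2 : ‖2 * Real.pi * Complex.I * z * (quadEval H (latVec e v) : ℂ)‖ ≤
        2 * Real.pi * (‖(z : ℂ)‖ * S + 1) * ‖latVec e v‖ ^ 2 := by
      rw [norm_mul, norm_mul, norm_mul, norm_mul, Complex.norm_I, Complex.norm_real,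
        Complex.norm_real, Complex.norm_ofNat, Real.norm_eq_abs, Real.norm_eq_abs,
        abs_of_pos Real.pi_pos, mul_one]
      calc 2 * Real.pi * ‖(z : ℂ)‖ * |quadEval H (latVec e v)|
          ≤ 2 * Real.pi * ‖(z : ℂ)‖ * (S * ‖latVec e v‖ ^ 2) := by gcongr
        _ = 2 * Real.pi * (‖(z : ℂ)‖ * S) * ‖latVec e v‖ ^ 2 := by ring
        _ ≤ _ := by
          gcongr
          linarith
    have h3 : R * (2 * Real.pi * (‖(z : ℂ)‖ * S + 1) * ‖latVec e v‖ ^ 2) =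
        Real.pi * (z : ℂ).im * ‖latVec e v‖ ^ 2 := by
      have : ‖(z : ℂ)‖ * S + 1 ≠ 0 := by positivity
      simp only [R]
      field_simp
    have h4 := mul_le_mul_of_nonneg_left h2 hR.le
    rw [h3] at h4
    linarith
  have h1 := (hasDerivAt_tsum_cexp hsum (t := ((0 : ℝ) : ℂ)) (by simpa using hR)).comp_ofReal
  have h2 : (fun t : ℝ => ∑' v, a v * Complex.exp (t * β v)) =
      fun t : ℝ => thetaMap (latticeGram b + t • B) z := by
    funext t
    refine tsum_congr fun v => ?_
    have h3 : dotProduct (fun i => (v i : ℝ))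
        ((latticeGram b + t • B).mulVec fun i => (v i : ℝ)) =
        ‖latVec e v‖ ^ 2 + t * quadEval H (latVec e v) := by
      rw [Matrix.add_mulVec, dotProduct_add, Matrix.smul_mulVec, dotProduct_smul, smul_eq_mul,
        quadEval_latVec, transpose_mul_coordinateForm_mul, ← quadEval_one, quadEval_latVec,
        Matrix.mul_one, latticeGram_eq]
    rw [h3, ← Complex.exp_add]
    congr 1
    simp only [β]
    push_cast
    ring
  rw [h2] at h1
  refine HasDerivAt.congr_deriv (f := fun t : ℝ => thetaMap (latticeGram b + t • B) z) h1 ?_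
  rw [quadTheta, thetaSeries, ← tsum_mul_left]
  refine tsum_congr fun v => ?_
  simp only [a, β, e, H, Complex.ofReal_zero, zero_mul, Complex.exp_zero, mul_one]
  ring

theorem thetaDifferential_eq_zero_iff (b : Module.Basis (Fin n) ℤ Λ)
    (B : Matrix (Fin n) (Fin n) ℝ) :
    thetaDifferential (latticeGram b) B = 0 ↔
      ∀ z : ℂ, 0 < z.im → quadTheta (b.ofZLatticeBasis ℝ Λ) (coordinateForm b B) z = 0 := by
  have h1 : ∀ z, thetaDifferential (latticeGram b) B z = 2 * Real.pi * Complex.I * z *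
      quadTheta (b.ofZLatticeBasis ℝ Λ) (coordinateForm b B) z := fun z =>
    (hasLineDerivAt_thetaMap b B z).lineDeriv
  have h2 : ∀ z : ℍ, (2 * Real.pi * Complex.I * z : ℂ) ≠ 0 := fun z =>
    mul_ne_zero (by simp [Real.pi_ne_zero]) z.ne_zero
  constructor
  · intro h z hz
    have h3 := congrFun h ⟨z, hz⟩
    rw [h1] at h3
    exact (mul_eq_zero.mp h3).resolve_left (h2 _)
  · intro h
    funext z
    rw [h1, h z z.2, mul_zero]
    rfl

/-- The traceless symmetric matrices are the real combinations of the basis, and a combination is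
nonzero when some coefficient is, since pairing recovers the coefficients. So linear dependence of
the theta series is the vanishing of one Θ_K. -/
theorem detSqDTheta_eq_zero_iff_quadTheta (b : Module.Basis (Fin n) ℤ Λ) :
    detSqDTheta Λ = 0 ↔ ∃ K : Matrix (Fin n) (Fin n) ℝ, K.IsSymm ∧ K.trace = 0 ∧ K ≠ 0 ∧
      ∀ z : ℂ, 0 < z.im → quadTheta (b.ofZLatticeBasis ℝ Λ) K z = 0 := by
  obtain ⟨H, hH, hh⟩ := exists_isTracelessONB n
  have hpair : ∀ (r : Fin (harmonicDim n) → ℝ) (i), 2 * (H i * ∑ j, r j • H j).trace = r i := by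
    intro r i
    rw [Matrix.mul_sum, Matrix.trace_sum, Finset.mul_sum]
    simp only [Matrix.mul_smul, Matrix.trace_smul, smul_eq_mul, mul_left_comm (2 : ℝ),
      hH.pairing_eq]
    simp
  constructor
  · intro h
    have hW : ∀ z : ℂ, 0 < z.im →
        wronskian (fun j => quadTheta (b.ofZLatticeBasis ℝ Λ) (H j)) z = 0 := by
      intro z hz
      have h1 := congrFun h ⟨z, hz⟩
      rw [detSqDTheta_eq_wronskian b hh, ← mul_pow] at h1
      refine (mul_eq_zero.mp (pow_eq_zero_iff two_ne_zero |>.mp h1)).resolve_left ?_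
      exact Finset.prod_ne_zero_iff.mpr fun k _ => pow_ne_zero _ (inv_ne_zero
        (by simp [Real.pi_ne_zero]))
    obtain ⟨r, hr, hr0⟩ := exists_quadTheta_eq_zero_of_wronskian hW
    refine ⟨∑ j, r j • H j, ?_, ?_, fun h0 => hr (funext fun i => ?_), hr0⟩
    · ext i j
      simp only [Matrix.transpose_apply, Matrix.sum_apply, Matrix.smul_apply]
      exact Finset.sum_congr rfl fun s _ => by rw [(hH.isSymm s).apply i j]
    · simp [Matrix.trace_sum, Matrix.trace_smul, hH.trace_eq_zero]
    · rw [← hpair r i, h0]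
      simp
  · rintro ⟨K, hK, hK0, hKne, hKz⟩
    have hexp := hH.expansion K hK hK0
    funext z
    rw [detSqDTheta_eq_wronskian b hh,
      wronskian_eq_zero_of_quadTheta (r := fun i => 2 * (H i * K).trace) ?_ ?_ z.2]
    · simp
    · intro h0
      refine hKne ?_
      rw [← hexp]
      exact Finset.sum_eq_zero fun i _ => by rw [show 2 * (H i * K).trace = 0 from congrFun h0 i,
        zero_smul]
    · rw [hexp]
      exact hKz

theorem detSqDTheta_eq_zero_iff_tangentZero (b : Module.Basis (Fin n) ℤ Λ) :
    detSqDTheta Λ = 0 ↔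
      ∃ B ∈ tangentZero (latticeGram b), B ≠ 0 ∧ thetaDifferential (latticeGram b) B = 0 := by
  rw [detSqDTheta_eq_zero_iff_quadTheta b]
  constructor
  · rintro ⟨K, hK, hK0, hKne, hKz⟩
    have h1 := coordinateForm_transpose_mul_mul b K
    refine ⟨_, ⟨isSymm_transpose_mul_mul hK _, ?_⟩, fun h0 => hKne ?_,
      (thetaDifferential_eq_zero_iff b _).mpr (h1 ▸ hKz)⟩
    · rw [← trace_coordinateForm, h1, hK0]
    · rw [← h1, h0]
      simp [coordinateForm]
  · rintro ⟨B, ⟨hB, hB0⟩, hBne, hBz⟩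
    refine ⟨coordinateForm b B, isSymm_transpose_mul_mul hB _, ?_, fun h0 => hBne ?_,
      (thetaDifferential_eq_zero_iff b B).mp hBz⟩
    · rw [trace_coordinateForm, hB0]
    · rw [← transpose_mul_coordinateForm_mul b B, h0]
      simp

/-- The trace condition is automatic: a direction annihilated by the differential has Θ_K = 0, which
forces tr K = 0. -/
theorem detSqDTheta_eq_zero_iff_isSymm (b : Module.Basis (Fin n) ℤ Λ) :
    detSqDTheta Λ = 0 ↔
      ∃ B : Matrix (Fin n) (Fin n) ℝ, B.IsSymm ∧ B ≠ 0 ∧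
        thetaDifferential (latticeGram b) B = 0 := by
  rw [detSqDTheta_eq_zero_iff_tangentZero b]
  constructor
  · rintro ⟨B, ⟨hB, -⟩, h⟩
    exact ⟨B, hB, h⟩
  · rintro ⟨B, hB, hBne, hBz⟩
    refine ⟨B, ⟨hB, ?_⟩, hBne, hBz⟩
    rw [← trace_coordinateForm]
    exact trace_eq_zero_of_quadTheta_eq_zero ((thetaDifferential_eq_zero_iff b B).mp hBz)

end

end ThetaMap

theorem proposition4p1 (n : ℕ) (Λ : Submodule ℤ (EuclideanSpace ℝ (Fin n)))
    [DiscreteTopology Λ] [IsZLattice ℝ Λ] :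
    -- `det² DΘ_Λ` does not depend on the orthonormal basis and is invariant under isometries
    (∀ h, IsHarmonicONB n h → ∀ z, detDTheta Λ h z ^ 2 = detSqDTheta Λ z) ∧
    (∀ φ : EuclideanSpace ℝ (Fin n) ≃ₗᵢ[ℝ] EuclideanSpace ℝ (Fin n),
      detSqDTheta (Λ.map (φ.toLinearEquiv.toLinearMap.restrictScalars ℤ)) = detSqDTheta Λ) ∧
    -- the differential of the theta map exists, and it is degenerate iff `det² DΘ_Λ = 0`
    (∀ b : Module.Basis (Fin n) ℤ Λ,
      (∀ B : Matrix (Fin n) (Fin n) ℝ, B.IsSymm → ∀ z : ℍ,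
        LineDifferentiableAt ℝ (fun A => thetaMap A z) (latticeGram b) B) ∧
      (detSqDTheta Λ = 0 ↔
        ∃ B ∈ tangentZero (latticeGram b), B ≠ 0 ∧ thetaDifferential (latticeGram b) B = 0) ∧
      (detSqDTheta Λ = 0 ↔
        ∃ B : Matrix (Fin n) (Fin n) ℝ, B.IsSymm ∧ B ≠ 0 ∧
          thetaDifferential (latticeGram b) B = 0)) ∧
    -- modularity for integral lattices of level `N`
    (∀ N : ℕ, IsIntegralLattice Λ → IsLevel Λ N →
      (n % 4 ≠ 3 →
        ∃ f : ModularForm ((CongruenceSubgroup.Gamma0 N).map (Matrix.SpecialLinearGroup.mapGL ℝ))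
            (((n : ℤ) + 2) ^ 2 * n * (n - 1) / 2),
          ⇑f = detSqDTheta Λ) ∧
      (n % 4 = 3 →
        (∃ f : ModularForm ((CongruenceSubgroup.Gamma1 N).map (Matrix.SpecialLinearGroup.mapGL ℝ))
            (((n : ℤ) + 2) ^ 2 * n * (n - 1) / 2),
          ⇑f = detSqDTheta Λ) ∧
        ∀ γ ∈ CongruenceSubgroup.Gamma0 N,
          detSqDTheta Λ ∣[((n : ℤ) + 2) ^ 2 * n * (n - 1) / 2] γ =
            ((ZMod.χ₄ (γ 1 1 : ZMod 4) : ℤ) : ℂ) • detSqDTheta Λ)) := by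
  obtain ⟨b₀⟩ := exists_lattice_basis Λ
  exact ⟨fun h hh z => hh.detDTheta_sq_eq b₀ z, fun φ => detSqDTheta_map b₀ φ,
    fun b => ⟨fun B _ z => (hasLineDerivAt_thetaMap b B z).lineDifferentiableAt,
      detSqDTheta_eq_zero_iff_tangentZero b, detSqDTheta_eq_zero_iff_isSymm b⟩,
    fun N hΛ hN => detSqDTheta_modularity hΛ hN⟩
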